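/- **Proposition 1.3.** Let $M$ be a compact complex manifold with $n=\dim_{\mathbb C}M$. The following are equivalent: 1. There exists a Hermitian metric $g$ on $M$ whose Chern connection $\nabla$ has (unrestricted) holonomy contained in $SU(n)$; that is, for every $x\in M$, the parallel transport of $\nabla$ along every piecewise smooth loop based at $x$ (contractible or not) is a complex linear isometry of $(T_xM,J,g_x)$ with complex determinant $1$. 2. The canonical bundle $K_M=\Lambda^n(T^{1,0}M)^*$ is holomorphically trivial; that is, $K_M$ is isomorphic, as a holomorphic line bundle, to the trivial line bundle $M\times\mathbb C$. Here the Chern connection of $g$ is the unique connection $\nabla$ on $TM$ with $\nabla g=0$ and $\nabla J=0$ whose $(0,1)$-part is the $\bar\partial$-operator of the holomorphic tangent bundle. -/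

import Mathlib

open scoped Manifold ContDiff Bundle Topology

noncomputable section

namespace ChernHolonomy

variable {E : Type*} [NormedAddCommGroup E] [NormedSpace ℂ E]
  {M : Type*} [TopologicalSpace M] [ChartedSpace E M]

/-! Throughout, `M` is a complex manifold modelled on the finite-dimensional complex vector
space `E`: a manifold of class `C^∞` over `ℂ`, that is, with holomorphic changes of charts
(over `ℂ`, being `C^∞` and being holomorphic are the same thing). The same atlas makes `M` a
smooth manifold over `ℝ`. -/

/-- The smooth real manifold underlying a complex manifold. -/
instance isManifold_real [hM : IsManifold 𝓘(ℂ, E) ∞ M] : IsManifold 𝓘(ℝ, E) ∞ M := by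
  apply isManifold_of_contDiffOn
  intro e e' he he'
  have h := contMDiffOn_of_mem_contDiffGroupoid
    ((contDiffGroupoid ∞ 𝓘(ℂ, E)).compatible he he')
  have h2 := h.contDiffOn.restrict_scalars ℝ
  simpa using! h2

/-! ### Complex structure and Hermitian metrics -/

/-- A real tangent vector, seen in the holomorphic tangent space. Both tangent spaces at `x` are
`E`, identified through the same preferred chart at `x`. -/
def complexTangent {x : M} (v : TangentSpace 𝓘(ℝ, E) x) : TangentSpace 𝓘(ℂ, E) x := v

/-- A holomorphic tangent vector, seen in the real tangent space; inverse of `complexTangent`. -/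
def realTangent {x : M} (v : TangentSpace 𝓘(ℂ, E) x) : TangentSpace 𝓘(ℝ, E) x := v

/-- The complex structure `J` on the real tangent spaces. -/
def J {x : M} (v : TangentSpace 𝓘(ℝ, E) x) : TangentSpace 𝓘(ℝ, E) x :=
  realTangent (Complex.I • complexTangent v)

/-- A Hermitian metric on a complex manifold: a smooth Riemannian metric `g` such that
`g(Jv, Jw) = g(v, w)`. Its fundamental form is `ω(v, w) = g(Jv, w)`. -/
structure HermitianMetric (E : Type*) [NormedAddCommGroup E] [NormedSpace ℂ E]
    (M : Type*) [TopologicalSpace M] [ChartedSpace E M] [IsManifold 𝓘(ℂ, E) ∞ M] extends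
    Bundle.ContMDiffRiemannianMetric 𝓘(ℝ, E) ∞ E (fun x : M ↦ TangentSpace 𝓘(ℝ, E) x) where
  inner_J (x : M) (v w : TangentSpace 𝓘(ℝ, E) x) : inner x (J v) (J w) = inner x v w

variable [IsManifold 𝓘(ℂ, E) ∞ M]

/-! ### The Chern connection -/

/-- Connections on the real tangent bundle of `M`. In Mathlib's notation, `D σ x v` is the
derivative `D_v σ` at `x` of a vector field `σ` in the direction `v`. -/
abbrev TangentConnection (E : Type*) [NormedAddCommGroup E] [NormedSpace ℂ E]
    (M : Type*) [TopologicalSpace M] [ChartedSpace E M] [IsManifold 𝓘(ℂ, E) ∞ M] : Type _ :=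
  CovariantDerivative 𝓘(ℝ, E) E (fun x : M ↦ TangentSpace 𝓘(ℝ, E) x)

/-- A vector field is holomorphic near `x`, as a section of the holomorphic tangent bundle. -/
def IsHolomorphicFieldAt (σ : ∀ y : M, TangentSpace 𝓘(ℝ, E) y) (x : M) : Prop :=
  ∀ᶠ y in 𝓝 x, MDifferentiableAt 𝓘(ℂ, E) (𝓘(ℂ, E).prod 𝓘(ℂ, E))
    (fun z ↦ (⟨z, complexTangent (σ z)⟩ : TangentBundle 𝓘(ℂ, E) M)) y

/-- `D` is the Chern connection of the Hermitian metric `g`: the connection on `TM` that is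
complex linear (`DJ = 0`), compatible with the metric (`Dg = 0`), and whose `(0,1)`-part is the
`∂̄`-operator of the holomorphic tangent bundle, i.e. `D σ` is of type `(1,0)` for every local
holomorphic vector field `σ`. -/
structure IsChernConnection (g : HermitianMetric E M)
    (D : TangentConnection E M) : Prop where
  complex (σ : ∀ y : M, TangentSpace 𝓘(ℝ, E) y) (x : M)
    (hσ : MDifferentiableAt 𝓘(ℝ, E) (𝓘(ℝ, E).prod 𝓘(ℝ, E))
      (fun y ↦ (⟨y, σ y⟩ : TangentBundle 𝓘(ℝ, E) M)) x)
    (v : TangentSpace 𝓘(ℝ, E) x) :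
    D (fun y ↦ J (σ y)) x v = J (D σ x v)
  metric (σ τ : ∀ y : M, TangentSpace 𝓘(ℝ, E) y) (x : M)
    (hσ : MDifferentiableAt 𝓘(ℝ, E) (𝓘(ℝ, E).prod 𝓘(ℝ, E))
      (fun y ↦ (⟨y, σ y⟩ : TangentBundle 𝓘(ℝ, E) M)) x)
    (hτ : MDifferentiableAt 𝓘(ℝ, E) (𝓘(ℝ, E).prod 𝓘(ℝ, E))
      (fun y ↦ (⟨y, τ y⟩ : TangentBundle 𝓘(ℝ, E) M)) x)
    (v : TangentSpace 𝓘(ℝ, E) x) :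
    mvfderiv 𝓘(ℝ, E) (fun y ↦ g.inner y (σ y) (τ y)) x v
      = g.inner x (D σ x v) (τ x) + g.inner x (σ x) (D τ x v)
  holomorphic (σ : ∀ y : M, TangentSpace 𝓘(ℝ, E) y) (x : M)
    (hσ : IsHolomorphicFieldAt σ x) (v : TangentSpace 𝓘(ℝ, E) x) :
    D σ x (J v) = J (D σ x v)

/-! ### Parallel transport and holonomy -/

/-- The velocity at `s` of a curve `γ` defined on the set `S` (one-sided at an end point). -/
def velocityWithin (γ : ℝ → M) (S : Set ℝ) (s : ℝ) : TangentSpace 𝓘(ℝ, E) (γ s) :=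
  mfderivWithin 𝓘(ℝ, ℝ) 𝓘(ℝ, E) γ S s ((NormedSpace.fromTangentSpace (𝕜 := ℝ) s).symm (1 : ℝ))

/-- A curve `X` in `TM` (a vector field along the curve `τ ↦ (X τ).proj`) is parallel on the
interval `S`: in every local trivialization `e` of `TM` over a chart of the atlas, its fibre
coordinate `ξ` satisfies `ξ' + A(γ') ξ = 0`, where `γ'` is the velocity of the base curve and
`A(γ') w` is the coordinate of the `D`-derivative along `γ'` of the local vector field with
constant coordinate `w`. -/
def IsParallelOn (D : TangentConnection E M)
    (X : ℝ → TangentBundle 𝓘(ℝ, E) M) (S : Set ℝ) : Prop :=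
  ∀ (e : Bundle.Trivialization E (Bundle.TotalSpace.proj : TangentBundle 𝓘(ℝ, E) M → M))
    [MemTrivializationAtlas e], ∀ s ∈ S, (X s).proj ∈ e.baseSet →
    HasDerivWithinAt (fun τ ↦ (e (X τ)).2)
      (-(e ⟨(X s).proj, D (fun y ↦ e.symm y (e (X s)).2) (X s).proj
          (velocityWithin (fun τ ↦ (X τ).proj) S s)⟩).2) S s

/-- A piecewise smooth loop `[0, 1] → M` based at `x`: for some subdivision
`0 = t 0 ≤ ⋯ ≤ t N = 1` it is smooth on every closed interval `[t i, t (i + 1)]`. -/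
structure PiecewiseSmoothLoop (E : Type*) [NormedAddCommGroup E] [NormedSpace ℂ E]
    {M : Type*} [TopologicalSpace M] [ChartedSpace E M] (x : M) where
  toFun : ℝ → M
  N : ℕ
  t : ℕ → ℝ
  monotone_t : Monotone t
  t_zero : t 0 = 0
  t_last : t N = 1
  smooth : ∀ i < N, ContMDiffOn 𝓘(ℝ, ℝ) 𝓘(ℝ, E) ∞ toFun (Set.Icc (t i) (t (i + 1)))
  source : toFun 0 = x
  target : toFun 1 = x

/-- `X` is a parallel vector field along the loop `γ`. -/
def IsParallelAlong (D : TangentConnection E M)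
    {x : M} (γ : PiecewiseSmoothLoop E x) (X : ℝ → TangentBundle 𝓘(ℝ, E) M) : Prop :=
  (∀ s ∈ Set.Icc (0 : ℝ) 1, (X s).proj = γ.toFun s) ∧
    ∀ i < γ.N, IsParallelOn D X (Set.Icc (γ.t i) (γ.t (i + 1)))

/-- The (unrestricted) holonomy group `Hol_x(D)`: all parallel transports `P` of `T_x M` along
piecewise smooth loops based at `x`. -/
def holonomy (D : TangentConnection E M) (x : M) :
    Set (TangentSpace 𝓘(ℝ, E) x →ₗ[ℝ] TangentSpace 𝓘(ℝ, E) x) :=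
  {P | ∃ γ : PiecewiseSmoothLoop E x, ∀ v : TangentSpace 𝓘(ℝ, E) x,
    ∃ X : ℝ → TangentBundle 𝓘(ℝ, E) M, IsParallelAlong D γ X ∧ X 0 = ⟨x, v⟩ ∧ X 1 = ⟨x, P v⟩}

/-- The special unitary group of `(T_x M, J, g)`, isomorphic to `SU(n)` through any unitary frame:
complex linear isometries of complex determinant one. -/
def specialUnitary (g : HermitianMetric E M) (x : M) :
    Set (TangentSpace 𝓘(ℝ, E) x →ₗ[ℝ] TangentSpace 𝓘(ℝ, E) x) :=
  {P | (∀ v w, g.inner x (P v) (P w) = g.inner x v w) ∧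
    ∃ Q : TangentSpace 𝓘(ℂ, E) x →ₗ[ℂ] TangentSpace 𝓘(ℂ, E) x,
      (∀ v, Q (complexTangent v) = complexTangent (P v)) ∧ LinearMap.det Q = 1}

/-! ### The canonical bundle -/

/-- A holomorphic line bundle `V` (with model fibre `F`) on `M` is holomorphically trivial: there
are linear isomorphisms `V x ≃ ℂ` that together form a biholomorphic map of total spaces onto the
trivial line bundle. -/
def IsHolomorphicallyTrivial (F : Type*) [NormedAddCommGroup F] [NormedSpace ℂ F]
    (V : M → Type*) [TopologicalSpace (Bundle.TotalSpace F V)] [∀ x, AddCommGroup (V x)]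
    [∀ x, Module ℂ (V x)] [∀ x, TopologicalSpace (V x)] [FiberBundle F V] : Prop :=
  ∃ Φ : ∀ x, V x ≃ₗ[ℂ] ℂ,
    ContMDiff (𝓘(ℂ, E).prod 𝓘(ℂ, F)) (𝓘(ℂ, E).prod 𝓘(ℂ, ℂ)) ∞
      (fun p : Bundle.TotalSpace F V ↦
        (⟨p.proj, Φ p.proj p.2⟩ : Bundle.TotalSpace ℂ (Bundle.Trivial M ℂ))) ∧
    ContMDiff (𝓘(ℂ, E).prod 𝓘(ℂ, ℂ)) (𝓘(ℂ, E).prod 𝓘(ℂ, F)) ∞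
      (fun q : Bundle.TotalSpace ℂ (Bundle.Trivial M ℂ) ↦
        (⟨q.proj, (Φ q.proj).symm q.2⟩ : Bundle.TotalSpace F V))

/-- The fibres of the canonical bundle `K_M = Λⁿ(T^{1,0}M)^*` of a complex manifold of
dimension `n`, modelled on the `n`-dimensional space `E`: complex alternating
`n`-forms on the holomorphic tangent spaces. The bundle structure is Mathlib's one on alternating
maps from the holomorphic tangent bundle to the trivial line bundle. -/
abbrev CanonicalFibre (n : ℕ) (E : Type*) [NormedAddCommGroup E] [NormedSpace ℂ E]
    (M : Type*) [TopologicalSpace M] [ChartedSpace E M] (x : M) : Type _ :=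
  TangentSpace 𝓘(ℂ, E) x [⋀^Fin n]→L[ℂ] Bundle.Trivial M ℂ x

end ChernHolonomy

end

/-!
# Special unitary holonomy of Chern connections and triviality of the canonical bundle

Fix a basis `b` of the model space `E`. Mathlib identifies every tangent space with `E`, so that an
`n`-form on `M` is the same thing as its values `κ x` on `b`, a *density* `κ : M → ℂ`; in a chart
`c` its coefficient is `densityInChart κ c`, which is `κ` times the determinant of the coordinate
frame. A holomorphic trivialization of `K_M` is a nowhere vanishing density with holomorphic
coefficients (`isHolomorphicallyTrivial_of_density`, `exists_density_of_isHolomorphicallyTrivial`).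

Let `h` be the metric in a chart. The three axioms of a Chern connection force its connection form
to be `A = h⁻¹ ∂h` (`chernForm`, `IsChernConnection.apply_frameField`), and conversely these forms
define a connection (`chernConnection`). All that matters about `A` is that it is complex linear in
the direction of differentiation, complex linear as an endomorphism, and compatible with `h`.

*From holonomy to a volume form.* When the holonomy is special unitary, transports along closed
piecewise smooth paths have determinant one. Choosing a base point in each class of points that are
joined by such paths, and a transport from each point `x` to it, the determinants of these
transports form a density `κ` that is invariant under parallel transport (`exists_density`). In a
chart, invariance along the short segment from `z` to `z + v`, where transport is `1 - A z v` up to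
`o(v)` (`hasFDerivAt_of_fundamental_solution`), says that the coefficient `f` of the density
satisfies `df = f · tr A`. Hence `f` is smooth, by induction on the order of differentiability, and its
derivative is complex linear because `A` is of type `(1, 0)`: it is holomorphic
(`contDiffOn_of_transport`, `contDiffOn_density`).

*From a volume form to holonomy.* Start from any Hermitian metric, which exists by a partition of
unity, and rescale it conformally so that its Gram determinant in the basis `b` is `|κ|²`
(`exists_metric_gramDet_eq`). In a chart this reads `det h = |f|²` with `f` holomorphic. Taking
logarithmic derivatives, `2 Re tr A = 2 Re (df / f)`; both `tr A` and `df / f` are complex linear in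
the direction, so that `df = f · tr A` (`fderiv_eq_mul_traceForm`). This is the statement that the
volume form is parallel (`hasDerivWithinAt_density_mul_det`), so that holonomy, which is always
complex linear and isometric, has determinant one (`det_holonomy_eq_one`). For `n = 0` no rescaling
is possible, and every determinant is one.
-/

noncomputable section

namespace ChernHolonomy

set_option maxSynthPendingDepth 3

/-! ### Coordinate frames -/

section

variable {E : Type*} [NormedAddCommGroup E] [NormedSpace ℂ E]
  {M : Type*} [TopologicalSpace M] [ChartedSpace E M]

/-- The frame of the holomorphic tangent bundle given by the chart `c`: the complex linear map
sending coordinates with respect to `c` to tangent vectors at `y`. Tangent vectors at `y` are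
elements of `E` through the preferred chart at `y`. -/
def frame (c : OpenPartialHomeomorph M E) (y : M) : E →L[ℂ] E :=
  fderiv ℂ (chartAt E y ∘ c.symm) (c y)

/-- The inverse of `frame c y`: coordinates of tangent vectors at `y` in the chart `c`. -/
def coframe (c : OpenPartialHomeomorph M E) (y : M) : E →L[ℂ] E :=
  fderiv ℂ (c ∘ (chartAt E y).symm) (chartAt E y y)

section transition

variable {c c' : OpenPartialHomeomorph M E}

omit [NormedSpace ℂ E] [ChartedSpace E M] in
theorem transition_comp_eventuallyEq {F : Type*} (f : M → F) {y : M} (hy : y ∈ c.source)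
    (hy' : y ∈ c'.source) :
    f ∘ c.symm =ᶠ[𝓝 (c y)] (f ∘ c'.symm) ∘ (c' ∘ c.symm) := by
  have : ∀ᶠ z in 𝓝 (c y), c.symm z ∈ c'.source :=
    (c.continuousAt_symm (c.map_source hy)).eventually
      (c'.open_source.mem_nhds (by rwa [c.left_inv hy]))
  filter_upwards [this] with z hz
  simp [c'.left_inv hz]

omit [ChartedSpace E M] in
theorem fderiv_transition_self {y : M} (hy : y ∈ c.source) :
    fderiv ℂ (c ∘ c.symm) (c y) = ContinuousLinearMap.id ℂ E := by
  rw [← fderiv_id (𝕜 := ℂ) (x := c y)]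
  apply Filter.EventuallyEq.fderiv_eq
  filter_upwards [c.open_target.mem_nhds (c.map_source hy)] with z hz
  simp [c.right_inv hz]

theorem frame_chartAt (y : M) : frame (chartAt E y) y = ContinuousLinearMap.id ℂ E :=
  fderiv_transition_self (mem_chart_source E y)

theorem coframe_chartAt (y : M) : coframe (chartAt E y) y = ContinuousLinearMap.id ℂ E :=
  fderiv_transition_self (mem_chart_source E y)

variable [IsManifold 𝓘(ℂ, E) ∞ M]

theorem contDiffAt_transition (hc : c ∈ atlas E M) (hc' : c' ∈ atlas E M) {y : M}
    (hy : y ∈ c.source) (hy' : y ∈ c'.source) : ContDiffAt ℂ ∞ (c' ∘ c.symm) (c y) := by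
  have h := (contMDiffOn_of_mem_contDiffGroupoid
    ((contDiffGroupoid ∞ 𝓘(ℂ, E)).compatible hc hc')).contDiffOn
  refine h.contDiffAt ((c.symm ≫ₕ c').open_source.mem_nhds ?_)
  simp [hy, hy']

theorem differentiableAt_transition (hc : c ∈ atlas E M) (hc' : c' ∈ atlas E M) {y : M}
    (hy : y ∈ c.source) (hy' : y ∈ c'.source) : DifferentiableAt ℂ (c' ∘ c.symm) (c y) :=
  (contDiffAt_transition hc hc' hy hy').differentiableAt (by simp)

/-- The cocycle relation for derivatives of changes of charts. -/
theorem fderiv_transition_comp {c'' : OpenPartialHomeomorph M E} (hc : c ∈ atlas E M)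
    (hc' : c' ∈ atlas E M) (hc'' : c'' ∈ atlas E M) {y : M}
    (hy : y ∈ c.source) (hy' : y ∈ c'.source) (hy'' : y ∈ c''.source) :
    fderiv ℂ (c'' ∘ c.symm) (c y)
      = (fderiv ℂ (c'' ∘ c'.symm) (c' y)).comp (fderiv ℂ (c' ∘ c.symm) (c y)) := by
  rw [(transition_comp_eventuallyEq c'' hy hy').fderiv_eq, fderiv_comp]
  · simp [c.left_inv hy]
  · simpa [c.left_inv hy] using differentiableAt_transition hc' hc'' hy' hy''
  · exact differentiableAt_transition hc hc' hy hy'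

@[simp] theorem coframe_frame (hc : c ∈ atlas E M) {y : M} (hy : y ∈ c.source) (v : E) :
    coframe c y (frame c y v) = v := by
  have := fderiv_transition_comp hc (chart_mem_atlas E y) hc hy (mem_chart_source E y) hy
  rw [fderiv_transition_self hy] at this
  exact (congrArg (fun L : E →L[ℂ] E ↦ L v) this).symm

@[simp] theorem frame_coframe (hc : c ∈ atlas E M) {y : M} (hy : y ∈ c.source) (v : E) :
    frame c y (coframe c y v) = v := by
  have := fderiv_transition_comp (chart_mem_atlas E y) hc (chart_mem_atlas E y)
    (mem_chart_source E y) hy (mem_chart_source E y)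
  rw [fderiv_transition_self (mem_chart_source E y)] at this
  exact (congrArg (fun L : E →L[ℂ] E ↦ L v) this).symm

/-- Frames of two charts differ by the derivative of the change of charts. -/
theorem frame_eq_frame_comp (hc : c ∈ atlas E M) (hc' : c' ∈ atlas E M) {y : M}
    (hy : y ∈ c.source) (hy' : y ∈ c'.source) :
    frame c y = (frame c' y).comp (fderiv ℂ (c' ∘ c.symm) (c y)) :=
  fderiv_transition_comp hc hc' (chart_mem_atlas E y) hy hy' (mem_chart_source E y)

theorem coframe_eq_comp_coframe (hc : c ∈ atlas E M) (hc' : c' ∈ atlas E M) {y : M}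
    (hy : y ∈ c.source) (hy' : y ∈ c'.source) :
    coframe c' y = (fderiv ℂ (c' ∘ c.symm) (c y)).comp (coframe c y) :=
  fderiv_transition_comp (chart_mem_atlas E y) hc hc' (mem_chart_source E y) hy hy'

end transition

theorem fderiv_real_eq {F : Type*} [NormedAddCommGroup F] [NormedSpace ℂ F] {f : E → F} {z : E}
    (h : DifferentiableAt ℂ f z) (v : E) : fderiv ℝ f z v = fderiv ℂ f z v := by
  rw [h.fderiv_restrictScalars ℝ]; rfl

section trivialization

variable [IsManifold 𝓘(ℂ, E) ∞ M]

theorem coordChange_real (i j : atlas E M) {y : M} (hy : y ∈ i.1.source) (hy' : y ∈ j.1.source)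
    (v : E) : (tangentBundleCore 𝓘(ℝ, E) M).coordChange i j y v
      = fderiv ℂ (j.1 ∘ i.1.symm) (i.1 y) v := by
  simp only [tangentBundleCore_coordChange, mfld_simps]
  rw [fderivWithin_univ]
  exact fderiv_real_eq (differentiableAt_transition i.2 j.2 hy hy') _

theorem coordChange_complex (i j : atlas E M) (y : M) (v : E) :
    (tangentBundleCore 𝓘(ℂ, E) M).coordChange i j y v
      = fderiv ℂ (j.1 ∘ i.1.symm) (i.1 y) v := by
  simp only [tangentBundleCore_coordChange, mfld_simps]
  rw [fderivWithin_univ]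

/-- The trivializations of the real tangent bundle are given by the frames of the charts. -/
theorem exists_chart_of_memTrivializationAtlas
    (e : Bundle.Trivialization E (Bundle.TotalSpace.proj : TangentBundle 𝓘(ℝ, E) M → M))
    [he : MemTrivializationAtlas e] :
    ∃ c ∈ atlas E M, e.baseSet = c.source ∧
      (∀ p : TangentBundle 𝓘(ℝ, E) M, p.proj ∈ c.source → (e p).2 = coframe c p.proj p.2) ∧
      ∀ y ∈ c.source, ∀ w, e.symm y w = frame c y w := by
  obtain ⟨i, rfl⟩ : ∃ i, (tangentBundleCore 𝓘(ℝ, E) M).localTriv i = e := he.out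
  refine ⟨i.1, i.2, rfl, fun p hp ↦ ?_, fun y hy w ↦ ?_⟩
  · exact coordChange_real (achart E p.proj) i (mem_chart_source E _) hp p.2
  · exact ((tangentBundleCore 𝓘(ℝ, E) M).localTriv_symm_apply i hy w).trans
      (coordChange_real i (achart E y) hy (mem_chart_source E _) w)

theorem trivializationAt_real_apply {x : M} {p : TangentBundle 𝓘(ℝ, E) M}
    (hp : p.proj ∈ (chartAt E x).source) :
    (trivializationAt E (TangentSpace 𝓘(ℝ, E)) x p).2 = coframe (chartAt E x) p.proj p.2 :=
  coordChange_real (achart E p.proj) (achart E x) (mem_chart_source E _) hp p.2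

theorem trivializationAt_real_symm {x y : M} (hy : y ∈ (chartAt E x).source) (w : E) :
    (trivializationAt E (TangentSpace 𝓘(ℝ, E)) x).symm y w = frame (chartAt E x) y w :=
  ((tangentBundleCore 𝓘(ℝ, E) M).localTriv_symm_apply (achart E x) hy w).trans
    (coordChange_real (achart E x) (achart E y) hy (mem_chart_source E _) w)

theorem trivializationAt_complex_apply (x : M) (p : TangentBundle 𝓘(ℂ, E) M) :
    (trivializationAt E (TangentSpace 𝓘(ℂ, E)) x p).2 = coframe (chartAt E x) p.proj p.2 :=
  coordChange_complex (achart E p.proj) (achart E x) p.proj p.2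

theorem trivializationAt_complex_symm {x y : M} (hy : y ∈ (chartAt E x).source) (w : E) :
    (trivializationAt E (TangentSpace 𝓘(ℂ, E)) x).symm y w = frame (chartAt E x) y w :=
  ((tangentBundleCore 𝓘(ℂ, E) M).localTriv_symm_apply (achart E x) hy w).trans
    (coordChange_complex (achart E x) (achart E y) y w)

end trivialization

section derivatives

variable [IsManifold 𝓘(ℂ, E) ∞ M] {c : OpenPartialHomeomorph M E}
  {F : Type*} [NormedAddCommGroup F] [NormedSpace ℝ F]

theorem hasFDerivAt_comp_symm (hc : c ∈ atlas E M) {y : M} (hy : y ∈ c.source) {f : M → F}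
    (hf : MDifferentiableAt 𝓘(ℝ, E) 𝓘(ℝ, F) f y) :
    HasFDerivAt (f ∘ c.symm) ((show E →L[ℝ] F from mvfderiv 𝓘(ℝ, E) f y).comp
      ((frame c y).restrictScalars ℝ)) (c y) := by
  have h1 : HasFDerivAt (f ∘ (chartAt E y).symm) (show E →L[ℝ] F from mvfderiv 𝓘(ℝ, E) f y)
      (chartAt E y y) := by
    have := hf.hasMFDerivAt.2
    simp only [mfld_simps] at this
    exact hasFDerivWithinAt_univ.1 this
  have h2 : HasFDerivAt (chartAt E y ∘ c.symm) ((frame c y).restrictScalars ℝ) (c y) :=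
    (differentiableAt_transition hc (chart_mem_atlas E y) hy
      (mem_chart_source E y)).hasFDerivAt.restrictScalars ℝ
  refine HasFDerivAt.congr_of_eventuallyEq ?_
    (transition_comp_eventuallyEq f hy (mem_chart_source E y))
  refine HasFDerivAt.comp _ ?_ h2
  simpa [c.left_inv hy] using h1

theorem mvfderiv_frame (hc : c ∈ atlas E M) {y : M} (hy : y ∈ c.source) {f : M → F}
    (hf : MDifferentiableAt 𝓘(ℝ, E) 𝓘(ℝ, F) f y) (v : E) :
    mvfderiv 𝓘(ℝ, E) f y (frame c y v) = fderiv ℝ (f ∘ c.symm) (c y) v := by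
  rw [(hasFDerivAt_comp_symm hc hy hf).fderiv]; rfl

/-- The expression of a curve in a chart has the coordinates of the velocity as its derivative. -/
theorem hasDerivWithinAt_chart_comp (hc : c ∈ atlas E M) {γ : ℝ → M} {S : Set ℝ} {s : ℝ}
    (hs : γ s ∈ c.source) (hγ : MDifferentiableWithinAt 𝓘(ℝ, ℝ) 𝓘(ℝ, E) γ S s) :
    HasDerivWithinAt (c ∘ γ) (coframe c (γ s) (velocityWithin γ S s)) S s := by
  have h1 : HasDerivWithinAt (chartAt E (γ s) ∘ γ) (show E from velocityWithin γ S s) S s := by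
    have := hγ.hasMFDerivWithinAt.2
    simp only [mfld_simps] at this
    exact HasFDerivWithinAt.hasDerivWithinAt this
  have h2 : HasFDerivAt (c ∘ (chartAt E (γ s)).symm) ((coframe c (γ s)).restrictScalars ℝ)
      (chartAt E (γ s) (γ s)) :=
    (differentiableAt_transition (chart_mem_atlas E _) hc
      (mem_chart_source E _) hs).hasFDerivAt.restrictScalars ℝ
  have h3 := h2.comp_hasDerivWithinAt s h1
  refine h3.congr_of_eventuallyEq ?_ (by simp)
  have : ∀ᶠ t in 𝓝[S] s, γ t ∈ (chartAt E (γ s)).source :=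
    hγ.continuousWithinAt.eventually
      ((chartAt E (γ s)).open_source.mem_nhds (mem_chart_source E _))
  filter_upwards [this] with t ht
  simp [(chartAt E (γ s)).left_inv ht]

end derivatives

end

/-! ### The Chern form of a Hermitian metric on a complex vector space -/

section

section linear

variable {E : Type*} [NormedAddCommGroup E] [NormedSpace ℂ E]
  {F : Type*} [NormedAddCommGroup F] [NormedSpace ℂ F]

/-- Real bilinear forms that are symmetric and invariant under multiplication by `i`: the real
parts of Hermitian forms. -/
structure IsHermitianForm (B : E →L[ℝ] E →L[ℝ] ℝ) : Prop where
  symm (v w : E) : B v w = B w v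
  I_smul_I_smul (v w : E) : B (Complex.I • v) (Complex.I • w) = B v w

theorem I_smul_I_smul_eq_neg (v : E) : Complex.I • Complex.I • v = -v := by
  rw [smul_smul, Complex.I_mul_I, neg_one_smul]

theorem IsHermitianForm.I_smul_left {B : E →L[ℝ] E →L[ℝ] ℝ} (hB : IsHermitianForm B) (v w : E) :
    B (Complex.I • v) w = -B v (Complex.I • w) := by
  rw [← hB.I_smul_I_smul (Complex.I • v), I_smul_I_smul_eq_neg]; simp

theorem map_smul_of_map_I_smul (L : E →ₗ[ℝ] F)
    (h : ∀ v, L (Complex.I • v) = Complex.I • L v) (a : ℂ) (v : E) : L (a • v) = a • L v := by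
  have key (v : E) : a • v = a.re • v + a.im • Complex.I • v := by
    conv_lhs => rw [← Complex.re_add_im a]
    rw [add_smul, mul_smul]; simp [Complex.coe_smul]
  have key' (v : F) : a • v = a.re • v + a.im • Complex.I • v := by
    conv_lhs => rw [← Complex.re_add_im a]
    rw [add_smul, mul_smul]; simp [Complex.coe_smul]
  rw [key, key', map_add, map_smul, map_smul, h]

/-- A real linear map commuting with multiplication by `i`, as a complex linear map. -/
def toComplexLinear (L : E →L[ℝ] F) (h : ∀ v, L (Complex.I • v) = Complex.I • L v) : E →L[ℂ] F where
  toFun := L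
  map_add' := L.map_add
  map_smul' := map_smul_of_map_I_smul (L : E →ₗ[ℝ] F) h
  cont := L.continuous

/-- Multiplication by `i`. -/
def mulI : E →L[ℝ] E := (Complex.I • ContinuousLinearMap.id ℂ E).restrictScalars ℝ

@[simp] theorem mulI_apply (v : E) : mulI v = Complex.I • v := rfl

theorem complexPart_aux (L : E →L[ℝ] F) (v : E) :
    ((2⁻¹ : ℝ) • (L - mulI.comp (L.comp mulI))) (Complex.I • v)
      = Complex.I • ((2⁻¹ : ℝ) • (L - mulI.comp (L.comp mulI))) v := by
  simp only [smul_apply, sub_apply, ContinuousLinearMap.comp_apply, mulI_apply,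
    I_smul_I_smul_eq_neg, map_neg, sub_neg_eq_add]
  rw [smul_comm Complex.I, smul_sub, I_smul_I_smul_eq_neg, sub_neg_eq_add, add_comm]

/-- The complex linear part `v ↦ (L v - i L (i v)) / 2` of a real linear map. -/
def complexPart : (E →L[ℝ] F) →L[ℝ] (E →L[ℂ] F) :=
  LinearMap.mkContinuous
    { toFun := fun L ↦ toComplexLinear _ (complexPart_aux L)
      map_add' := fun L L' ↦ by
        ext v
        change (2⁻¹ : ℝ) • (L v + L' v - Complex.I • (L (Complex.I • v) + L' (Complex.I • v)))
          = (2⁻¹ : ℝ) • (L v - Complex.I • L (Complex.I • v))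
            + (2⁻¹ : ℝ) • (L' v - Complex.I • L' (Complex.I • v))
        rw [← smul_add, smul_add Complex.I]; congr 1; abel
      map_smul' := fun a L ↦ by
        ext v
        change (2⁻¹ : ℝ) • (a • L v - Complex.I • a • L (Complex.I • v))
          = a • (2⁻¹ : ℝ) • (L v - Complex.I • L (Complex.I • v))
        rw [smul_comm Complex.I, ← smul_sub, smul_comm] } 1 (fun L ↦ by
    rw [one_mul]
    refine ContinuousLinearMap.opNorm_le_bound _ (norm_nonneg _) fun v ↦ ?_
    change ‖(2⁻¹ : ℝ) • (L v - Complex.I • L (Complex.I • v))‖ ≤ _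
    rw [norm_smul]
    have h1 := L.le_opNorm v
    have h2 := L.le_opNorm (Complex.I • v)
    rw [norm_smul, Complex.norm_I, one_mul] at h2
    have h3 := norm_sub_le (L v) (Complex.I • L (Complex.I • v))
    rw [norm_smul, Complex.norm_I, one_mul] at h3
    rw [Real.norm_of_nonneg (by norm_num)]
    linarith)

theorem complexPart_apply_of_map_I_smul {L : E →L[ℝ] F}
    (h : ∀ v, L (Complex.I • v) = Complex.I • L v) (v : E) : complexPart L v = L v := by
  change (2⁻¹ : ℝ) • (L v - Complex.I • L (Complex.I • v)) = L v
  rw [h, I_smul_I_smul_eq_neg]; module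

variable [FiniteDimensional ℂ E]

/-- A positive form on a finite-dimensional space identifies it with its dual. -/
theorem isInvertible_of_pos {B : E →L[ℝ] E →L[ℝ] ℝ} (hB : ∀ v, v ≠ 0 → 0 < B v v) :
    B.IsInvertible := by
  have : FiniteDimensional ℝ E := FiniteDimensional.complexToReal E
  have hinj : Function.Injective B := by
    refine (injective_iff_map_eq_zero B).2 fun v hv ↦ ?_
    by_contra h
    simpa [hv] using hB v h
  have hfin : Module.finrank ℝ E = Module.finrank ℝ (E →L[ℝ] ℝ) := by
    rw [← (LinearMap.toContinuousLinearMap (𝕜 := ℝ) (E := E) (F' := ℝ)).finrank_eq]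
    exact (Subspace.dual_finrank_eq (K := ℝ) (V := E)).symm
  have : FiniteDimensional ℝ (E →L[ℝ] ℝ) :=
    (LinearMap.toContinuousLinearMap (𝕜 := ℝ) (E := E) (F' := ℝ)).finiteDimensional
  exact ⟨(LinearMap.linearEquivOfInjective (B : E →ₗ[ℝ] E →L[ℝ] ℝ) hinj
    hfin).toContinuousLinearEquiv, by ext; rfl⟩

/-- The Chern form. For a metric with value `B` and derivative `B'` at a point of `E`, it is the
connection form `A` determined by `B (A v w) u = (B' v w u + B' (i v) w (i u)) / 2`, the real form
of the familiar `h⁻¹ ∂h`. -/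
def chernForm (B : E →L[ℝ] E →L[ℝ] ℝ) (B' : E →L[ℝ] E →L[ℝ] E →L[ℝ] ℝ) : E →L[ℝ] E →L[ℝ] E :=
  (ContinuousLinearMap.compL ℝ E (E →L[ℝ] ℝ) E B.inverse).comp
    ((2⁻¹ : ℝ) • (B' + (ContinuousLinearMap.compL ℝ E (E →L[ℝ] ℝ) (E →L[ℝ] ℝ)
      ((ContinuousLinearMap.compL ℝ E E ℝ).flip mulI)).comp (B'.comp mulI)))

section
variable {B : E →L[ℝ] E →L[ℝ] ℝ} {B' : E →L[ℝ] E →L[ℝ] E →L[ℝ] ℝ}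

omit [FiniteDimensional ℂ E] in
theorem chernForm_apply (v w : E) : chernForm B B' v w
    = B.inverse ((2⁻¹ : ℝ) • (B' v w + (B' (Complex.I • v) w).comp mulI)) := rfl

theorem apply_chernForm (hB : ∀ v, v ≠ 0 → 0 < B v v) (v w u : E) :
    B (chernForm B B' v w) u = 2⁻¹ * (B' v w u + B' (Complex.I • v) w (Complex.I • u)) := by
  obtain ⟨e, he⟩ := isInvertible_of_pos hB
  have : ∀ l : E →L[ℝ] ℝ, B (B.inverse l) = l := fun l ↦ by
    rw [← he, ContinuousLinearMap.inverse_equiv]; exact e.apply_symm_apply l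
  rw [chernForm_apply, this]
  rfl

omit [FiniteDimensional ℂ E] in
theorem eq_of_forall_form_eq (hB : ∀ v, v ≠ 0 → 0 < B v v) {a b : E} (h : ∀ u, B a u = B b u) :
    a = b := by
  by_contra hab
  have h1 := hB (a - b) (sub_ne_zero.2 hab)
  have h2 : B (a - b) (a - b) = B a (a - b) - B b (a - b) := by
    rw [map_sub B]; rfl
  rw [h2, h, sub_self] at h1
  exact lt_irrefl _ h1

theorem chernForm_I_smul_left (hB : ∀ v, v ≠ 0 → 0 < B v v) (hB' : IsHermitianForm B) (v w : E) :
    chernForm B B' (Complex.I • v) w = Complex.I • chernForm B B' v w := by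
  refine eq_of_forall_form_eq hB fun u ↦ ?_
  rw [hB'.I_smul_left, apply_chernForm hB, apply_chernForm hB, I_smul_I_smul_eq_neg,
    I_smul_I_smul_eq_neg]
  have : B' (-v) w (Complex.I • u) = -B' v w (Complex.I • u) := by rw [map_neg]; rfl
  rw [this, map_neg]; ring

theorem chernForm_I_smul_right (hB : ∀ v, v ≠ 0 → 0 < B v v) (hB' : IsHermitianForm B)
    (hB'' : ∀ v, IsHermitianForm (B' v)) (v w : E) :
    chernForm B B' v (Complex.I • w) = Complex.I • chernForm B B' v w := by
  refine eq_of_forall_form_eq hB fun u ↦ ?_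
  rw [hB'.I_smul_left, apply_chernForm hB, apply_chernForm hB, (hB'' _).I_smul_left,
    (hB'' _).I_smul_left]
  ring

/-- The Chern form is compatible with the metric. -/
theorem metric_chernForm (hB : ∀ v, v ≠ 0 → 0 < B v v) (hB' : IsHermitianForm B)
    (hB'' : ∀ v, IsHermitianForm (B' v)) (v w u : E) :
    B' v w u = B (chernForm B B' v w) u + B w (chernForm B B' v u) := by
  rw [hB'.symm w, apply_chernForm hB, apply_chernForm hB, (hB'' v).symm u w,
    (hB'' _).symm u, (hB'' _).I_smul_left]
  ring

end

/-- The Chern form transforms as a connection form under a holomorphic change of coordinates. -/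
theorem chernForm_transition {G₁ G₂ : E → E →L[ℝ] E →L[ℝ] ℝ} {ψ : E → E} {z : E}
    (hψ : DifferentiableAt ℂ ψ z) (hC : DifferentiableAt ℂ (fderiv ℂ ψ) z)
    (hG₁ : DifferentiableAt ℝ G₁ z) (hG₂ : DifferentiableAt ℝ G₂ (ψ z))
    (hpos₁ : ∀ v, v ≠ 0 → 0 < G₁ z v v) (hpos₂ : ∀ v, v ≠ 0 → 0 < G₂ (ψ z) v v)
    (hherm : IsHermitianForm (G₂ (ψ z)))
    (hinj : Function.Surjective (fderiv ℂ ψ z))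
    (h : ∀ᶠ y in 𝓝 z, ∀ w u, G₁ y w u = G₂ (ψ y) (fderiv ℂ ψ y w) (fderiv ℂ ψ y u)) (v w : E) :
    fderiv ℂ ψ z (chernForm (G₁ z) (fderiv ℝ G₁ z) v w)
      = chernForm (G₂ (ψ z)) (fderiv ℝ G₂ (ψ z)) (fderiv ℂ ψ z v) (fderiv ℂ ψ z w)
        + fderiv ℂ (fderiv ℂ ψ) z v w := by
  set C := fderiv ℂ ψ with hCdef
  set C' := fderiv ℂ C z
  have hd (v w u : E) : fderiv ℝ G₁ z v w u = fderiv ℝ G₂ (ψ z) (C z v) (C z w) (C z u)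
      + G₂ (ψ z) (C' v w) (C z u) + G₂ (ψ z) (C z w) (C' v u) := by
    have h1 : HasFDerivAt (fun y ↦ G₁ y w u)
        (((fderiv ℝ G₁ z).flip w).flip u) z := by
      have := (hG₁.hasFDerivAt.clm_apply (hasFDerivAt_const w z)).clm_apply (hasFDerivAt_const u z)
      simpa using this
    have hCw (w : E) : HasFDerivAt (fun y ↦ C y w)
        ((C'.flip w).restrictScalars ℝ) z := by
      have := (hC.hasFDerivAt.clm_apply (hasFDerivAt_const w z)).restrictScalars ℝ
      simpa using this
    have h2 : HasFDerivAt (fun y ↦ G₂ (ψ y)) ((fderiv ℝ G₂ (ψ z)).comp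
        ((C z).restrictScalars ℝ)) z :=
      hG₂.hasFDerivAt.comp z (hψ.hasFDerivAt.restrictScalars ℝ)
    have h3 := (h2.clm_apply (hCw w)).clm_apply (hCw u)
    have h4 := h1.unique (h3.congr_of_eventuallyEq (h.mono fun y hy ↦ hy w u))
    have h5 := congrArg (fun L : E →L[ℝ] ℝ ↦ L v) h4
    simp only [ContinuousLinearMap.comp_apply,
      add_apply, ContinuousLinearMap.flip_apply,
      ContinuousLinearMap.coe_restrictScalars'] at h5
    rw [h5]; ring
  refine eq_of_forall_form_eq hpos₂ fun u ↦ ?_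
  obtain ⟨u, rfl⟩ := hinj u
  rw [← h.self_of_nhds, apply_chernForm hpos₁, map_add, add_apply,
    apply_chernForm hpos₂, hd, hd]
  simp only [map_smul, smul_apply, hherm.I_smul_I_smul]
  rw [I_smul_I_smul_eq_neg]
  simp; ring

/-- The Chern form of a smooth metric is smooth. -/
theorem contDiffAt_chernForm {G : E → E →L[ℝ] E →L[ℝ] ℝ} {z : E} (hG : ContDiffAt ℝ ∞ G z)
    (hpos : ∀ v, v ≠ 0 → 0 < G z v v) :
    ContDiffAt ℝ ∞ (fun y ↦ chernForm (G y) (fderiv ℝ G y)) z := by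
  have : FiniteDimensional ℝ E := FiniteDimensional.complexToReal E
  have : CompleteSpace E := FiniteDimensional.complete ℝ E
  have h1 : ContDiffAt ℝ ∞ (fun y ↦ (G y).inverse) z := by
    obtain ⟨e, he⟩ := isInvertible_of_pos hpos
    exact ContDiffAt.comp z (he ▸ contDiffAt_map_inverse e) hG
  have h2 : ContDiffAt ℝ ∞ (fderiv ℝ G) z := hG.fderiv_right (by simp)
  unfold chernForm
  fun_prop

end linear

end

/-! ### Frame fields -/

section

variable {E : Type*} [NormedAddCommGroup E] [NormedSpace ℂ E]
  {M : Type*} [TopologicalSpace M] [ChartedSpace E M] [IsManifold 𝓘(ℂ, E) ∞ M]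
  {c : OpenPartialHomeomorph M E}

theorem contMDiffOn_frame (hc : c ∈ atlas E M) (w : E) :
    ContMDiffOn 𝓘(ℝ, E) (𝓘(ℝ, E).prod 𝓘(ℝ, E)) ∞
      (fun y ↦ (⟨y, frame c y w⟩ : TangentBundle 𝓘(ℝ, E) M)) c.source := by
  let e : Bundle.Trivialization E (Bundle.TotalSpace.proj : TangentBundle 𝓘(ℝ, E) M → M) :=
    (tangentBundleCore 𝓘(ℝ, E) M).localTriv ⟨c, hc⟩
  have he : MemTrivializationAtlas e := ⟨⟨⟨c, hc⟩, rfl⟩⟩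
  have h1 : ContMDiffOn 𝓘(ℝ, E) (𝓘(ℝ, E).prod 𝓘(ℝ, E)) ∞
      (fun y ↦ (⟨y, e.symm y w⟩ : TangentBundle 𝓘(ℝ, E) M)) e.baseSet := by
    rw [e.contMDiffOn_section_baseSet_iff]
    refine contMDiffOn_const (c := w) |>.congr fun y hy ↦ ?_
    rw [e.apply_mk_symm hy]
  refine h1.congr fun y hy ↦ ?_
  congr 1
  exact (((tangentBundleCore 𝓘(ℝ, E) M).localTriv_symm_apply ⟨c, hc⟩ hy w).trans
      (coordChange_real ⟨c, hc⟩ (achart E y) hy (mem_chart_source E _) w)).symm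

theorem mdifferentiableAt_frame_complex (hc : c ∈ atlas E M) (w : E) {x : M} (hx : x ∈ c.source) :
    MDifferentiableAt 𝓘(ℂ, E) (𝓘(ℂ, E).prod 𝓘(ℂ, E))
      (fun y ↦ (⟨y, frame c y w⟩ : TangentBundle 𝓘(ℂ, E) M)) x := by
  let e : Bundle.Trivialization E (Bundle.TotalSpace.proj : TangentBundle 𝓘(ℂ, E) M → M) :=
    (tangentBundleCore 𝓘(ℂ, E) M).localTriv ⟨c, hc⟩
  have he : MemTrivializationAtlas e := ⟨⟨⟨c, hc⟩, rfl⟩⟩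
  have h1 : ContMDiffOn 𝓘(ℂ, E) (𝓘(ℂ, E).prod 𝓘(ℂ, E)) ∞
      (fun y ↦ (⟨y, e.symm y w⟩ : TangentBundle 𝓘(ℂ, E) M)) e.baseSet := by
    rw [e.contMDiffOn_section_baseSet_iff]
    refine contMDiffOn_const (c := w) |>.congr fun y hy ↦ ?_
    rw [e.apply_mk_symm hy]
  have h2 : ContMDiffOn 𝓘(ℂ, E) (𝓘(ℂ, E).prod 𝓘(ℂ, E)) ∞
      (fun y ↦ (⟨y, frame c y w⟩ : TangentBundle 𝓘(ℂ, E) M)) c.source := by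
    refine h1.congr fun y hy ↦ ?_
    congr 1
    exact (((tangentBundleCore 𝓘(ℂ, E) M).localTriv_symm_apply ⟨c, hc⟩ hy w).trans
      (coordChange_complex ⟨c, hc⟩ (achart E y) y w)).symm
  exact (h2.contMDiffAt (c.open_source.mem_nhds hx)).mdifferentiableAt (by simp)

/-- A vector field that has constant coordinate `w` in the chart `c`. -/
def IsFrameField (c : OpenPartialHomeomorph M E) (w : E)
    (σ : ∀ y : M, TangentSpace 𝓘(ℝ, E) y) : Prop :=
  ∀ y ∈ c.source, σ y = frame c y w

namespace IsFrameField

variable {w : E} {σ : ∀ y : M, TangentSpace 𝓘(ℝ, E) y}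

theorem contMDiffAt (hσ : IsFrameField c w σ) (hc : c ∈ atlas E M) {x : M} (hx : x ∈ c.source) :
    ContMDiffAt 𝓘(ℝ, E) (𝓘(ℝ, E).prod 𝓘(ℝ, E)) ∞
      (fun y ↦ (⟨y, σ y⟩ : TangentBundle 𝓘(ℝ, E) M)) x := by
  refine ((contMDiffOn_frame hc w).contMDiffAt (c.open_source.mem_nhds hx)).congr_of_eventuallyEq ?_
  filter_upwards [c.open_source.mem_nhds hx] with y hy
  rw [hσ y hy]

theorem mdifferentiableAt (hσ : IsFrameField c w σ) (hc : c ∈ atlas E M) {x : M}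
    (hx : x ∈ c.source) :
    MDifferentiableAt 𝓘(ℝ, E) (𝓘(ℝ, E).prod 𝓘(ℝ, E))
      (fun y ↦ (⟨y, σ y⟩ : TangentBundle 𝓘(ℝ, E) M)) x :=
  (hσ.contMDiffAt hc hx).mdifferentiableAt (by simp)

theorem isHolomorphicFieldAt (hσ : IsFrameField c w σ) (hc : c ∈ atlas E M) {x : M}
    (hx : x ∈ c.source) : IsHolomorphicFieldAt σ x := by
  filter_upwards [c.open_source.mem_nhds hx] with y hy
  refine (mdifferentiableAt_frame_complex hc w hy).congr_of_eventuallyEq ?_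
  filter_upwards [c.open_source.mem_nhds hy] with z hz
  rw [hσ z hz]; rfl

omit [IsManifold 𝓘(ℂ, E) ∞ M] in
theorem J (hσ : IsFrameField c w σ) : IsFrameField c (Complex.I • w) (fun y ↦ J (σ y)) := by
  intro y hy
  refine (congrArg (fun v : E ↦ Complex.I • v) (hσ y hy)).trans ?_
  exact ((frame c y).map_smul Complex.I w).symm

end IsFrameField

/-! ### Hermitian metrics in a chart -/

/-- The metric on the tangent space at `y`, as a bilinear form on the model space. -/
def HermitianMetric.form (g : HermitianMetric E M) (y : M) : E →L[ℝ] E →L[ℝ] ℝ := g.inner y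

theorem HermitianMetric.isHermitianForm_form (g : HermitianMetric E M) (y : M) :
    IsHermitianForm (g.form y) :=
  ⟨g.symm y, g.inner_J y⟩

theorem HermitianMetric.form_pos (g : HermitianMetric E M) (y : M) (v : E) (hv : v ≠ 0) :
    0 < g.form y v v := g.pos y v hv

/-- The metric in the frame of the chart `c`, as a function of the coordinates. -/
def metricInChart (g : HermitianMetric E M) (c : OpenPartialHomeomorph M E) (z : E) :
    E →L[ℝ] E →L[ℝ] ℝ :=
  (g.form (c.symm z)).bilinearComp ((frame c (c.symm z)).restrictScalars ℝ)
    ((frame c (c.symm z)).restrictScalars ℝ)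

variable {g : HermitianMetric E M}

theorem metricInChart_apply (z v w : E) : metricInChart g c z v w
    = g.form (c.symm z) (frame c (c.symm z) v) (frame c (c.symm z) w) := rfl

theorem metricInChart_coframe (hc : c ∈ atlas E M) {y : M} (hy : y ∈ c.source) (v w : E) :
    metricInChart g c (c y) (coframe c y v) (coframe c y w) = g.form y v w := by
  rw [metricInChart_apply, c.left_inv hy, frame_coframe hc hy, frame_coframe hc hy]

theorem isHermitianForm_metricInChart (g : HermitianMetric E M) (c : OpenPartialHomeomorph M E)
    (z : E) : IsHermitianForm (metricInChart g c z) where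
  symm v w := (g.isHermitianForm_form _).symm _ _
  I_smul_I_smul v w := by
    rw [metricInChart_apply, (frame c _).map_smul, (frame c _).map_smul,
      (g.isHermitianForm_form _).I_smul_I_smul]
    rfl

theorem metricInChart_pos (g : HermitianMetric E M) (hc : c ∈ atlas E M) {z : E}
    (hz : z ∈ c.target) (v : E) (hv : v ≠ 0) : 0 < metricInChart g c z v v := by
  refine g.form_pos _ _ fun h ↦ hv ?_
  have h' : frame c (c.symm z) v = 0 := h
  rw [← coframe_frame hc (c.map_target hz) v, h', map_zero]

/-- The scalar product of two smooth vector fields is smooth. -/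
theorem contMDiffAt_inner {σ τ : ∀ y : M, TangentSpace 𝓘(ℝ, E) y} {x : M}
    (hσ : ContMDiffAt 𝓘(ℝ, E) (𝓘(ℝ, E).prod 𝓘(ℝ, E)) ∞
      (fun y ↦ (⟨y, σ y⟩ : TangentBundle 𝓘(ℝ, E) M)) x)
    (hτ : ContMDiffAt 𝓘(ℝ, E) (𝓘(ℝ, E).prod 𝓘(ℝ, E)) ∞
      (fun y ↦ (⟨y, τ y⟩ : TangentBundle 𝓘(ℝ, E) M)) x) :
    ContMDiffAt 𝓘(ℝ, E) 𝓘(ℝ, ℝ) ∞ (fun y ↦ g.inner y (σ y) (τ y)) x := by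
  have : ContMDiffAt 𝓘(ℝ, E) (𝓘(ℝ, E).prod 𝓘(ℝ)) ∞
      (fun m ↦ Bundle.TotalSpace.mk' ℝ (E := Bundle.Trivial M ℝ) m (g.inner m (σ m) (τ m))) x :=
    ContMDiffAt.clm_bundle_apply₂ (F₁ := E) (F₂ := E) g.contMDiff.contMDiffAt hσ hτ
  rw [Bundle.contMDiffAt_totalSpace] at this
  exact this.2

theorem contDiffOn_metricInChart [FiniteDimensional ℂ E] (g : HermitianMetric E M)
    (hc : c ∈ atlas E M) : ContDiffOn ℝ ∞ (metricInChart g c) c.target := by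
  have : FiniteDimensional ℝ E := FiniteDimensional.complexToReal E
  refine contDiffOn_clm_apply.2 fun v ↦ contDiffOn_clm_apply.2 fun w ↦ ?_
  have h1 : ContMDiffOn 𝓘(ℝ, E) 𝓘(ℝ, ℝ) ∞
      (fun y ↦ g.inner y (frame c y v) (frame c y w)) c.source := fun y hy ↦
    (contMDiffAt_inner ((contMDiffOn_frame hc v).contMDiffAt (c.open_source.mem_nhds hy))
      ((contMDiffOn_frame hc w).contMDiffAt (c.open_source.mem_nhds hy))).contMDiffWithinAt
  have h2 : ContMDiffOn 𝓘(ℝ, E) 𝓘(ℝ, E) ∞ c.symm c.target :=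
    contMDiffOn_symm_of_mem_maximalAtlas (IsManifold.subset_maximalAtlas hc)
  exact (h1.comp h2 fun z hz ↦ c.map_target hz).contDiffOn

/-- The Chern connection form of the metric in the chart `c`. -/
def chartForm (g : HermitianMetric E M) (c : OpenPartialHomeomorph M E) (z : E) :
    E →L[ℝ] E →L[ℝ] E :=
  chernForm (metricInChart g c z) (fderiv ℝ (metricInChart g c) z)

section
variable [FiniteDimensional ℂ E]

theorem contDiffAt_metricInChart (g : HermitianMetric E M)
    (hc : c ∈ atlas E M) {z : E} (hz : z ∈ c.target) : ContDiffAt ℝ ∞ (metricInChart g c) z :=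
  (contDiffOn_metricInChart g hc).contDiffAt (c.open_target.mem_nhds hz)

theorem hasFDerivAt_metricInChart (g : HermitianMetric E M)
    (hc : c ∈ atlas E M) {z : E} (hz : z ∈ c.target) :
    HasFDerivAt (metricInChart g c) (fderiv ℝ (metricInChart g c) z) z :=
  ((contDiffAt_metricInChart g hc hz).differentiableAt (by simp)).hasFDerivAt

theorem hasFDerivAt_metricInChart_apply (g : HermitianMetric E M)
    (hc : c ∈ atlas E M) {z : E} (hz : z ∈ c.target) (w u : E) :
    HasFDerivAt (fun y ↦ metricInChart g c y w u)
      (((fderiv ℝ (metricInChart g c) z).flip w).flip u) z := by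
  have := ((hasFDerivAt_metricInChart g hc hz).clm_apply (hasFDerivAt_const w z)).clm_apply
    (hasFDerivAt_const u z)
  simpa using this

theorem isHermitianForm_fderiv_metricInChart (g : HermitianMetric E M)
    (hc : c ∈ atlas E M) {z : E} (hz : z ∈ c.target) (v : E) :
    IsHermitianForm (fderiv ℝ (metricInChart g c) z v) := by
  have key (w u w' u' : E) (h : ∀ y, metricInChart g c y w u = metricInChart g c y w' u') :
      fderiv ℝ (metricInChart g c) z v w u = fderiv ℝ (metricInChart g c) z v w' u' := by
    have h1 := hasFDerivAt_metricInChart_apply g hc hz w u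
    have h2 := hasFDerivAt_metricInChart_apply g hc hz w' u'
    rw [funext h] at h1
    exact congrArg (fun L : E →L[ℝ] ℝ ↦ L v) (h1.unique h2)
  exact ⟨fun w u ↦ key _ _ _ _ fun y ↦ (isHermitianForm_metricInChart g c y).symm w u,
    fun w u ↦ key _ _ _ _ fun y ↦ (isHermitianForm_metricInChart g c y).I_smul_I_smul w u⟩

theorem contDiffAt_chartForm (g : HermitianMetric E M)
    (hc : c ∈ atlas E M) {z : E} (hz : z ∈ c.target) : ContDiffAt ℝ ∞ (chartForm g c) z :=
  contDiffAt_chernForm (contDiffAt_metricInChart g hc hz) (metricInChart_pos g hc hz)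

theorem chartForm_I_smul_left (g : HermitianMetric E M)
    (hc : c ∈ atlas E M) {z : E} (hz : z ∈ c.target) (v w : E) :
    chartForm g c z (Complex.I • v) w = Complex.I • chartForm g c z v w :=
  chernForm_I_smul_left (metricInChart_pos g hc hz) (isHermitianForm_metricInChart g c z) v w

theorem chartForm_I_smul_right (g : HermitianMetric E M)
    (hc : c ∈ atlas E M) {z : E} (hz : z ∈ c.target) (v w : E) :
    chartForm g c z v (Complex.I • w) = Complex.I • chartForm g c z v w :=
  chernForm_I_smul_right (metricInChart_pos g hc hz) (isHermitianForm_metricInChart g c z)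
    (isHermitianForm_fderiv_metricInChart g hc hz) v w

theorem metric_chartForm (g : HermitianMetric E M)
    (hc : c ∈ atlas E M) {z : E} (hz : z ∈ c.target) (v w u : E) :
    fderiv ℝ (metricInChart g c) z v w u = metricInChart g c z (chartForm g c z v w) u
      + metricInChart g c z w (chartForm g c z v u) :=
  metric_chernForm (metricInChart_pos g hc hz) (isHermitianForm_metricInChart g c z)
    (isHermitianForm_fderiv_metricInChart g hc hz) v w u

theorem chartForm_transition (g : HermitianMetric E M) {c' : OpenPartialHomeomorph M E}
    (hc : c ∈ atlas E M) (hc' : c' ∈ atlas E M) {y : M} (hy : y ∈ c.source) (hy' : y ∈ c'.source)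
    (v w : E) :
    fderiv ℂ (c' ∘ c.symm) (c y) (chartForm g c (c y) v w)
      = chartForm g c' (c' y) (fderiv ℂ (c' ∘ c.symm) (c y) v) (fderiv ℂ (c' ∘ c.symm) (c y) w)
        + fderiv ℂ (fderiv ℂ (c' ∘ c.symm)) (c y) v w := by
  have hψ := contDiffAt_transition hc hc' hy hy'
  have e1 : (c' ∘ c.symm) (c y) = c' y := by simp [c.left_inv hy]
  have hz := c.map_source hy
  have hz' := c'.map_source hy'
  have := chernForm_transition (G₁ := metricInChart g c) (G₂ := metricInChart g c')
    (ψ := c' ∘ c.symm) (z := c y) (hψ.differentiableAt (by simp))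
    ((hψ.fderiv_right (m := ∞) (by simp)).differentiableAt (by simp))
    (hasFDerivAt_metricInChart g hc hz).differentiableAt
    (by rw [e1]; exact (hasFDerivAt_metricInChart g hc' hz').differentiableAt)
    (metricInChart_pos g hc hz) (by rw [e1]; exact metricInChart_pos g hc' hz')
    (isHermitianForm_metricInChart g c' _) ?_ ?_ v w
  · rw [e1] at this; exact this
  · intro u
    refine ⟨coframe c y (frame c' y u), ?_⟩
    have := congrArg (fun L : E →L[ℂ] E ↦ L (frame c' y u)) (coframe_eq_comp_coframe hc hc' hy hy')
    exact this.symm.trans (coframe_frame hc' hy' u)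
  · have h1 : ∀ᶠ z in 𝓝 (c y), c.symm z ∈ c'.source :=
      (c.continuousAt_symm hz).eventually (c'.open_source.mem_nhds (by rwa [c.left_inv hy]))
    filter_upwards [h1, c.open_target.mem_nhds hz] with z hz1 hz2 w u
    have h2 := frame_eq_frame_comp hc hc' (c.map_target hz2) hz1
    rw [c.right_inv hz2] at h2
    rw [metricInChart_apply, metricInChart_apply, h2]
    simp [c'.left_inv hz1]

/-! ### The Chern connection in a chart -/

variable {D : TangentConnection E M}

theorem fderiv_metricInChart_eq (hc : c ∈ atlas E M) {x : M}
    (hx : x ∈ c.source) {w u : E} {σ τ : ∀ y : M, TangentSpace 𝓘(ℝ, E) y}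
    (hσ : IsFrameField c w σ) (hτ : IsFrameField c u τ) (v : E) :
    fderiv ℝ (metricInChart g c) (c x) v w u
      = mvfderiv 𝓘(ℝ, E) (fun y ↦ g.inner y (σ y) (τ y)) x (frame c x v) := by
  rw [mvfderiv_frame hc hx ((contMDiffAt_inner (hσ.contMDiffAt hc hx)
    (hτ.contMDiffAt hc hx)).mdifferentiableAt (by simp))]
  have h1 := hasFDerivAt_metricInChart_apply g hc (c.map_source hx) w u
  have h2 : (fun y ↦ g.inner y (σ y) (τ y)) ∘ c.symm =ᶠ[𝓝 (c x)]
      fun z ↦ metricInChart g c z w u := by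
    filter_upwards [c.open_target.mem_nhds (c.map_source hx)] with z hz
    simp only [Function.comp_apply]
    rw [hσ _ (c.map_target hz), hτ _ (c.map_target hz)]; rfl
  rw [h2.fderiv_eq, h1.fderiv]; rfl

/-- The coefficients of the Chern connection in the frame of a chart are those of the Chern form of
the metric. In particular the three axioms determine the connection. -/
theorem IsChernConnection.apply_frameField (hD : IsChernConnection g D) (hc : c ∈ atlas E M) {x : M}
    (hx : x ∈ c.source) {w : E} {σ : ∀ y : M, TangentSpace 𝓘(ℝ, E) y} (hσ : IsFrameField c w σ)
    (v : E) : D σ x (frame c x v) = frame c x (chartForm g c (c x) v w) := by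
  refine eq_of_forall_form_eq (g.form_pos x) fun u ↦ ?_
  have hpos := metricInChart_pos g hc (c.map_source hx)
  obtain ⟨u, rfl⟩ : ∃ u', frame c x u' = u := ⟨coframe c x u, frame_coframe hc hx u⟩
  let τ : ∀ y : M, TangentSpace 𝓘(ℝ, E) y := fun y ↦ frame c y u
  have hτ : IsFrameField c u τ := fun y _ ↦ rfl
  have e1 := hD.metric σ τ x (hσ.mdifferentiableAt hc hx) (hτ.mdifferentiableAt hc hx)
    (frame c x v)
  have e2 := hD.metric σ (fun y ↦ J (τ y)) x (hσ.mdifferentiableAt hc hx)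
    (hτ.J.mdifferentiableAt hc hx) (J (show TangentSpace 𝓘(ℝ, E) x from frame c x v))
  rw [hD.complex τ x (hτ.mdifferentiableAt hc hx),
    hD.holomorphic σ x (hσ.isHolomorphicFieldAt hc hx),
    hD.holomorphic τ x (hτ.isHolomorphicFieldAt hc hx)] at e2
  rw [← fderiv_metricInChart_eq hc hx hσ hτ] at e1
  have e3 : (J (show TangentSpace 𝓘(ℝ, E) x from frame c x v)) = frame c x (Complex.I • v) := by
    rw [map_smul]; rfl
  rw [e3, ← fderiv_metricInChart_eq hc hx hσ hτ.J] at e2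
  have e4 := apply_chernForm hpos (B' := fderiv ℝ (metricInChart g c) (c x)) v w u
  have e5 : metricInChart g c (c x) (chartForm g c (c x) v w) u
      = g.form x (frame c x (chartForm g c (c x) v w)) (frame c x u) := by
    rw [metricInChart_apply, c.left_inv hx]
  rw [← e5]
  refine Eq.trans ?_ e4.symm
  rw [e1, e2]
  have e6 : g.inner x (J (D σ x (frame c x v))) (J (τ x)) = g.form x (D σ x (frame c x v)) (τ x) :=
    g.inner_J x _ _
  have e7 : g.inner x (σ x) (J (J (D τ x (frame c x v))))
      = -g.form x (σ x) (D τ x (frame c x v)) := by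
    have : (show E from J (J (D τ x (frame c x v)))) = -(show E from D τ x (frame c x v)) :=
      I_smul_I_smul_eq_neg (show E from D τ x (frame c x v))
    exact (congrArg (g.form x (σ x)) this).trans (map_neg (g.form x (σ x)) _)
  rw [e6, e7]
  change g.form x (D σ x (frame c x v)) (frame c x u) = 2⁻¹ * (
    (g.form x (D σ x (frame c x v)) (frame c x u) + g.form x (σ x) (D τ x (frame c x v)))
    + (g.form x (D σ x (frame c x v)) (frame c x u) + -g.form x (σ x) (D τ x (frame c x v))))
  ring

end

end

/-! ### Parallel fields in charts -/

section

variable {E : Type*} [NormedAddCommGroup E] [NormedSpace ℂ E]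
  {M : Type*} [TopologicalSpace M] [ChartedSpace E M] [IsManifold 𝓘(ℂ, E) ∞ M]
  {c : OpenPartialHomeomorph M E} {g : HermitianMetric E M} {D : TangentConnection E M}
  {X Y : ℝ → TangentBundle 𝓘(ℝ, E) M} {S : Set ℝ} {s : ℝ}

/-- The coordinates with respect to `c` of a vector field along a curve. They are meaningful where
the base curve lies in `c.source`. -/
def coord (c : OpenPartialHomeomorph M E) (X : ℝ → TangentBundle 𝓘(ℝ, E) M) (s : ℝ) : E :=
  coframe c (X s).proj (X s).2

/-- The velocity of the base curve of `X`, in the chart `c`. -/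
def velocityCoord (c : OpenPartialHomeomorph M E) (X : ℝ → TangentBundle 𝓘(ℝ, E) M) (S : Set ℝ)
    (s : ℝ) : E :=
  coframe c (X s).proj (velocityWithin (fun τ ↦ (X τ).proj) S s)

omit [IsManifold 𝓘(ℂ, E) ∞ M] in
theorem velocityWithin_congr {γ γ' : ℝ → M} {S : Set ℝ} {s : ℝ} (h : Set.EqOn γ γ' S)
    (hs : s ∈ S) : velocityWithin γ S s = (show E from velocityWithin γ' S s) := by
  unfold velocityWithin
  rw [mfderivWithin_congr (fun t ht ↦ h ht) (h hs)]
  rfl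

omit [IsManifold 𝓘(ℂ, E) ∞ M] in
theorem velocityCoord_eq {γ : ℝ → M} (h : ∀ τ ∈ S, (X τ).proj = γ τ) (hs : s ∈ S) :
    velocityCoord c X S s = coframe c (γ s) (velocityWithin γ S s) := by
  unfold velocityCoord
  rw [h s hs]
  exact congrArg _ (velocityWithin_congr (fun τ hτ ↦ h τ hτ) hs)

/-- The equation of parallel transport at the time `s` in the chart `c`. -/
def IsParallelInChartAt (g : HermitianMetric E M) (c : OpenPartialHomeomorph M E)
    (X : ℝ → TangentBundle 𝓘(ℝ, E) M) (S : Set ℝ) (s : ℝ) : Prop :=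
  HasDerivWithinAt (coord c X)
    (-chartForm g c (c (X s).proj) (velocityCoord c X S s) (coord c X s)) S s

/-- The base curve of `X` is differentiable on `S`. -/
def HasDifferentiableBase (X : ℝ → TangentBundle 𝓘(ℝ, E) M) (S : Set ℝ) : Prop :=
  ∀ s ∈ S, MDifferentiableWithinAt 𝓘(ℝ, ℝ) 𝓘(ℝ, E) (fun τ ↦ (X τ).proj) S s

omit [IsManifold 𝓘(ℂ, E) ∞ M] in
theorem HasDifferentiableBase.eventually_mem (hX : HasDifferentiableBase X S) (hs : s ∈ S)
    {U : Set M} (hU : IsOpen U) (h : (X s).proj ∈ U) : ∀ᶠ τ in 𝓝[S] s, (X τ).proj ∈ U :=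
  (hX s hs).continuousWithinAt.eventually (hU.mem_nhds h)

theorem HasDifferentiableBase.hasDerivWithinAt (hX : HasDifferentiableBase X S) (hs : s ∈ S)
    (hc : c ∈ atlas E M) (h : (X s).proj ∈ c.source) :
    HasDerivWithinAt (fun τ ↦ c (X τ).proj) (velocityCoord c X S s) S s :=
  hasDerivWithinAt_chart_comp hc h (hX s hs)

variable [FiniteDimensional ℂ E]

theorem hasDerivWithinAt_trivialization_iff (hD : IsChernConnection g D) (hc : c ∈ atlas E M)
    (hX : HasDifferentiableBase X S) (hs : s ∈ S)
    {e : Bundle.Trivialization E (Bundle.TotalSpace.proj : TangentBundle 𝓘(ℝ, E) M → M)}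
    (he : ∀ p : TangentBundle 𝓘(ℝ, E) M, p.proj ∈ c.source → (e p).2 = coframe c p.proj p.2)
    (he' : ∀ y ∈ c.source, ∀ w, e.symm y w = frame c y w) (hsc : (X s).proj ∈ c.source) :
    HasDerivWithinAt (fun τ ↦ (e (X τ)).2)
      (-(e ⟨(X s).proj, D (fun y ↦ e.symm y (e (X s)).2) (X s).proj
          (velocityWithin (fun τ ↦ (X τ).proj) S s)⟩).2) S s ↔ IsParallelInChartAt g c X S s := by
  have h1 : (fun τ ↦ (e (X τ)).2) =ᶠ[𝓝[S] s] coord c X := by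
    filter_upwards [hX.eventually_mem hs c.open_source hsc] with τ hτ
    exact he _ hτ
  have h2 : (e (X s)).2 = coord c X s := he _ hsc
  have h3 : IsFrameField c (coord c X s) (fun y ↦ e.symm y (e (X s)).2) := fun y hy ↦
    (he' y hy _).trans (congrArg (frame c y) h2)
  have h4 := hD.apply_frameField hc hsc h3 (velocityCoord c X S s)
  have hv : frame c (X s).proj (velocityCoord c X S s)
      = (show E from velocityWithin (fun τ ↦ (X τ).proj) S s) := frame_coframe hc hsc _
  have h5 : coframe c (X s).proj (D (fun y ↦ e.symm y (e (X s)).2) (X s).proj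
      (velocityWithin (fun τ ↦ (X τ).proj) S s))
      = chartForm g c (c (X s).proj) (velocityCoord c X S s) (coord c X s) :=
    ((congrArg (fun v : E ↦ coframe c (X s).proj (D (fun y ↦ e.symm y (e (X s)).2) (X s).proj v))
      hv).symm.trans (congrArg (coframe c (X s).proj) h4)).trans (coframe_frame hc hsc _)
  have h6 := (he ⟨(X s).proj, D (fun y ↦ e.symm y (e (X s)).2) (X s).proj
      (velocityWithin (fun τ ↦ (X τ).proj) S s)⟩ hsc).trans h5
  rw [h6, h1.hasDerivWithinAt_iff h2]
  rfl

/-- The equation of parallel transport does not depend on the chart. -/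
theorem IsParallelInChartAt.change (hX : HasDifferentiableBase X S) (hs : s ∈ S)
    {c' : OpenPartialHomeomorph M E} (hc : c ∈ atlas E M) (hc' : c' ∈ atlas E M)
    (h : (X s).proj ∈ c.source) (h' : (X s).proj ∈ c'.source)
    (hpar : IsParallelInChartAt g c X S s) : IsParallelInChartAt g c' X S s := by
  unfold IsParallelInChartAt at hpar ⊢
  set C := fderiv ℂ (c' ∘ c.symm)
  have hC : DifferentiableAt ℂ C (c (X s).proj) :=
    ((contDiffAt_transition hc hc' h h').fderiv_right (m := ∞) (by simp)).differentiableAt (by simp)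
  have h1 : coord c' X =ᶠ[𝓝[S] s] fun τ ↦ C (c (X τ).proj) (coord c X τ) := by
    filter_upwards [hX.eventually_mem hs c.open_source h,
      hX.eventually_mem hs c'.open_source h'] with τ hτ hτ'
    exact congrArg (fun L : E →L[ℂ] E ↦ L (X τ).2) (coframe_eq_comp_coframe hc hc' hτ hτ')
  have h2 : coord c' X s = C (c (X s).proj) (coord c X s) :=
    congrArg (fun L : E →L[ℂ] E ↦ L (X s).2) (coframe_eq_comp_coframe hc hc' h h')
  have h3 : velocityCoord c' X S s = C (c (X s).proj) (velocityCoord c X S s) :=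
    congrArg (fun L : E →L[ℂ] E ↦ L (velocityWithin (fun τ ↦ (X τ).proj) S s))
      (coframe_eq_comp_coframe hc hc' h h')
  have h4 := (hC.hasFDerivAt.restrictScalars ℝ).comp_hasDerivWithinAt s
    (hX.hasDerivWithinAt hs hc h)
  have h5 : HasDerivWithinAt (fun τ ↦ ((C (c (X τ).proj)).restrictScalars ℝ))
      ((fderiv ℂ C (c (X s).proj) (velocityCoord c X S s)).restrictScalars ℝ) S s :=
    (ContinuousLinearMap.restrictScalarsL ℂ E E ℝ ℝ).hasFDerivAt.comp_hasDerivWithinAt s h4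
  have h6 := h5.clm_apply hpar
  refine (h6.congr_of_eventuallyEq h1 h2).congr_deriv ?_
  rw [h2, h3]
  have h7 := chartForm_transition g hc hc' h h' (velocityCoord c X S s) (coord c X s)
  simp only [ContinuousLinearMap.coe_restrictScalars', map_neg]
  rw [h7]
  abel

theorem IsParallelOn.isParallelInChartAt (hD : IsChernConnection g D)
    (hX : HasDifferentiableBase X S) (h : IsParallelOn D X S) (hs : s ∈ S) (hc : c ∈ atlas E M)
    (hsc : (X s).proj ∈ c.source) : IsParallelInChartAt g c X S s := by
  have h1 := h (trivializationAt E (TangentSpace 𝓘(ℝ, E)) (X s).proj) s hs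
    (FiberBundle.mem_baseSet_trivializationAt' _)
  rw [hasDerivWithinAt_trivialization_iff hD (chart_mem_atlas E (X s).proj) hX hs
    (fun p hp ↦ trivializationAt_real_apply hp) (fun y hy w ↦ trivializationAt_real_symm hy w)
    (mem_chart_source E _)] at h1
  exact h1.change hX hs (chart_mem_atlas E _) hc (mem_chart_source E _) hsc

/-- It suffices to verify the equation of parallel transport in one chart around each point. -/
theorem isParallelOn_of_isParallelInChartAt (hD : IsChernConnection g D)
    (hX : HasDifferentiableBase X S)
    (h : ∀ s ∈ S, ∃ c ∈ atlas E M, (X s).proj ∈ c.source ∧ IsParallelInChartAt g c X S s) :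
    IsParallelOn D X S := by
  intro e he s hs hse
  obtain ⟨c, hc, hbase, h1, h2⟩ := exists_chart_of_memTrivializationAtlas e
  obtain ⟨c', hc', hsc', h3⟩ := h s hs
  have hsc : (X s).proj ∈ c.source := hbase ▸ hse
  exact (hasDerivWithinAt_trivialization_iff hD hc hX hs h1 h2 hsc).2
    (h3.change hX hs hc' hc hsc' hsc)

/-- Multiplication by `i` preserves parallel fields, because the connection is complex linear. -/
theorem IsParallelInChartAt.smul_I (hc : c ∈ atlas E M) (hsc : (X s).proj ∈ c.source)
    (h : IsParallelInChartAt g c X S s) :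
    IsParallelInChartAt g c (fun τ ↦ ⟨(X τ).proj, J (X τ).2⟩) S s := by
  have h1 (τ : ℝ) : coord c (fun τ ↦ (⟨(X τ).proj, J (X τ).2⟩ : TangentBundle 𝓘(ℝ, E) M)) τ
      = Complex.I • coord c X τ := (coframe c (X τ).proj).map_smul Complex.I (X τ).2
  unfold IsParallelInChartAt at h ⊢
  rw [h1, funext h1]
  refine (HasDerivWithinAt.const_smul Complex.I h).congr_deriv ?_
  rw [chartForm_I_smul_right g hc (c.map_source hsc), smul_neg]
  rfl

/-- Parallel transport preserves the metric. -/
theorem hasDerivWithinAt_form_of_parallel (hX : HasDifferentiableBase X S) (hs : s ∈ S)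
    (hXY : ∀ τ ∈ S, (Y τ).proj = (X τ).proj) (hc : c ∈ atlas E M) (hsc : (X s).proj ∈ c.source)
    (hparX : IsParallelInChartAt g c X S s) (hparY : IsParallelInChartAt g c Y S s) :
    HasDerivWithinAt (fun τ ↦ g.form (X τ).proj (X τ).2 (Y τ).2) 0 S s := by
  have hz := c.map_source hsc
  have h0 : HasFDerivAt (metricInChart g c) (fderiv ℝ (metricInChart g c) (c (X s).proj))
      ((fun τ ↦ c (X τ).proj) s) := hasFDerivAt_metricInChart g hc hz
  have h1 : HasDerivWithinAt (fun τ ↦ metricInChart g c (c (X τ).proj))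
      (fderiv ℝ (metricInChart g c) (c (X s).proj) (velocityCoord c X S s)) S s := by
    have hh := (hX.hasDerivWithinAt hs hc hsc).hasFDerivWithinAt
    have := HasFDerivAt.comp_hasFDerivWithinAt (x := s) (hg := h0) (hf := hh)
    exact this.hasDerivWithinAt.congr_deriv (by simp)
  have h2 := (h1.clm_apply hparX).clm_apply hparY
  have hv : velocityCoord c Y S s = velocityCoord c X S s := velocityCoord_eq hXY hs
  have key (τ : ℝ) (hτ : τ ∈ S) (hτc : (X τ).proj ∈ c.source) :
      g.form (X τ).proj (X τ).2 (Y τ).2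
        = metricInChart g c (c (X τ).proj) (coord c X τ) (coord c Y τ) := by
    unfold coord
    rw [hXY τ hτ]
    exact (metricInChart_coframe hc hτc (X τ).2 (Y τ).2).symm
  have h3 : (fun τ ↦ g.form (X τ).proj (X τ).2 (Y τ).2) =ᶠ[𝓝[S] s]
      fun τ ↦ metricInChart g c (c (X τ).proj) (coord c X τ) (coord c Y τ) := by
    filter_upwards [hX.eventually_mem hs c.open_source hsc, self_mem_nhdsWithin] with τ hτ hτS
    exact key τ hτS hτ
  refine (h2.congr_of_eventuallyEq h3 (key s hs hsc)).congr_deriv ?_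
  rw [hv, hXY s hs, add_apply, metric_chartForm g hc hz]
  simp

end

/-! ### Holonomy preserves parallel tensors -/

section

/-- A function with vanishing derivative on every interval of a subdivision has equal values at both
ends. It is differentiated one-sidedly at the subdivision points. -/
theorem eq_of_hasDerivWithinAt_zero {F : Type*} [NormedAddCommGroup F] [NormedSpace ℝ F]
    {q : ℝ → F} {t : ℕ → ℝ} (ht : Monotone t) {N : ℕ}
    (hq : ∀ i < N, ∀ s ∈ Set.Icc (t i) (t (i + 1)),
      HasDerivWithinAt q 0 (Set.Icc (t i) (t (i + 1))) s) : q (t N) = q (t 0) := by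
  induction N with
  | zero => rfl
  | succ N ih =>
    rw [← ih fun i hi ↦ hq i (hi.trans N.lt_succ_self)]
    have h := (convex_Icc (t N) (t (N + 1))).norm_image_sub_le_of_norm_hasDerivWithin_le
      (C := 0) (hq N N.lt_succ_self) (fun _ _ ↦ by simp)
      (Set.left_mem_Icc.2 (ht N.le_succ)) (Set.right_mem_Icc.2 (ht N.le_succ))
    rw [zero_mul] at h
    exact sub_eq_zero.1 (norm_le_zero_iff.1 h)

variable {E : Type*} [NormedAddCommGroup E] [NormedSpace ℂ E]
  {M : Type*} [TopologicalSpace M] [ChartedSpace E M] [IsManifold 𝓘(ℂ, E) ∞ M]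
  {c : OpenPartialHomeomorph M E} {g : HermitianMetric E M} {D : TangentConnection E M}
  {x : M}

omit [IsManifold 𝓘(ℂ, E) ∞ M] in
theorem PiecewiseSmoothLoop.Icc_subset (γ : PiecewiseSmoothLoop E x) {i : ℕ} (hi : i < γ.N) :
    Set.Icc (γ.t i) (γ.t (i + 1)) ⊆ Set.Icc 0 1 := by
  apply Set.Icc_subset_Icc
  · rw [← γ.t_zero]; exact γ.monotone_t (Nat.zero_le _)
  · rw [← γ.t_last]; exact γ.monotone_t hi

theorem IsParallelAlong.hasDifferentiableBase {γ : PiecewiseSmoothLoop E x}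
    {X : ℝ → TangentBundle 𝓘(ℝ, E) M} (h : IsParallelAlong D γ X) {i : ℕ} (hi : i < γ.N) :
    HasDifferentiableBase X (Set.Icc (γ.t i) (γ.t (i + 1))) := fun s hs ↦
  ((γ.smooth i hi).mdifferentiableOn (by simp) s hs).congr
    (fun t ht ↦ h.1 t (γ.Icc_subset hi ht)) (h.1 s (γ.Icc_subset hi hs))

variable [FiniteDimensional ℂ E]

omit [IsManifold 𝓘(ℂ, E) ∞ M] [FiniteDimensional ℂ E] in
/-- A function along a loop with vanishing derivative on each smooth piece has the same value at
both ends. -/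
theorem PiecewiseSmoothLoop.eq_of_hasDerivWithinAt_zero {F : Type*} [NormedAddCommGroup F]
    [NormedSpace ℝ F] (γ : PiecewiseSmoothLoop E x) {q : ℝ → F}
    (hq : ∀ i < γ.N, ∀ s ∈ Set.Icc (γ.t i) (γ.t (i + 1)),
      HasDerivWithinAt q 0 (Set.Icc (γ.t i) (γ.t (i + 1))) s) : q 1 = q 0 := by
  have := ChernHolonomy.eq_of_hasDerivWithinAt_zero γ.monotone_t hq
  rwa [γ.t_last, γ.t_zero] at this

theorem IsParallelAlong.isParallelInChartAt (hD : IsChernConnection g D)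
    {γ : PiecewiseSmoothLoop E x} {X : ℝ → TangentBundle 𝓘(ℝ, E) M} (h : IsParallelAlong D γ X)
    {i : ℕ} (hi : i < γ.N) {s : ℝ} (hs : s ∈ Set.Icc (γ.t i) (γ.t (i + 1))) (hc : c ∈ atlas E M)
    (hsc : (X s).proj ∈ c.source) :
    IsParallelInChartAt g c X (Set.Icc (γ.t i) (γ.t (i + 1))) s :=
  (h.2 i hi).isParallelInChartAt hD (h.hasDifferentiableBase hi) hs hc hsc

theorem IsParallelAlong.J (hD : IsChernConnection g D)
    {γ : PiecewiseSmoothLoop E x} {X : ℝ → TangentBundle 𝓘(ℝ, E) M} (h : IsParallelAlong D γ X) :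
    IsParallelAlong D γ (fun τ ↦ ⟨(X τ).proj, J (X τ).2⟩) :=
  ⟨h.1, fun _ hi ↦ isParallelOn_of_isParallelInChartAt hD (h.hasDifferentiableBase hi)
    fun s hs ↦ ⟨chartAt E (X s).proj, chart_mem_atlas E _, mem_chart_source E _,
      (h.isParallelInChartAt hD hi hs (chart_mem_atlas E _) (mem_chart_source E _)).smul_I
        (chart_mem_atlas E _) (mem_chart_source E _)⟩⟩

theorem IsParallelAlong.form_eq (hD : IsChernConnection g D)
    {γ : PiecewiseSmoothLoop E x} {X Y : ℝ → TangentBundle 𝓘(ℝ, E) M} (hX : IsParallelAlong D γ X)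
    (hY : IsParallelAlong D γ Y) :
    g.form (X 1).proj (X 1).2 (Y 1).2 = g.form (X 0).proj (X 0).2 (Y 0).2 := by
  refine γ.eq_of_hasDerivWithinAt_zero (q := fun τ ↦ g.form (X τ).proj (X τ).2 (Y τ).2)
    fun i hi s hs ↦ ?_
  have hXY : ∀ τ ∈ Set.Icc (γ.t i) (γ.t (i + 1)), (Y τ).proj = (X τ).proj := fun τ hτ ↦
    (hY.1 τ (γ.Icc_subset hi hτ)).trans (hX.1 τ (γ.Icc_subset hi hτ)).symm
  exact hasDerivWithinAt_form_of_parallel (hX.hasDifferentiableBase hi) hs hXY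
    (chart_mem_atlas E (X s).proj) (mem_chart_source E _)
    (hX.isParallelInChartAt hD hi hs (chart_mem_atlas E _) (mem_chart_source E _))
    (hY.isParallelInChartAt hD hi hs (chart_mem_atlas E _)
      (by rw [hXY s hs]; exact mem_chart_source E _))

theorem holonomy_isometry (hD : IsChernConnection g D)
    {P : TangentSpace 𝓘(ℝ, E) x →ₗ[ℝ] TangentSpace 𝓘(ℝ, E) x} (hP : P ∈ holonomy D x) (v w : E) :
    g.form x (P v) (P w) = g.form x v w := by
  obtain ⟨γ, h⟩ := hP
  obtain ⟨X, hX, hX0, hX1⟩ := h v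
  obtain ⟨Y, hY, hY0, hY1⟩ := h w
  have := hX.form_eq hD hY
  rw [hX0, hX1, hY0, hY1] at this
  exact this

/-- Holonomy is complex linear. Its elements are not assumed to come from a unique parallel field,
so that commutation with `J` is deduced from the invariance of the metric. -/
theorem holonomy_map_I_smul (hD : IsChernConnection g D)
    {P : TangentSpace 𝓘(ℝ, E) x →ₗ[ℝ] TangentSpace 𝓘(ℝ, E) x} (hP : P ∈ holonomy D x) (v : E) :
    P (Complex.I • v : E) = (Complex.I • (show E from P v) : E) := by
  have hiso := holonomy_isometry hD hP
  obtain ⟨γ, h⟩ := hP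
  obtain ⟨X, hX, hX0, hX1⟩ := h v
  obtain ⟨Y, hY, hY0, hY1⟩ := h (Complex.I • v : E)
  have h1 := (hX.J hD).form_eq hD hY
  rw [hX0, hX1, hY0, hY1] at h1
  -- The scalar product of `J X` with the transport of `i v` is constant, so that both vectors,
  -- having the same length, agree at time one.
  have h1' : g.form x (Complex.I • (show E from P v) : E) (P (Complex.I • v : E))
    = g.form x (Complex.I • v : E) (Complex.I • v : E) := h1
  have h2 := hiso (Complex.I • v) (Complex.I • v)
  have h3 : g.form x (Complex.I • (show E from P v) : E) (Complex.I • (show E from P v) : E)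
      = g.form x (Complex.I • v : E) (Complex.I • v : E) := by
    rw [(g.isHermitianForm_form x).I_smul_I_smul, (g.isHermitianForm_form x).I_smul_I_smul]
    exact hiso v v
  set a : E := P (Complex.I • v : E)
  set b : E := (Complex.I • (show E from P v) : E)
  by_contra hab
  have h4 := g.form_pos x (a - b) (sub_ne_zero.2 hab)
  have h5 : g.form x (a - b) (a - b) = g.form x a a - g.form x b a - (g.form x b a - g.form x b b)
      := by
    rw [(g.isHermitianForm_form x).symm b a, map_sub (g.form x), sub_apply, map_sub, map_sub,
      (g.isHermitianForm_form x).symm b a]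
  rw [h5] at h4
  linarith

end

/-! ### Existence of the Chern connection -/

section

variable {E : Type*} [NormedAddCommGroup E] [NormedSpace ℂ E]
  {M : Type*} [TopologicalSpace M] [ChartedSpace E M] [IsManifold 𝓘(ℂ, E) ∞ M]
  {c : OpenPartialHomeomorph M E} {g : HermitianMetric E M} {D : TangentConnection E M}
  {x : M} {σ τ : ∀ y : M, TangentSpace 𝓘(ℝ, E) y}

/-- The expression of a vector field in the chart `c`. -/
def localField (c : OpenPartialHomeomorph M E) (σ : ∀ y : M, TangentSpace 𝓘(ℝ, E) y) (z : E) : E :=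
  coframe c (c.symm z) (σ (c.symm z))

omit [IsManifold 𝓘(ℂ, E) ∞ M] in
theorem localField_chartAt (σ : ∀ y : M, TangentSpace 𝓘(ℝ, E) y) (x : M) :
    localField (chartAt E x) σ (chartAt E x x) = σ x := by
  unfold localField
  rw [(chartAt E x).left_inv (mem_chart_source E x), coframe_chartAt]
  rfl

theorem differentiableAt_localField (hσ : MDifferentiableAt 𝓘(ℝ, E) (𝓘(ℝ, E).prod 𝓘(ℝ, E))
      (fun y ↦ (⟨y, σ y⟩ : TangentBundle 𝓘(ℝ, E) M)) x) :
    DifferentiableAt ℝ (localField (chartAt E x) σ) (chartAt E x x) := by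
  have h1 := (mdifferentiableAt_section _ σ).1 hσ
  have h2 := (hasFDerivAt_comp_symm (chart_mem_atlas E x) (mem_chart_source E x)
    h1).differentiableAt
  refine h2.congr_of_eventuallyEq ?_
  filter_upwards [(chartAt E x).open_target.mem_nhds (mem_chart_target E x)] with z hz
  exact (trivializationAt_real_apply (p := ⟨_, σ ((chartAt E x).symm z)⟩)
    ((chartAt E x).map_target hz)).symm

theorem differentiableAt_localField_complex (hσ : IsHolomorphicFieldAt σ x) :
    DifferentiableAt ℂ (localField (chartAt E x) σ) (chartAt E x x) := by
  have h1 := ((mdifferentiableAt_section _ (fun z ↦ complexTangent (σ z))).1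
    hσ.self_of_nhds).hasMFDerivAt.2
  simp only [mfld_simps] at h1
  have h2 := (hasFDerivWithinAt_univ.1 h1).differentiableAt
  refine DifferentiableAt.congr_of_eventuallyEq h2 ?_
  refine Filter.Eventually.of_forall fun z ↦ ?_
  exact (trivializationAt_complex_apply x ⟨_, complexTangent (σ ((chartAt E x).symm z))⟩).symm

theorem mdifferentiableAt_inner (hσ : MDifferentiableAt 𝓘(ℝ, E) (𝓘(ℝ, E).prod 𝓘(ℝ, E))
      (fun y ↦ (⟨y, σ y⟩ : TangentBundle 𝓘(ℝ, E) M)) x)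
    (hτ : MDifferentiableAt 𝓘(ℝ, E) (𝓘(ℝ, E).prod 𝓘(ℝ, E))
      (fun y ↦ (⟨y, τ y⟩ : TangentBundle 𝓘(ℝ, E) M)) x) :
    MDifferentiableAt 𝓘(ℝ, E) 𝓘(ℝ, ℝ) (fun y ↦ g.inner y (σ y) (τ y)) x := by
  have : MDifferentiableAt 𝓘(ℝ, E) (𝓘(ℝ, E).prod 𝓘(ℝ))
      (fun m ↦ Bundle.TotalSpace.mk' ℝ (E := Bundle.Trivial M ℝ) m (g.inner m (σ m) (τ m))) x :=
    MDifferentiableAt.clm_bundle_apply₂ (F₁ := E) (F₂ := E)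
      (g.contMDiff.contMDiffAt.mdifferentiableAt (by simp)) hσ hτ
  rw [mdifferentiableAt_totalSpace] at this
  exact this.2

theorem mvfderiv_eq_fderiv_chartAt {F : Type*} [NormedAddCommGroup F] [NormedSpace ℝ F] {f : M → F}
    (hf : MDifferentiableAt 𝓘(ℝ, E) 𝓘(ℝ, F) f x) (v : E) :
    mvfderiv 𝓘(ℝ, E) f x v = fderiv ℝ (f ∘ (chartAt E x).symm) (chartAt E x x) v := by
  rw [← mvfderiv_frame (chart_mem_atlas E x) (mem_chart_source E x) hf, frame_chartAt]
  rfl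

variable [FiniteDimensional ℂ E]

/-- The covariant derivative at `x` of the vector field with expression `s` in the preferred chart
at `x`, for the Chern connection of `g`. -/
def chernDeriv (g : HermitianMetric E M) (x : M) (s : E → E) : E →L[ℝ] E :=
  fderiv ℝ s (chartAt E x x)
    + (chartForm g (chartAt E x) (chartAt E x x)).flip (s (chartAt E x x))

omit [FiniteDimensional ℂ E] in
theorem chernDeriv_apply (g : HermitianMetric E M) (x : M) (s : E → E) (v : E) :
    chernDeriv g x s v = fderiv ℝ s (chartAt E x x) v
      + chartForm g (chartAt E x) (chartAt E x x) v (s (chartAt E x x)) := rfl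

omit [FiniteDimensional ℂ E] in
theorem chernDeriv_add (x : M) {s t : E → E} (hs : DifferentiableAt ℝ s (chartAt E x x))
    (ht : DifferentiableAt ℝ t (chartAt E x x)) :
    chernDeriv g x (s + t) = chernDeriv g x s + chernDeriv g x t := by
  ext v
  simp only [chernDeriv_apply, add_apply, fderiv_add hs ht, Pi.add_apply, map_add]
  abel

omit [FiniteDimensional ℂ E] in
theorem chernDeriv_smul (x : M) {f : E → ℝ} {s : E → E}
    (hf : DifferentiableAt ℝ f (chartAt E x x)) (hs : DifferentiableAt ℝ s (chartAt E x x)) :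
    chernDeriv g x (f • s) = f (chartAt E x x) • chernDeriv g x s
      + (fderiv ℝ f (chartAt E x x)).smulRight (s (chartAt E x x)) := by
  ext v
  rw [add_apply, smul_apply, chernDeriv_apply, chernDeriv_apply, fderiv_smul hf hs, Pi.smul_apply',
    map_smul, add_apply, smul_apply, smul_add]
  abel

theorem chernDeriv_I_smul (x : M) {s : E → E} (hs : DifferentiableAt ℝ s (chartAt E x x)) (v : E) :
    chernDeriv g x (fun z ↦ Complex.I • s z) v = Complex.I • chernDeriv g x s v := by
  rw [chernDeriv_apply, chernDeriv_apply, fderiv_fun_const_smul hs,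
    chartForm_I_smul_right g (chart_mem_atlas E x) (mem_chart_target E x), smul_add]
  rfl

theorem chernDeriv_apply_I_smul (x : M) {s : E → E} (hs : DifferentiableAt ℂ s (chartAt E x x))
    (v : E) : chernDeriv g x s (Complex.I • v) = Complex.I • chernDeriv g x s v := by
  rw [chernDeriv_apply, chernDeriv_apply, fderiv_real_eq hs, fderiv_real_eq hs, map_smul,
    chartForm_I_smul_left g (chart_mem_atlas E x) (mem_chart_target E x), smul_add]

theorem fderiv_metricInChart_apply (x : M) {s t : E → E}
    (hs : DifferentiableAt ℝ s (chartAt E x x)) (ht : DifferentiableAt ℝ t (chartAt E x x))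
    (v : E) :
    fderiv ℝ (fun z ↦ metricInChart g (chartAt E x) z (s z) (t z)) (chartAt E x x) v
      = metricInChart g (chartAt E x) (chartAt E x x) (chernDeriv g x s v) (t (chartAt E x x))
        + metricInChart g (chartAt E x) (chartAt E x x) (s (chartAt E x x))
          (chernDeriv g x t v) := by
  have hz := mem_chart_target E x
  have h2 := ((hasFDerivAt_metricInChart g (chart_mem_atlas E x) hz).clm_apply
    hs.hasFDerivAt).clm_apply ht.hasFDerivAt
  have h4 := metric_chartForm g (chart_mem_atlas E x) hz v (s (chartAt E x x)) (t (chartAt E x x))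
  rw [h2.fderiv]
  simp only [chernDeriv_apply, add_apply, ContinuousLinearMap.flip_apply,
    ContinuousLinearMap.comp_apply, map_add]
  rw [h4]
  ring

/-- The Chern connection of a Hermitian metric. -/
def chernConnection (g : HermitianMetric E M) : TangentConnection E M where
  toFun σ x := chernDeriv (E := E) g x (localField (chartAt E x) σ)
  isCovariantDerivativeOnUniv :=
    { add := by
        intro σ τ x hσ hτ _
        have h1 : localField (chartAt E x) (σ + τ)
            = localField (chartAt E x) σ + localField (chartAt E x) τ :=
          funext fun z ↦ (coframe (chartAt E x) _).map_add _ _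
        exact (congrArg (chernDeriv g x) h1).trans (chernDeriv_add x
          (differentiableAt_localField hσ) (differentiableAt_localField hτ))
      leibniz := by
        intro σ f x hσ hf _
        have h1 : localField (chartAt E x) (f • σ)
            = (f ∘ (chartAt E x).symm) • localField (chartAt E x) σ :=
          funext fun z ↦ ((coframe (chartAt E x) _).restrictScalars ℝ).map_smul _ _
        have h3 := (hasFDerivAt_comp_symm (chart_mem_atlas E x) (mem_chart_source E x)
          hf).differentiableAt
        have h4 : f ((chartAt E x).symm (chartAt E x x)) = f x :=
          congrArg f ((chartAt E x).left_inv (mem_chart_source E x))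
        have h5 := (congrArg (chernDeriv g x) h1).trans
          (chernDeriv_smul x h3 (differentiableAt_localField hσ))
        refine ContinuousLinearMap.ext fun v ↦ ?_
        refine (congrArg (fun L : E →L[ℝ] E ↦ L v) h5).trans ?_
        refine congrArg₂ (fun (a : E) b ↦ a + b) (congrArg
          (fun r : ℝ ↦ r • chernDeriv g x (localField (chartAt E x) σ) v) h4) ?_
        exact congrArg₂ (fun (a : ℝ) (b : E) ↦ a • b) (mvfderiv_eq_fderiv_chartAt hf v).symm
          (localField_chartAt σ x) }

theorem isChernConnection_chernConnection (g : HermitianMetric E M) :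
    IsChernConnection g (chernConnection g) where
  complex σ x hσ v := by
    have h1 : localField (chartAt E x) (fun y ↦ J (σ y))
        = fun z ↦ Complex.I • localField (chartAt E x) σ z :=
      funext fun z ↦ (coframe (chartAt E x) _).map_smul _ _
    exact (congrArg (fun s ↦ chernDeriv g x s v) h1).trans
      (chernDeriv_I_smul x (differentiableAt_localField hσ) v)
  metric σ τ x hσ hτ v := by
    have hz := mem_chart_target E x
    have hx := mem_chart_source E x
    refine (mvfderiv_eq_fderiv_chartAt (mdifferentiableAt_inner (g := g) hσ hτ) v).trans ?_
    have h1 : (fun y ↦ g.inner y (σ y) (τ y)) ∘ (chartAt E x).symm =ᶠ[𝓝 (chartAt E x x)]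
        fun z ↦ metricInChart g (chartAt E x) z (localField (chartAt E x) σ z)
          (localField (chartAt E x) τ z) := by
      filter_upwards [(chartAt E x).open_target.mem_nhds hz] with z hz'
      have := metricInChart_coframe (g := g) (chart_mem_atlas E x) ((chartAt E x).map_target hz')
        (σ ((chartAt E x).symm z)) (τ ((chartAt E x).symm z))
      rw [(chartAt E x).right_inv hz'] at this
      exact this.symm
    have h3 (u w : E) : metricInChart g (chartAt E x) (chartAt E x x) u w = g.form x u w := by
      rw [metricInChart_apply, (chartAt E x).left_inv hx, frame_chartAt]; rfl
    refine (congrArg (fun L : E →L[ℝ] ℝ ↦ L v) h1.fderiv_eq).trans ?_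
    refine (fderiv_metricInChart_apply x (differentiableAt_localField hσ)
      (differentiableAt_localField hτ) v).trans ?_
    rw [h3, h3, localField_chartAt, localField_chartAt]
    rfl
  holomorphic σ x hσ v :=
    chernDeriv_apply_I_smul x (differentiableAt_localField_complex hσ) v

end

/-! ### Linear differential equations and complex differentiability -/

section

section Linear

variable {𝔸 : Type*} [NormedRing 𝔸] [NormedAlgebra ℝ 𝔸]

/-- Fundamental solution of a linear differential equation with small coefficients. -/
theorem exists_fundamental_solution [CompleteSpace 𝔸] (h1 : ‖(1 : 𝔸)‖ ≤ 1) {B : ℝ → 𝔸}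
    (hB : ContinuousOn B (Set.Icc 0 1)) (hB' : ∀ s ∈ Set.Icc (0 : ℝ) 1, ‖B s‖ ≤ 1 / 2) :
    ∃ Φ : ℝ → 𝔸, Φ 0 = 1 ∧ ∀ s ∈ Set.Icc (0 : ℝ) 1,
      HasDerivWithinAt Φ (B s * Φ s) (Set.Icc 0 1) s ∧ ‖Φ s‖ ≤ 2 := by
  have hnorm {w : 𝔸} (hw : w ∈ Metric.closedBall (1 : 𝔸) 1) : ‖w‖ ≤ 2 := by
    have := norm_le_norm_add_norm_sub' w 1
    rw [mem_closedBall_iff_norm] at hw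
    linarith
  have hPL : IsPicardLindelof (fun s w ↦ B s * w) (tmin := 0) (tmax := 1)
      ⟨0, Set.left_mem_Icc.2 zero_le_one⟩ (1 : 𝔸) 1 0 1 1 :=
    { lipschitzOnWith := fun t ht ↦ by
        refine LipschitzOnWith.of_dist_le_mul fun w _ w' _ ↦ ?_
        rw [dist_eq_norm, dist_eq_norm, ← mul_sub]
        refine (norm_mul_le _ _).trans (mul_le_mul_of_nonneg_right ?_ (norm_nonneg _))
        exact (hB' t ht).trans (by norm_num)
      continuousOn := fun w _ ↦ hB.mul continuousOn_const
      norm_le := fun t ht w hw ↦ by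
        have := mul_le_mul (hB' t ht) (hnorm hw) (norm_nonneg _) (by norm_num)
        exact (norm_mul_le _ _).trans (this.trans (by norm_num))
      mul_max_le := by norm_num }
  obtain ⟨α, hα⟩ := ODE.FunSpace.exists_isFixedPt_next hPL (Metric.mem_closedBall_self le_rfl)
  refine ⟨α.compProj, ?_, fun t ht ↦ ⟨?_, ?_⟩⟩
  · have := ODE.FunSpace.compProj_val (α := α) (t := ⟨0, Set.left_mem_Icc.2 zero_le_one⟩)
    rw [← hα, ODE.FunSpace.next_apply₀] at this
    rwa [hα] at this
  · refine (ODE.hasDerivWithinAt_picard_Icc (Set.left_mem_Icc.2 zero_le_one)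
      hPL.continuousOn_uncurry α.continuous_compProj.continuousOn
      (fun _ ht' ↦ α.compProj_mem_closedBall hPL.mul_max_le) 1 ht).congr_of_mem ?_ ht
    intro t' ht'
    nth_rw 1 [← hα]
    rw [ODE.FunSpace.compProj_of_mem ht', ODE.FunSpace.next_apply]
  · exact hnorm (α.compProj_mem_closedBall hPL.mul_max_le)

/-- The time one value of the fundamental solution is `1 + B₀` up to second order, when the
coefficient is close to the constant `B₀`. -/
theorem norm_fundamental_solution_sub_le {B : ℝ → 𝔸} {Φ : ℝ → 𝔸} {B₀ : 𝔸} {κ η : ℝ}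
    (h0 : Φ 0 = 1) (hΦ : ∀ s ∈ Set.Icc (0 : ℝ) 1,
      HasDerivWithinAt Φ (B s * Φ s) (Set.Icc 0 1) s ∧ ‖Φ s‖ ≤ 2)
    (hB : ∀ s ∈ Set.Icc (0 : ℝ) 1, ‖B s‖ ≤ κ) (hB₀ : ‖B₀‖ ≤ κ)
    (hη : ∀ s ∈ Set.Icc (0 : ℝ) 1, ‖B s - B₀‖ ≤ η) : ‖Φ 1 - 1 - B₀‖ ≤ 2 * η + 2 * κ ^ 2 := by
  have hκ : 0 ≤ κ := (norm_nonneg _).trans hB₀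
  have e0 : (0 : ℝ) ∈ Set.Icc (0 : ℝ) 1 := Set.left_mem_Icc.2 zero_le_one
  have e1 : (1 : ℝ) ∈ Set.Icc (0 : ℝ) 1 := Set.right_mem_Icc.2 zero_le_one
  have h1 (s : ℝ) (hs : s ∈ Set.Icc (0 : ℝ) 1) : ‖Φ s - 1‖ ≤ 2 * κ := by
    have := (convex_Icc (0 : ℝ) 1).norm_image_sub_le_of_norm_hasDerivWithin_le (C := κ * 2)
      (fun s hs ↦ (hΦ s hs).1) (fun s hs ↦ (norm_mul_le _ _).trans
        (mul_le_mul (hB s hs) (hΦ s hs).2 (norm_nonneg _) hκ)) e0 hs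
    rw [h0] at this
    refine this.trans ?_
    rw [sub_zero, Real.norm_of_nonneg hs.1]
    nlinarith [hs.2]
  have h2 (s : ℝ) (hs : s ∈ Set.Icc (0 : ℝ) 1) :
      HasDerivWithinAt (fun s ↦ Φ s - s • B₀) (B s * Φ s - (1 : ℝ) • B₀) (Set.Icc 0 1) s :=
    (hΦ s hs).1.sub ((hasDerivWithinAt_id s _).smul_const B₀)
  have h3 := (convex_Icc (0 : ℝ) 1).norm_image_sub_le_of_norm_hasDerivWithin_le
    (C := 2 * η + 2 * κ ^ 2) h2 (fun s hs ↦ ?_) e0 e1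
  · rw [h0, zero_smul, one_smul, sub_zero, sub_zero, norm_one, mul_one] at h3
    rwa [sub_right_comm]
  · have h4 : B s * Φ s - (1 : ℝ) • B₀ = (B s - B₀) * Φ s + B₀ * (Φ s - 1) := by
      rw [one_smul]; noncomm_ring
    rw [h4]
    have h5 := (norm_mul_le (B s - B₀) (Φ s)).trans
      (mul_le_mul (hη s hs) (hΦ s hs).2 (norm_nonneg _) ((norm_nonneg _).trans (hη s hs)))
    have h6 := (norm_mul_le B₀ (Φ s - 1)).trans
      (mul_le_mul hB₀ (h1 s hs) (norm_nonneg _) hκ)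
    refine (norm_add_le _ _).trans ?_
    linarith

variable {E : Type*} [NormedAddCommGroup E] [NormedSpace ℝ E]

/-- The parallel transport along a short segment from `z` to `z + v` has derivative `-A z` in
`v` at `0`, where `A` is the connection form. -/
theorem hasFDerivAt_of_fundamental_solution {A : E → E →L[ℝ] 𝔸} {z : E} (hA : ContinuousAt A z)
    {T : E → 𝔸} (hT : ∀ᶠ v in 𝓝 (0 : E), ∃ Φ : ℝ → 𝔸, Φ 0 = 1 ∧ Φ 1 = T v ∧
      ∀ s ∈ Set.Icc (0 : ℝ) 1,
        HasDerivWithinAt Φ (-(A (z + s • v) v) * Φ s) (Set.Icc 0 1) s ∧ ‖Φ s‖ ≤ 2) :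
    HasFDerivAt T (-A z) 0 := by
  have hT0 : T 0 = 1 := by
    obtain ⟨Φ, h0, h1, h2⟩ := hT.self_of_nhds
    have := norm_fundamental_solution_sub_le (B₀ := 0) (κ := 0) (η := 0) h0 h2 (by simp) (by simp)
      (by simp)
    rw [h1] at this
    simpa [sub_eq_zero] using this
  rw [hasFDerivAt_iff_isLittleO_nhds_zero, Asymptotics.isLittleO_iff]
  intro ε hε
  set C := ‖A z‖ + 1
  have hC : 0 < C := by positivity
  obtain ⟨δ, hδ, hball⟩ := Metric.continuousAt_iff.1 hA (min 1 (ε / 4)) (by positivity)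
  filter_upwards [hT, Metric.ball_mem_nhds (0 : E) hδ,
    Metric.ball_mem_nhds (0 : E) (show 0 < ε / (4 * C ^ 2) by positivity)] with v hv hvδ hvε
  obtain ⟨Φ, h0, h1, h2⟩ := hv
  rw [mem_ball_zero_iff] at hvδ hvε
  have hclose (s : ℝ) (hs : s ∈ Set.Icc (0 : ℝ) 1) :
      ‖A (z + s • v) - A z‖ ≤ min 1 (ε / 4) := by
    rw [← dist_eq_norm]
    refine (hball ?_).le
    rw [dist_eq_norm, add_sub_cancel_left, norm_smul, Real.norm_of_nonneg hs.1]
    nlinarith [hs.2, norm_nonneg v]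
  have hAs (s : ℝ) (hs : s ∈ Set.Icc (0 : ℝ) 1) : ‖A (z + s • v)‖ ≤ C := by
    have := norm_le_norm_add_norm_sub' (A (z + s • v)) (A z)
    have := (hclose s hs).trans (min_le_left _ _)
    linarith
  have h3 := norm_fundamental_solution_sub_le (B := fun s ↦ -(A (z + s • v) v)) (B₀ := -A z v)
    (κ := C * ‖v‖) (η := ε / 4 * ‖v‖) h0 h2 (fun s hs ↦ ?_) ?_ (fun s hs ↦ ?_)
  · rw [zero_add, hT0, ← h1]
    refine h3.trans ?_
    have h4 : C ^ 2 * ‖v‖ ≤ ε / 4 := by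
      rw [lt_div_iff₀ (by positivity)] at hvε
      linarith
    nlinarith [norm_nonneg v]
  · rw [norm_neg]
    exact (A _).le_of_opNorm_le (hAs s hs) v
  · rw [norm_neg]
    exact (A z).le_of_opNorm_le (by simp [C]) v
  · rw [neg_sub_neg, ← norm_neg, neg_sub, ← sub_apply]
    exact ContinuousLinearMap.le_of_opNorm_le _ ((hclose s hs).trans (min_le_right _ _)) v

end Linear

universe u

variable {E : Type u} [NormedAddCommGroup E] [NormedSpace ℂ E]

/-- A complex differentiable function that is smooth over the reals is smooth over the complex
numbers: its complex derivative is again complex differentiable, by the symmetry of the second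
derivative. Both spaces lie in one universe because the induction replaces `F` by `E →L[ℂ] F`. -/
theorem contDiffOn_complex_of_real {F : Type u} [NormedAddCommGroup F] [NormedSpace ℂ F] {U : Set E}
    (hU : IsOpen U) {f : E → F} (hf : ContDiffOn ℝ ∞ f U) (hf' : DifferentiableOn ℂ f U) :
    ContDiffOn ℂ ∞ f U := by
  refine contDiffOn_infty.2 fun n ↦ ?_
  induction n generalizing F f with
  | zero => exact contDiffOn_zero.2 hf.continuousOn
  | succ n ih =>
    have hd {z : E} (hz : z ∈ U) : DifferentiableAt ℂ f z := hf'.differentiableAt (hU.mem_nhds hz)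
    have h1 : Set.EqOn (fderiv ℂ f) (fun z ↦ complexPart (fderiv ℝ f z)) U := fun z hz ↦ by
      ext v
      rw [complexPart_apply_of_map_I_smul, fderiv_real_eq (hd hz)]
      intro v
      rw [fderiv_real_eq (hd hz), fderiv_real_eq (hd hz), map_smul]
    have h2 : ContDiffOn ℝ ∞ (fderiv ℝ f) U := ((contDiffOn_infty_iff_fderiv_of_isOpen hU).1 hf).2
    have h3 : ContDiffOn ℝ ∞ (fderiv ℂ f) U :=
      ((complexPart (E := E) (F := F)).contDiff.comp_contDiffOn h2).congr h1
    rw [Nat.cast_add, Nat.cast_one, contDiffOn_succ_iff_fderiv_of_isOpen hU]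
    refine ⟨hf', by simp, ih h3 fun z hz ↦ DifferentiableAt.differentiableWithinAt ?_⟩
    have h4 := ((h3.contDiffAt (hU.mem_nhds hz)).differentiableAt (by simp)).hasFDerivAt
    have h5 (v w : E) : fderiv ℝ (fderiv ℂ f) z v w = fderiv ℝ (fderiv ℝ f) z v w := by
      have e1 : HasFDerivAt (fun y ↦ fderiv ℂ f y w)
          ((ContinuousLinearMap.apply ℂ F w).restrictScalars ℝ ∘L fderiv ℝ (fderiv ℂ f) z) z :=
        ((ContinuousLinearMap.apply ℂ F w).restrictScalars ℝ).hasFDerivAt.comp z h4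
      have e2 : HasFDerivAt (fun y ↦ fderiv ℝ f y w)
          (ContinuousLinearMap.apply ℝ F w ∘L fderiv ℝ (fderiv ℝ f) z) z :=
        (ContinuousLinearMap.apply ℝ F w).hasFDerivAt.comp z
          ((h2.contDiffAt (hU.mem_nhds hz)).differentiableAt (by simp)).hasFDerivAt
      have e3 : (fun y ↦ fderiv ℂ f y w) =ᶠ[𝓝 z] fun y ↦ fderiv ℝ f y w := by
        filter_upwards [hU.mem_nhds hz] with y hy
        exact (fderiv_real_eq (hd hy) w).symm
      have := e1.unique (e2.congr_of_eventuallyEq e3)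
      exact congrArg (fun L : E →L[ℝ] F ↦ L v) this
    have h6 : IsSymmSndFDerivAt ℝ f z :=
      (hf.contDiffAt (hU.mem_nhds hz)).isSymmSndFDerivAt (by simpa using ENat.LEInfty.out)
    have h7 (v : E) : fderiv ℝ (fderiv ℂ f) z (Complex.I • v)
        = Complex.I • fderiv ℝ (fderiv ℂ f) z v := by
      ext w
      rw [smul_apply, h5, h6.eq, ← h5, map_smul, h5, h6.eq, ← h5]
    exact ⟨toComplexLinear _ h7, .of_isLittleO h4.isLittleO⟩

end

/-! ### Functions that are invariant under transport along segments -/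

section

section

variable {E : Type*} [NormedAddCommGroup E] [NormedSpace ℂ E]

/-- A connection form with complex linear values, as a form with values in `E →L[ℂ] E`. -/
def complexForm (A : E → E →L[ℝ] E →L[ℝ] E) (z : E) : E →L[ℝ] E →L[ℂ] E :=
  ContinuousLinearMap.compL ℝ E (E →L[ℝ] E) (E →L[ℂ] E) complexPart (A z)

theorem complexForm_apply {A : E → E →L[ℝ] E →L[ℝ] E} {z : E}
    (h : ∀ v w, A z v (Complex.I • w) = Complex.I • A z v w) (v w : E) :
    complexForm A z v w = A z v w :=
  complexPart_apply_of_map_I_smul (h v) w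

theorem complexForm_I_smul {A : E → E →L[ℝ] E →L[ℝ] E} {z : E}
    (h₁ : ∀ v w, A z (Complex.I • v) w = Complex.I • A z v w)
    (h₂ : ∀ v w, A z v (Complex.I • w) = Complex.I • A z v w) (v : E) :
    complexForm A z (Complex.I • v) = Complex.I • complexForm A z v := by
  ext w
  rw [smul_apply, complexForm_apply h₂, complexForm_apply h₂, h₁]

/-- Along every short segment from `z` the equation of parallel transport has a fundamental
solution. -/
theorem eventually_exists_fundamental_solution [CompleteSpace E] {A : E → E →L[ℝ] E →L[ℂ] E}
    {U : Set E} (hU : IsOpen U) (hA : ContinuousOn A U) {z : E} (hz : z ∈ U) :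
    ∀ᶠ v in 𝓝 (0 : E), (∀ s ∈ Set.Icc (0 : ℝ) 1, z + s • v ∈ U) ∧
      ∃ Φ : ℝ → E →L[ℂ] E, Φ 0 = 1 ∧ ∀ s ∈ Set.Icc (0 : ℝ) 1,
        HasDerivWithinAt Φ (-(A (z + s • v) v) * Φ s) (Set.Icc 0 1) s ∧ ‖Φ s‖ ≤ 2 := by
  obtain ⟨δ, hδ, hball⟩ := Metric.continuousAt_iff.1 (hA.continuousAt (hU.mem_nhds hz)) 1 one_pos
  obtain ⟨ε, hε, hεU⟩ := Metric.isOpen_iff.1 hU z hz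
  set C := ‖A z‖ + 1
  have hC : 0 < C := by positivity
  filter_upwards [Metric.ball_mem_nhds (0 : E) hδ, Metric.ball_mem_nhds (0 : E) hε,
    Metric.ball_mem_nhds (0 : E) (show 0 < 1 / (2 * C) by positivity)] with v hvδ hvε hvC
  rw [mem_ball_zero_iff] at hvδ hvε hvC
  have hle (s : ℝ) (hs : s ∈ Set.Icc (0 : ℝ) 1) : ‖s • v‖ ≤ ‖v‖ := by
    rw [norm_smul, Real.norm_of_nonneg hs.1]
    nlinarith [hs.2, norm_nonneg v]
  have hmem (s : ℝ) (hs : s ∈ Set.Icc (0 : ℝ) 1) : z + s • v ∈ U := by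
    refine hεU ?_
    rw [mem_ball_iff_norm, add_sub_cancel_left]
    exact (hle s hs).trans_lt hvε
  refine ⟨hmem, exists_fundamental_solution
    (ContinuousLinearMap.norm_id_le) (B := fun s ↦ -(A (z + s • v) v)) ?_ fun s hs ↦ ?_⟩
  · have h1 : ContinuousOn (fun s : ℝ ↦ z + s • v) (Set.Icc 0 1) := by fun_prop
    exact ((hA.comp h1 hmem).clm_apply continuousOn_const).neg
  · have h1 : ‖A (z + s • v) - A z‖ ≤ 1 := by
      rw [← dist_eq_norm]
      refine (hball ?_).le
      rw [dist_eq_norm, add_sub_cancel_left]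
      exact (hle s hs).trans_lt hvδ
    have h2 : ‖A (z + s • v)‖ ≤ C := by
      have := norm_le_norm_add_norm_sub' (A (z + s • v)) (A z)
      linarith
    rw [norm_neg]
    refine ((A _).le_of_opNorm_le h2 v).trans ?_
    rw [lt_div_iff₀ (by positivity)] at hvC
    linarith

end

variable {E : Type} [NormedAddCommGroup E] [NormedSpace ℂ E]

/-- A function that is multiplied by `(δ T)⁻¹` under the parallel transport `T` along segments,
where `δ` is a character such as the determinant, is holomorphic when the connection form is of
type `(1, 0)`. -/
theorem contDiffOn_of_transport [CompleteSpace E] {A : E → E →L[ℝ] E →L[ℝ] E} {U : Set E}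
    (hU : IsOpen U) (hA : ContDiffOn ℝ ∞ A U)
    (hA₁ : ∀ z ∈ U, ∀ v w, A z (Complex.I • v) w = Complex.I • A z v w)
    (hA₂ : ∀ z ∈ U, ∀ v w, A z v (Complex.I • w) = Complex.I • A z v w)
    {δ : (E →L[ℂ] E) → ℂ} (hδ : DifferentiableAt ℂ δ 1) (hδ₁ : δ 1 = 1) {f : E → ℂ}
    (hf : ∀ z ∈ U, ∀ z' ∈ U, (∀ s ∈ Set.Icc (0 : ℝ) 1, z + s • (z' - z) ∈ U) →
      ∀ Φ : ℝ → E →L[ℂ] E, Φ 0 = 1 → (∀ w, ∀ s ∈ Set.Icc (0 : ℝ) 1,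
        HasDerivWithinAt (fun s ↦ Φ s w) (-A (z + s • (z' - z)) (z' - z) (Φ s w)) (Set.Icc 0 1) s) →
      IsUnit (Φ 1) → f z' * δ (Φ 1) = f z) :
    ContDiffOn ℂ ∞ f U := by
  set τ : (E →L[ℂ] E) →L[ℂ] ℂ := fderiv ℂ δ 1
  have hB : ContDiffOn ℝ ∞ (complexForm A) U :=
    (ContinuousLinearMap.compL ℝ E (E →L[ℝ] E) (E →L[ℂ] E) complexPart).contDiff.comp_contDiffOn hA
  -- The derivative of `f` is `f` times the trace of the connection form.
  have key {z : E} (hz : z ∈ U) :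
      HasFDerivAt f (f z • (τ.restrictScalars ℝ ∘L complexForm A z)) z := by
    have hex := eventually_exists_fundamental_solution hU hB.continuousOn hz
    classical
    set P : E → (ℝ → E →L[ℂ] E) → Prop := fun v Φ ↦ Φ 0 = 1 ∧ ∀ s ∈ Set.Icc (0 : ℝ) 1,
      HasDerivWithinAt Φ (-(complexForm A (z + s • v) v) * Φ s) (Set.Icc 0 1) s ∧ ‖Φ s‖ ≤ 2
    set Ψ : E → ℝ → E →L[ℂ] E := fun v ↦ if h : ∃ Φ, P v Φ then h.choose else fun _ ↦ 1
    have hΨ : ∀ᶠ v in 𝓝 (0 : E), (∀ s ∈ Set.Icc (0 : ℝ) 1, z + s • v ∈ U) ∧ P v (Ψ v) := by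
      filter_upwards [hex] with v hv
      refine ⟨hv.1, ?_⟩
      have h1 : Ψ v = hv.2.choose := dif_pos hv.2
      rw [h1]
      exact hv.2.choose_spec
    have hT : HasFDerivAt (fun v ↦ Ψ v 1) (-complexForm A z) 0 := by
      refine hasFDerivAt_of_fundamental_solution (hB.continuousOn.continuousAt (hU.mem_nhds hz)) ?_
      filter_upwards [hΨ] with v hv
      exact ⟨Ψ v, hv.2.1, rfl, hv.2.2⟩
    have hδT : Ψ 0 1 = 1 := by
      have h1 := hΨ.self_of_nhds.2
      have := norm_fundamental_solution_sub_le (B := fun _ ↦ 0) (B₀ := 0) (κ := 0) (η := 0) h1.1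
        (by simpa using h1.2) (by simp) (by simp) (by simp)
      simpa [sub_eq_zero] using this
    have hfT : ∀ᶠ v in 𝓝 (0 : E), f (z + v) * δ (Ψ v 1) = f z := by
      have hunit : ∀ᶠ v in 𝓝 (0 : E), IsUnit (Ψ v 1) :=
        hT.continuousAt.eventually (Units.isOpen.mem_nhds (by simp [hδT]))
      filter_upwards [hΨ, hunit] with v hv hvu
      have h1 : z + v - z = v := add_sub_cancel_left z v
      refine hf z hz (z + v) (by simpa using hv.1 1 (by simp)) (by rw [h1]; exact hv.1) _ hv.2.1
        (fun w s hs ↦ ?_) hvu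
      rw [h1]
      have h2 :=
        ((ContinuousLinearMap.apply ℂ E w).restrictScalars ℝ).hasFDerivAt.comp_hasDerivWithinAt
          s (hv.2.2 s hs).1
      refine h2.congr_deriv ?_
      rw [neg_mul]
      change -(complexForm A (z + s • v) v (Ψ v s w)) = _
      rw [complexForm_apply (hA₂ _ (hv.1 s hs))]
    have h3 : HasFDerivAt (fun v ↦ δ (Ψ v 1)) (-(τ.restrictScalars ℝ ∘L complexForm A z)) 0 := by
      have h4 : HasFDerivAt δ (τ.restrictScalars ℝ) (Ψ 0 1) := by
        rw [hδT]; exact hδ.hasFDerivAt.restrictScalars ℝ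
      have := h4.comp (0 : E) hT
      rwa [ContinuousLinearMap.comp_neg] at this
    have h5 : HasFDerivAt (fun v ↦ f z * (δ (Ψ v 1))⁻¹)
        (f z • (τ.restrictScalars ℝ ∘L complexForm A z)) 0 := by
      have h6 : HasFDerivAt (fun v ↦ (δ (Ψ v 1))⁻¹) (τ.restrictScalars ℝ ∘L complexForm A z) 0 := by
        have h7 : δ (Ψ 0 1) ≠ 0 := by rw [hδT, hδ₁]; exact one_ne_zero
        have h8 := ((hasDerivAt_inv h7).hasFDerivAt.restrictScalars ℝ).comp (0 : E) h3
        refine h8.congr_fderiv ?_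
        ext v
        rw [hδT, hδ₁]
        simp
      exact h6.const_mul (f z)
    have h9 : (fun v ↦ f (z + v)) =ᶠ[𝓝 0] fun v ↦ f z * (δ (Ψ v 1))⁻¹ := by
      have h10 : ∀ᶠ v in 𝓝 (0 : E), δ (Ψ v 1) ≠ 0 :=
        h3.continuousAt.eventually_ne (by rw [hδT, hδ₁]; exact one_ne_zero)
      filter_upwards [hfT, h10] with v hv hv'
      rw [eq_mul_inv_iff_mul_eq₀ hv', hv]
    have h11 := h5.congr_of_eventuallyEq h9
    rw [hasFDerivAt_iff_isLittleO_nhds_zero] at h11 ⊢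
    simpa using h11
  have hτ : ContDiffOn ℝ ∞ (fun z ↦ (τ.restrictScalars ℝ ∘L complexForm A z : E →L[ℝ] ℂ)) U :=
    (ContinuousLinearMap.compL ℝ E (E →L[ℂ] E) ℂ
      (τ.restrictScalars ℝ)).contDiff.comp_contDiffOn hB
  have hsmooth : ContDiffOn ℝ ∞ f U := by
    refine contDiffOn_infty.2 fun n ↦ ?_
    induction n with
    | zero => exact contDiffOn_zero.2 fun z hz ↦ (key hz).continuousAt.continuousWithinAt
    | succ n ih =>
      rw [Nat.cast_add, Nat.cast_one, contDiffOn_succ_iff_fderiv_of_isOpen hU]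
      refine ⟨fun z hz ↦ (key hz).differentiableAt.differentiableWithinAt, by simp, ?_⟩
      exact (ih.smul (hτ.of_le (by exact_mod_cast le_top))).congr fun z hz ↦ (key hz).fderiv
  refine contDiffOn_complex_of_real hU hsmooth fun z hz ↦
    DifferentiableAt.differentiableWithinAt ?_
  have h1 (v : E) : (f z • (τ.restrictScalars ℝ ∘L complexForm A z)) (Complex.I • v)
      = Complex.I • (f z • (τ.restrictScalars ℝ ∘L complexForm A z)) v := by
    simp only [smul_apply, ContinuousLinearMap.comp_apply, complexForm_I_smul (hA₁ z hz) (hA₂ z hz),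
      ContinuousLinearMap.coe_restrictScalars', map_smul]
    rw [smul_comm]
  exact ⟨toComplexLinear _ h1, .of_isLittleO (key hz).isLittleO⟩

end

/-! ### Concatenation of parallel transports -/

section

variable {E : Type*} [NormedAddCommGroup E] [NormedSpace ℂ E]
  {M : Type*} [TopologicalSpace M] [ChartedSpace E M] [IsManifold 𝓘(ℂ, E) ∞ M]
  {c : OpenPartialHomeomorph M E} {g : HermitianMetric E M} {D : TangentConnection E M}
  {x y z : M} {L L' : E →L[ℂ] E}

/-- `L` is the parallel transport from `x` to `y` along a smooth path, which can be taken to be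
parametrized by any interval. Tangent spaces are identified with the model space `E`, and only
complex linear transports are considered. -/
def IsSmoothTransport (D : TangentConnection E M) (x y : M) (L : E →L[ℂ] E) : Prop :=
  ∀ a b : ℝ, a < b → ∃ γ : ℝ → M, ContMDiffOn 𝓘(ℝ, ℝ) 𝓘(ℝ, E) ∞ γ (Set.Icc a b) ∧
    γ a = x ∧ γ b = y ∧ ∀ v : E, ∃ X : ℝ → TangentBundle 𝓘(ℝ, E) M,
      (∀ s ∈ Set.Icc a b, (X s).proj = γ s) ∧ IsParallelOn D X (Set.Icc a b) ∧
      X a = ⟨x, v⟩ ∧ X b = ⟨y, L v⟩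

/-- Compositions of parallel transports along smooth paths. -/
inductive IsTransport (D : TangentConnection E M) : M → M → (E →L[ℂ] E) → Prop
  | of_smooth {x y : M} {L : E →L[ℂ] E} : IsSmoothTransport D x y L → IsTransport D x y L
  | snoc {x y z : M} {L L' : E →L[ℂ] E} : IsTransport D x y L → IsSmoothTransport D y z L' →
      IsTransport D x z (L' * L)

theorem IsTransport.trans (h : IsTransport D x y L) (h' : IsTransport D y z L') :
    IsTransport D x z (L' * L) := by
  induction h' with
  | of_smooth h' => exact h.snoc h'
  | snoc _ h'' ih => rw [mul_assoc]; exact ih.snoc h''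

theorem IsParallelOn.congr {X X' : ℝ → TangentBundle 𝓘(ℝ, E) M} {S : Set ℝ}
    (hX : IsParallelOn D X S) (h : Set.EqOn X' X S) : IsParallelOn D X' S := by
  intro e he s hs hse
  have key (p p' : TangentBundle 𝓘(ℝ, E) M) (hp : p = p') (v v' : E) (hv : v = v') :
      -(e ⟨p.proj, D (fun y ↦ e.symm y (e p).2) p.proj v⟩).2
        = -(e ⟨p'.proj, D (fun y ↦ e.symm y (e p').2) p'.proj v'⟩).2 := by
    subst hp hv; rfl
  have h1 := hX e s hs (by rwa [← h hs])
  refine (h1.congr (fun t ht ↦ by rw [h ht]) (by rw [h hs])).congr_deriv ?_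
  exact key _ _ (h hs).symm _ _
    (velocityWithin_congr (fun t ht ↦ congrArg Bundle.TotalSpace.proj (h ht)) hs).symm

/-- Two functions that agree at `m`, glued there. -/
theorem eqOn_glue {Y : Type*} {p q : ℝ → Y} {m b : ℝ} (h : p m = q m) :
    Set.EqOn (fun s ↦ if s ≤ m then p s else q s) p (Set.Iic m) ∧
      Set.EqOn (fun s ↦ if s ≤ m then p s else q s) q (Set.Icc m b) := by
  refine ⟨fun s hs ↦ if_pos hs, fun s hs ↦ ?_⟩
  rcases hs.1.eq_or_lt with rfl | h'
  · simpa using h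
  · exact if_neg h'.not_ge

/-- Compositions of transports along smooth paths are transports along piecewise smooth paths. -/
theorem IsTransport.exists_piecewise (h : IsTransport D x y L) {a b : ℝ} (hab : a < b) :
    ∃ (γ : ℝ → M) (N : ℕ) (t : ℕ → ℝ), Monotone t ∧ t 0 = a ∧ t N = b ∧
      (∀ i < N, ContMDiffOn 𝓘(ℝ, ℝ) 𝓘(ℝ, E) ∞ γ (Set.Icc (t i) (t (i + 1)))) ∧
      γ a = x ∧ γ b = y ∧ ∀ v : E, ∃ X : ℝ → TangentBundle 𝓘(ℝ, E) M,
        (∀ s ∈ Set.Icc a b, (X s).proj = γ s) ∧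
        (∀ i < N, IsParallelOn D X (Set.Icc (t i) (t (i + 1)))) ∧
        X a = ⟨x, v⟩ ∧ X b = ⟨y, L v⟩ := by
  classical
  induction h generalizing a b with
  | of_smooth h =>
    obtain ⟨γ, hγ, hx, hy, hX⟩ := h a b hab
    refine ⟨γ, 1, fun i ↦ if i = 0 then a else b, ?_, by simp, by simp, ?_, hx, hy, fun v ↦ ?_⟩
    · intro i j hij
      simp only
      split_ifs with h1 h2 h2
      · exact le_rfl
      · exact hab.le
      · omega
      · exact le_rfl
    · intro i hi
      obtain rfl : i = 0 := by omega
      simpa using hγ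
    · obtain ⟨X, h1, h2, h3⟩ := hX v
      refine ⟨X, h1, fun i hi ↦ ?_, h3⟩
      obtain rfl : i = 0 := by omega
      simpa using h2
  | @snoc y z L L' _ h' ih =>
    obtain ⟨m, ham, hmb⟩ := exists_between hab
    obtain ⟨γ, N, t, ht, ht0, htN, hγ, hx, hy, hX⟩ := ih ham
    obtain ⟨γ', hγ', hy', hz', hX'⟩ := h' m b hmb
    have htm {i : ℕ} (hi : i ≤ N) : t i ≤ m := htN ▸ ht hi
    have hsub {i : ℕ} (hi : i < N) : Set.Icc (t i) (t (i + 1)) ⊆ Set.Iic m := fun s hs ↦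
      hs.2.trans (htm hi)
    have hcase (i : ℕ) (hi : i < N + 1) : Set.Icc (if i ≤ N then t i else b)
        (if i + 1 ≤ N then t (i + 1) else b) = if i < N then Set.Icc (t i) (t (i + 1))
          else Set.Icc m b := by
      by_cases h : i < N
      · simp only [if_pos h.le, if_pos h, if_pos (Nat.succ_le_of_lt h)]
      · obtain rfl : i = N := by omega
        simp [htN]
    have hγγ := eqOn_glue (b := b) (hy.trans hy'.symm)
    refine ⟨fun s ↦ if s ≤ m then γ s else γ' s, N + 1, fun i ↦ if i ≤ N then t i else b, ?_,
      by simp [ht0], by simp, fun i hi ↦ ?_, by simp [ham.le, hx], by simp [hmb.not_ge, hz'],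
      fun v ↦ ?_⟩
    · intro i j hij
      simp only
      split_ifs with h1 h2 h2
      · exact ht hij
      · exact (htm h1).trans hmb.le
      · omega
      · exact le_rfl
    · simp only [hcase i hi]
      split_ifs with h
      · exact (hγ i h).congr (hγγ.1.mono (hsub h))
      · exact hγ'.congr hγγ.2
    · obtain ⟨X, h1, h2, h3, h4⟩ := hX v
      obtain ⟨X', h1', h2', h3', h4'⟩ := hX' (L v)
      have hXX := eqOn_glue (b := b) (h4.trans h3'.symm)
      refine ⟨fun s ↦ if s ≤ m then X s else X' s, fun s hs ↦ ?_, fun i hi ↦ ?_,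
        by simp [ham.le, h3], by simp [hmb.not_ge, h4']⟩
      · simp only
        split_ifs with h
        · exact h1 s ⟨hs.1, h⟩
        · exact h1' s ⟨(not_le.1 h).le, hs.2⟩
      · simp only [hcase i hi]
        split_ifs with h
        · exact (h2 i h).congr (hXX.1.mono (hsub h))
        · exact h2'.congr hXX.2

theorem IsTransport.mem_holonomy (h : IsTransport D x x L) :
    (show TangentSpace 𝓘(ℝ, E) x →ₗ[ℝ] TangentSpace 𝓘(ℝ, E) x from
      ((L.restrictScalars ℝ : E →L[ℝ] E) : E →ₗ[ℝ] E)) ∈ holonomy D x := by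
  obtain ⟨γ, N, t, ht, ht0, htN, hγ, hx, hy, hX⟩ := h.exists_piecewise zero_lt_one
  refine ⟨⟨γ, N, t, ht, ht0, htN, hγ, hx, hy⟩, fun v ↦ ?_⟩
  obtain ⟨X, h1, h2, h3, h4⟩ := hX v
  exact ⟨X, ⟨h1, h2⟩, h3, h4⟩

theorem det_eq_one_of_isTransport (hhol : holonomy D x ⊆ specialUnitary g x)
    (h : IsTransport D x x L) : L.det = 1 := by
  obtain ⟨-, Q, hQ, hdet⟩ := hhol h.mem_holonomy
  rw [← hdet]
  exact congrArg LinearMap.det (LinearMap.ext fun v ↦ (hQ v).symm)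

/-- When transports along closed paths have determinant one, there is a density that is compatible
with all transports between points that are also joined by a transport in the opposite direction.
Asking for the latter makes the relation of being joined symmetric by definition. -/
theorem exists_density (H : ∀ x : M, ∀ L, IsTransport D x x L → L.det = 1)
    (h1 : ∀ x : M, IsTransport D x x 1) :
    ∃ κ : M → ℂ, (∀ x, κ x ≠ 0) ∧ ∀ x y S S', IsTransport D x y S → IsTransport D y x S' →
      κ y * S.det = κ x := by
  have det_mul (A B : E →L[ℂ] E) : (A * B).det = A.det * B.det := LinearMap.det_comp _ _
  let R : Setoid M :=
    { r := fun x y ↦ (∃ S, IsTransport D x y S) ∧ ∃ S, IsTransport D y x S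
      iseqv :=
        { refl := fun x ↦ ⟨⟨1, h1 x⟩, ⟨1, h1 x⟩⟩
          symm := fun h ↦ ⟨h.2, h.1⟩
          trans := fun ⟨⟨_, h1⟩, ⟨_, h2⟩⟩ ⟨⟨_, h3⟩, ⟨_, h4⟩⟩ ↦
            ⟨⟨_, h1.trans h3⟩, ⟨_, h4.trans h2⟩⟩ } }
  -- A base point in each class, and a transport to it.
  let r (x : M) : M := (Quotient.mk R x).out
  have hr (x : M) : R.r (r x) x := Quotient.mk_out x
  choose K hK using fun x ↦ (hr x).2
  choose K' hK' using fun x ↦ (hr x).1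
  have hdet (x : M) : (K' x).det * (K x).det = 1 := by
    rw [← det_mul]
    exact H x _ ((hK x).trans (hK' x))
  -- The value at `x` is the factor by which volumes change from `x` to the base point of its class.
  refine ⟨fun x ↦ (K x).det, fun x h ↦ ?_, fun x y S S' hS hS' ↦ ?_⟩
  · simpa [h] using hdet x
  · have hxy : r x = r y := congrArg Quotient.out (Quotient.sound ⟨⟨S, hS⟩, ⟨S', hS'⟩⟩)
    have h2 : IsTransport D x x (K' x * (K y * S)) := by
      refine (hS.trans (hK y)).trans ?_
      rw [← hxy]
      exact hK' x
    have h3 := H x _ h2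
    rw [det_mul, det_mul, ← hdet x] at h3
    refine mul_left_cancel₀ (fun h ↦ ?_) h3
    simpa [h] using hdet x

end

/-! ### Parallel transport along segments in a chart -/

section

section Segment

variable {E : Type*} [NormedAddCommGroup E] [NormedSpace ℂ E]
  {M : Type*} [TopologicalSpace M] [ChartedSpace E M] [IsManifold 𝓘(ℂ, E) ∞ M]
  {c : OpenPartialHomeomorph M E} {g : HermitianMetric E M} {D : TangentConnection E M}

variable [FiniteDimensional ℂ E]

/-- Parallel transport along the preimage of a segment under a chart. -/
theorem isSmoothTransport_segment (hD : IsChernConnection g D) (hc : c ∈ atlas E M) {z z' : E}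
    (hzz' : ∀ s ∈ Set.Icc (0 : ℝ) 1, z + s • (z' - z) ∈ c.target) {Φ : ℝ → E →L[ℂ] E}
    (hΦ₀ : Φ 0 = 1) (hΦ : ∀ w, ∀ s ∈ Set.Icc (0 : ℝ) 1, HasDerivWithinAt (fun s ↦ Φ s w)
      (-chartForm g c (z + s • (z' - z)) (z' - z) (Φ s w)) (Set.Icc 0 1) s) :
    IsSmoothTransport D (c.symm z) (c.symm z')
      ((frame c (c.symm z')).comp ((Φ 1).comp (coframe c (c.symm z)))) := by
  intro a b hab
  set u : ℝ → ℝ := fun s ↦ (b - a)⁻¹ * (s - a) with hu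
  have hba : 0 < b - a := sub_pos.2 hab
  have hua : u a = 0 := by simp [hu]
  have hub : u b = 1 := by simp [hu, hba.ne']
  have hmaps : Set.MapsTo u (Set.Icc a b) (Set.Icc 0 1) := fun s hs ↦ by
    refine ⟨mul_nonneg (inv_nonneg.2 hba.le) (sub_nonneg.2 hs.1), ?_⟩
    rw [hu, inv_mul_le_iff₀ hba]
    linarith [hs.2]
  have hu' (s : ℝ) : HasDerivWithinAt u (b - a)⁻¹ (Set.Icc a b) s := by
    simpa using (((hasDerivAt_id s).sub_const a).const_mul (b - a)⁻¹).hasDerivWithinAt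
  set ℓ : ℝ → E := fun s ↦ z + u s • (z' - z) with hℓ
  have hmem (s : ℝ) (hs : s ∈ Set.Icc a b) : ℓ s ∈ c.target := hzz' _ (hmaps hs)
  have hℓ' (s : ℝ) : HasDerivWithinAt ℓ ((b - a)⁻¹ • (z' - z)) (Set.Icc a b) s :=
    ((hu' s).smul_const (z' - z)).const_add z
  have hγ : ContMDiffOn 𝓘(ℝ, ℝ) 𝓘(ℝ, E) ∞ (fun s ↦ c.symm (ℓ s)) (Set.Icc a b) := by
    have h1 : ContDiff ℝ ∞ ℓ := by fun_prop
    exact (contMDiffOn_symm_of_mem_maximalAtlas (IsManifold.subset_maximalAtlas hc)).comp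
      h1.contMDiff.contMDiffOn hmem
  refine ⟨fun s ↦ c.symm (ℓ s), hγ, by simp [hℓ, hua], by simp [hℓ, hub], fun v ↦ ?_⟩
  set w : E := coframe c (c.symm z) v with hw
  set X : ℝ → TangentBundle 𝓘(ℝ, E) M := fun s ↦ ⟨c.symm (ℓ s), frame c (c.symm (ℓ s)) (Φ (u s) w)⟩
    with hX
  have hbase : HasDifferentiableBase X (Set.Icc a b) := hγ.mdifferentiableOn (by simp)
  have hcoord (s : ℝ) (hs : s ∈ Set.Icc a b) : coord c X s = Φ (u s) w :=
    coframe_frame hc (c.map_target (hmem s hs)) _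
  refine ⟨X, fun s _ ↦ rfl, isParallelOn_of_isParallelInChartAt hD hbase fun s hs ↦
    ⟨c, hc, c.map_target (hmem s hs), ?_⟩, ?_, ?_⟩
  · have hvel : velocityCoord c X (Set.Icc a b) s = (b - a)⁻¹ • (z' - z) := by
      have h1 := hbase.hasDerivWithinAt hs hc (c.map_target (hmem s hs))
      have h2 : HasDerivWithinAt (fun τ ↦ c (X τ).proj) ((b - a)⁻¹ • (z' - z)) (Set.Icc a b) s :=
        (hℓ' s).congr (fun t ht ↦ c.right_inv (hmem t ht)) (c.right_inv (hmem s hs))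
      exact (uniqueDiffOn_Icc hab s hs).eq_deriv _ h1 h2
    unfold IsParallelInChartAt
    have h3 := (hΦ w (u s) (hmaps hs)).scomp s (hu' s) hmaps
    refine (h3.congr (fun t ht ↦ hcoord t ht) (hcoord s hs)).congr_deriv ?_
    have h4 : c (X s).proj = ℓ s := c.right_inv (hmem s hs)
    rw [hvel, hcoord s hs, h4, map_smul, smul_apply, smul_neg]
  · have h1 : ℓ a = z := by simp [hℓ, hua]
    have h2 : z ∈ c.target := by simpa using hzz' 0 (by simp)
    have h3 : frame c (c.symm z) (Φ 0 w) = v := by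
      rw [hΦ₀]; exact frame_coframe hc (c.map_target h2) v
    have h4 : X a = ⟨c.symm (ℓ a), frame c (c.symm (ℓ a)) (Φ 0 w)⟩ := by simp only [hX, hua]
    exact h4.trans ((congrArg (fun ζ ↦ (⟨c.symm ζ, frame c (c.symm ζ) (Φ 0 w)⟩ :
      TangentBundle 𝓘(ℝ, E) M)) h1).trans
      (congrArg (fun v : E ↦ (⟨c.symm z, v⟩ : TangentBundle 𝓘(ℝ, E) M)) h3))
  · have h1 : ℓ b = z' := by simp [hℓ, hub]
    have h4 : X b = ⟨c.symm (ℓ b), frame c (c.symm (ℓ b)) (Φ 1 w)⟩ := by simp only [hX, hub]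
    exact h4.trans (congrArg (fun ζ ↦ (⟨c.symm ζ, frame c (c.symm ζ) (Φ 1 w)⟩ :
      TangentBundle 𝓘(ℝ, E) M)) h1)

/-- The constant path transports by the identity. -/
theorem isSmoothTransport_one (hD : IsChernConnection g D) (x : M) :
    IsSmoothTransport D x x 1 := by
  have hx := mem_chart_source E x
  have h1 := isSmoothTransport_segment hD (chart_mem_atlas E x) (z := chartAt E x x)
    (z' := chartAt E x x) (Φ := fun _ ↦ 1) (by simp) rfl
    (fun w s _ ↦ by simpa using! hasDerivWithinAt_const s _ w)
  rw [(chartAt E x).left_inv hx] at h1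
  convert h1 using 1
  ext v
  exact (frame_coframe (chart_mem_atlas E x) hx v).symm

end Segment

theorem contDiff_det {n : ℕ} {E : Type*} [NormedAddCommGroup E] [NormedSpace ℂ E]
    [FiniteDimensional ℂ E] (b : Module.Basis (Fin n) ℂ E) :
    ContDiff ℂ ∞ (fun L : E →L[ℂ] E ↦ L.det) := by
  have h1 : (fun L : E →L[ℂ] E ↦ L.det) = fun L ↦ ∑ p : Equiv.Perm (Fin n),
      (Equiv.Perm.sign p : ℂ) * ∏ i, b.equivFunL (L (b i)) (p i) := by
    funext L
    rw [ContinuousLinearMap.det, ← LinearMap.det_toMatrix b, Matrix.det_apply']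
    refine Finset.sum_congr rfl fun p _ ↦ ?_
    simp [LinearMap.toMatrix_apply]
  rw [h1]
  refine ContDiff.sum fun p _ ↦ contDiff_const.mul (contDiff_prod fun i _ ↦ ?_)
  have h2 : ContDiff ℂ ∞ (fun L : E →L[ℂ] E ↦ b.equivFunL (L (b i))) :=
    b.equivFunL.contDiff.comp (ContinuousLinearMap.apply ℂ E (b i)).contDiff
  exact contDiff_pi.1 h2 (p i)

section Density

variable {E : Type*} [NormedAddCommGroup E] [NormedSpace ℂ E]
  {M : Type*} [TopologicalSpace M] [ChartedSpace E M] [IsManifold 𝓘(ℂ, E) ∞ M]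
  {c : OpenPartialHomeomorph M E} {g : HermitianMetric E M} {D : TangentConnection E M}

theorem det_frame_mul_det_coframe (hc : c ∈ atlas E M) {y : M} (hy : y ∈ c.source) :
    (coframe c y).det * (frame c y).det = 1 := by
  have : ((coframe c y).comp (frame c y)).det = 1 := by
    have h : (coframe c y).comp (frame c y) = .id ℂ E := ContinuousLinearMap.ext fun v ↦
      coframe_frame hc hy v
    rw [h]
    exact LinearMap.det_id
  rw [← this]
  exact (LinearMap.det_comp _ _).symm

/-- The fundamental solution along the reversed segment is `Φ (1 - s) Φ(1)⁻¹`. -/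
theorem exists_reverse_fundamental_solution {A : E → E →L[ℝ] E →L[ℝ] E} {z z' : E}
    {Φ : ℝ → E →L[ℂ] E} (hΦ : ∀ w, ∀ s ∈ Set.Icc (0 : ℝ) 1, HasDerivWithinAt (fun s ↦ Φ s w)
      (-A (z + s • (z' - z)) (z' - z) (Φ s w)) (Set.Icc 0 1) s) (hu : IsUnit (Φ 1)) :
    ∃ Ψ : ℝ → E →L[ℂ] E, Ψ 0 = 1 ∧ ∀ w, ∀ s ∈ Set.Icc (0 : ℝ) 1,
      HasDerivWithinAt (fun s ↦ Ψ s w)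
        (-A (z' + s • (z - z')) (z - z') (Ψ s w)) (Set.Icc 0 1) s := by
  obtain ⟨T, hT⟩ := hu
  refine ⟨fun s ↦ Φ (1 - s) * (T⁻¹ : (E →L[ℂ] E)ˣ), by simp [← hT], fun w s hs ↦ ?_⟩
  have h1 : Set.MapsTo (fun s : ℝ ↦ 1 - s) (Set.Icc 0 1) (Set.Icc 0 1) := fun s hs ↦
    ⟨by linarith [hs.2], by linarith [hs.1]⟩
  have h2 : HasDerivWithinAt (fun s : ℝ ↦ 1 - s) (-1) (Set.Icc 0 1) s :=
    ((hasDerivAt_id s).const_sub 1).hasDerivWithinAt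
  have h3 := (hΦ (((T⁻¹ : (E →L[ℂ] E)ˣ) : E →L[ℂ] E) w) _ (h1 hs)).scomp s h2 h1
  refine h3.congr_deriv ?_
  have h4 : z + (1 - s) • (z' - z) = z' + s • (z - z') := by module
  have h5 : A (z' + s • (z - z')) (z - z') = -A (z' + s • (z - z')) (z' - z) := by
    rw [← map_neg, neg_sub]
  rw [h4, h5, neg_smul, one_smul]
  rfl

end Density

section Holomorphic

variable {E : Type} [NormedAddCommGroup E] [NormedSpace ℂ E] [FiniteDimensional ℂ E]
  {M : Type*} [TopologicalSpace M] [ChartedSpace E M] [IsManifold 𝓘(ℂ, E) ∞ M]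
  {c : OpenPartialHomeomorph M E} {g : HermitianMetric E M} {D : TangentConnection E M}

/-- A density that is compatible with parallel transport is holomorphic in every chart. -/
theorem contDiffOn_density {n : ℕ} (b : Module.Basis (Fin n) ℂ E) (hD : IsChernConnection g D)
    {κ : M → ℂ} (hκ : ∀ x y S S', IsTransport D x y S → IsTransport D y x S' →
      κ y * S.det = κ x) (hc : c ∈ atlas E M) :
    ContDiffOn ℂ ∞ (fun z ↦ κ (c.symm z) * (frame c (c.symm z)).det) c.target := by
  have hdet1 : (1 : E →L[ℂ] E).det = 1 := LinearMap.det_id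
  refine contDiffOn_of_transport (A := chartForm g c) c.open_target
    (fun z hz ↦ (contDiffAt_chartForm g hc hz).contDiffWithinAt)
    (fun z hz ↦ chartForm_I_smul_left g hc hz) (fun z hz ↦ chartForm_I_smul_right g hc hz)
    ((contDiff_det b).differentiable (by simp) 1) hdet1 fun z hz z' hz' hseg Φ hΦ₀ hΦ hu ↦ ?_
  obtain ⟨Ψ, hΨ₀, hΨ⟩ := exists_reverse_fundamental_solution hΦ hu
  have hseg' : ∀ s ∈ Set.Icc (0 : ℝ) 1, z' + s • (z - z') ∈ c.target := fun s hs ↦ by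
    have := hseg (1 - s) ⟨by linarith [hs.2], by linarith [hs.1]⟩
    convert this using 1
    module
  have h1 := hκ _ _ _ _ (.of_smooth (isSmoothTransport_segment hD hc hseg hΦ₀ hΦ))
    (.of_smooth (isSmoothTransport_segment hD hc hseg' hΨ₀ hΨ))
  have det_comp (A B : E →L[ℂ] E) : (A.comp B).det = A.det * B.det := LinearMap.det_comp _ _
  rw [det_comp, det_comp] at h1
  rw [← h1]
  linear_combination (-κ (c.symm z') * (frame c (c.symm z')).det * (Φ 1).det)
    * det_frame_mul_det_coframe hc (c.map_target hz)

end Holomorphic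

end

/-! ### The canonical bundle in coordinates -/

section

variable {E : Type*} [NormedAddCommGroup E] [NormedSpace ℂ E] {n : ℕ}
  {M : Type*} [TopologicalSpace M] [ChartedSpace E M]

/-- In the chart `c`, the coefficient of the `n`-form which takes the value `κ y` on a fixed basis
of the tangent space at `y`. -/
def densityInChart (κ : M → ℂ) (c : OpenPartialHomeomorph M E) (y : M) : ℂ :=
  κ y * (frame c y).det

variable [IsManifold 𝓘(ℂ, E) ∞ M]

theorem trivializationAt_canonical_apply {x : M}
    (p : Bundle.TotalSpace (E [⋀^Fin n]→L[ℂ] ℂ) (CanonicalFibre n E M))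
    (hp : p.proj ∈ (chartAt E x).source) (w : Fin n → E) :
    (trivializationAt (E [⋀^Fin n]→L[ℂ] ℂ) (CanonicalFibre n E M) x p).2 w
      = (show E [⋀^Fin n]→L[ℂ] ℂ from p.2) (fun i ↦ frame (chartAt E x) p.proj (w i)) := by
  rw [FiberBundle.trivializationAt_continuousAlternatingMap_apply]
  have h : (fun i ↦ (trivializationAt E (TangentSpace 𝓘(ℂ, E)) x).symmL ℂ p.proj (w i))
      = fun i ↦ frame (chartAt E x) p.proj (w i) :=
    funext fun i ↦ ((trivializationAt E (TangentSpace 𝓘(ℂ, E)) x).symmL_apply hp (w i)).trans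
      (trivializationAt_complex_symm hp (w i))
  have h' (η : E [⋀^Fin n]→L[ℂ] ℂ) (u : Fin n → E) :
      (((Bundle.Trivial.trivialization M ℂ).continuousLinearMapAt ℂ
        p.proj).compContinuousAlternatingMap η) u = η u := by simp
  exact (h' _ _).trans (congrArg (show E [⋀^Fin n]→L[ℂ] ℂ from p.2) h)

theorem alternating_apply_comp (b : Module.Basis (Fin n) ℂ E) (η : E [⋀^Fin n]→L[ℂ] ℂ)
    (L : E →L[ℂ] E) : η (fun i ↦ L (b i)) = L.det * η b := by
  have h := η.toAlternatingMap.eq_smul_basis_det b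
  have h1 (w : Fin n → E) : η w = η b * b.det w := congrArg (fun f : E [⋀^Fin n]→ₗ[ℂ] ℂ ↦ f w) h
  have h2 := b.det_comp (L : E →ₗ[ℂ] E) b
  rw [h1, mul_comm]
  refine congrArg (· * η b) ?_
  rw [b.det_self, mul_one] at h2
  exact h2

/-- The coordinate of the value of an `n`-form on the fixed basis. -/
theorem trivializationAt_canonical_basis (b : Module.Basis (Fin n) ℂ E) {x : M}
    (p : Bundle.TotalSpace (E [⋀^Fin n]→L[ℂ] ℂ) (CanonicalFibre n E M))
    (hp : p.proj ∈ (chartAt E x).source) :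
    (trivializationAt (E [⋀^Fin n]→L[ℂ] ℂ) (CanonicalFibre n E M) x p).2 b
      = (frame (chartAt E x) p.proj).det * (show E [⋀^Fin n]→L[ℂ] ℂ from p.2) b :=
  (trivializationAt_canonical_apply p hp b).trans (alternating_apply_comp b _ _)

/-- The determinant with respect to a basis, as a continuous alternating map. -/
def basisForm [FiniteDimensional ℂ E] (b : Module.Basis (Fin n) ℂ E) : E [⋀^Fin n]→L[ℂ] ℂ :=
  { b.det with
    cont := by
      have h : Continuous fun w : Fin n → E ↦ Matrix.det fun i j ↦ b.equivFunL (w j) i := by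
        refine Continuous.matrix_det (continuous_matrix fun i j ↦ ?_)
        exact (continuous_apply i).comp (b.equivFunL.continuous.comp (continuous_apply j))
      exact h }

theorem basisForm_self [FiniteDimensional ℂ E] (b : Module.Basis (Fin n) ℂ E) :
    basisForm b b = 1 := b.det_self

theorem eq_smul_basisForm [FiniteDimensional ℂ E] (b : Module.Basis (Fin n) ℂ E)
    (η : E [⋀^Fin n]→L[ℂ] ℂ) : η = η b • basisForm b := by
  have h := η.toAlternatingMap.eq_smul_basis_det b
  ext w
  exact congrArg (fun f : E [⋀^Fin n]→ₗ[ℂ] ℂ ↦ f w) h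

/-- The canonical bundle is holomorphically trivial when there is a nowhere vanishing holomorphic
density. -/
theorem isHolomorphicallyTrivial_of_density [FiniteDimensional ℂ E] (b : Module.Basis (Fin n) ℂ E)
    {κ : M → ℂ} (h0 : ∀ x, κ x ≠ 0)
    (hκ : ∀ x, ContMDiffAt 𝓘(ℂ, E) 𝓘(ℂ, ℂ) ∞ (densityInChart κ (chartAt E x)) x) :
    IsHolomorphicallyTrivial (E := E) (M := M) (E [⋀^Fin n]→L[ℂ] ℂ) (CanonicalFibre n E M) := by
  let Ψ (x : M) : (E [⋀^Fin n]→L[ℂ] ℂ) ≃ₗ[ℂ] ℂ :=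
    { toFun := fun η ↦ η b * (κ x)⁻¹
      map_add' := fun η η' ↦ add_mul (η b) (η' b) _
      map_smul' := fun a η ↦ mul_assoc a (η b) _
      invFun := fun t ↦ (t * κ x) • basisForm b
      left_inv := fun η ↦ by
        simp only [inv_mul_cancel_right₀ (h0 x)]
        exact (eq_smul_basisForm b η).symm
      right_inv := fun t ↦ by
        change (t * κ x) * basisForm b b * _ = t
        rw [basisForm_self, mul_one, mul_inv_cancel_right₀ (h0 x)] }
  have hdet {x y : M} (hy : y ∈ (chartAt E x).source) : (frame (chartAt E x) y).det ≠ 0 :=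
    right_ne_zero_of_mul_eq_one (det_frame_mul_det_coframe (chart_mem_atlas E x) hy)
  have hne {x y : M} (hy : y ∈ (chartAt E x).source) : densityInChart κ (chartAt E x) y ≠ 0 :=
    mul_ne_zero (h0 y) (hdet hy)
  refine ⟨Ψ, fun p ↦ ?_, fun q ↦ ?_⟩
  · set x := p.proj
    have hp := (Bundle.contMDiffAt_totalSpace (IB := 𝓘(ℂ, E)) (n := ∞)).1 (contMDiffAt_id (x := p))
    have hp1 : ContMDiffAt (𝓘(ℂ, E).prod 𝓘(ℂ, E [⋀^Fin n]→L[ℂ] ℂ)) 𝓘(ℂ, E) ∞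
      (fun q : Bundle.TotalSpace (E [⋀^Fin n]→L[ℂ] ℂ) (CanonicalFibre n E M) ↦ q.proj) p := hp.1
    refine Bundle.contMDiffAt_totalSpace.2 ⟨hp.1, ?_⟩
    have h1 := (ContinuousAlternatingMap.apply ℂ E ℂ b).contMDiff.contMDiffAt.comp p hp.2
    have h2 : ContMDiffAt (𝓘(ℂ, E).prod 𝓘(ℂ, E [⋀^Fin n]→L[ℂ] ℂ)) 𝓘(ℂ, ℂ) ∞
      (fun q : Bundle.TotalSpace (E [⋀^Fin n]→L[ℂ] ℂ) (CanonicalFibre n E M) ↦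
        densityInChart κ (chartAt E x) q.proj) p := ContMDiffAt.comp p (hκ x) hp1
    refine (h1.mul (h2.inv₀ (hne (mem_chart_source E x)))).congr_of_eventuallyEq ?_
    filter_upwards [hp1.continuousAt.preimage_mem_nhds
      ((chartAt E x).open_source.mem_nhds (mem_chart_source E x))] with q hq
    have h3 := trivializationAt_canonical_basis b q hq
    refine Eq.trans ?_ (congrArg (· * (densityInChart κ (chartAt E x) q.proj)⁻¹) h3.symm)
    change (show E [⋀^Fin n]→L[ℂ] ℂ from q.2) b * (κ q.proj)⁻¹ = _
    have h4 := hdet hq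
    have h5 := h0 q.proj
    simp only [densityInChart]
    field_simp
  · set x := q.proj
    have hq := (Bundle.contMDiffAt_totalSpace (IB := 𝓘(ℂ, E)) (n := ∞)).1 (contMDiffAt_id (x := q))
    have hq1 : ContMDiffAt (𝓘(ℂ, E).prod 𝓘(ℂ, ℂ)) 𝓘(ℂ, E) ∞
      (fun q : Bundle.TotalSpace ℂ (Bundle.Trivial M ℂ) ↦ q.proj) q := hq.1
    have hq2 : ContMDiffAt (𝓘(ℂ, E).prod 𝓘(ℂ, ℂ)) 𝓘(ℂ, ℂ) ∞
      (fun q : Bundle.TotalSpace ℂ (Bundle.Trivial M ℂ) ↦ (show ℂ from q.2)) q := hq.2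
    refine Bundle.contMDiffAt_totalSpace.2 ⟨hq.1, ?_⟩
    have h2 := hq2.mul (ContMDiffAt.comp q (hκ x) hq1)
    have h3 := ((ContinuousLinearMap.id ℂ ℂ).smulRight
      (basisForm b)).contMDiff.contMDiffAt.comp q h2
    refine h3.congr_of_eventuallyEq ?_
    filter_upwards [hq1.continuousAt.preimage_mem_nhds
      ((chartAt E x).open_source.mem_nhds (mem_chart_source E x))] with p hp
    refine (eq_smul_basisForm b _).trans (congrArg (· • basisForm b) ?_)
    refine (trivializationAt_canonical_basis b
      ⟨p.proj, ((show ℂ from p.2) * κ p.proj) • basisForm b⟩ hp).trans ?_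
    change _ * ((show ℂ from p.2) * κ p.proj * basisForm b b) = (show ℂ from p.2) * _
    rw [basisForm_self]
    simp only [densityInChart, Function.comp_apply]
    ring

/-- A holomorphically trivial canonical bundle has a nowhere vanishing holomorphic density. -/
theorem exists_density_of_isHolomorphicallyTrivial (b : Module.Basis (Fin n) ℂ E)
    (h : IsHolomorphicallyTrivial (E := E) (M := M) (E [⋀^Fin n]→L[ℂ] ℂ) (CanonicalFibre n E M)) :
    ∃ κ : M → ℂ, (∀ x, κ x ≠ 0) ∧
      ∀ x, ContMDiffAt 𝓘(ℂ, E) 𝓘(ℂ, ℂ) ∞ (densityInChart κ (chartAt E x)) x := by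
  obtain ⟨Ψ, -, hΨ⟩ := h
  let Ω (x : M) : E [⋀^Fin n]→L[ℂ] ℂ := (Ψ x).symm 1
  have hΩ0 (x : M) : Ω x ≠ 0 := fun h ↦ by
    have := congrArg (Ψ x) h
    exact one_ne_zero (((Ψ x).apply_symm_apply 1).symm.trans (this.trans (Ψ x).map_zero))
  refine ⟨fun x ↦ Ω x b, fun x h ↦ hΩ0 x ?_, fun x ↦ ?_⟩
  · have := (Ω x).toAlternatingMap.eq_smul_basis_det b
    ext w
    refine (congrArg (fun f : E [⋀^Fin n]→ₗ[ℂ] ℂ ↦ f w) this).trans ?_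
    change Ω x b * b.det w = 0
    rw [show Ω x b = 0 from h, zero_mul]
  · have h1 : ContMDiffAt 𝓘(ℂ, E) (𝓘(ℂ, E).prod 𝓘(ℂ, ℂ)) ∞
        (fun y : M ↦ (⟨y, (1 : ℂ)⟩ : Bundle.TotalSpace ℂ (Bundle.Trivial M ℂ))) x :=
      Bundle.contMDiffAt_totalSpace.2 ⟨contMDiffAt_id, contMDiffAt_const⟩
    have h2 := (Bundle.contMDiffAt_totalSpace.1 ((hΨ _).comp x h1)).2
    have h3 := (ContinuousAlternatingMap.apply ℂ E ℂ b).contMDiff.contMDiffAt.comp x h2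
    refine h3.congr_of_eventuallyEq ?_
    filter_upwards [(chartAt E x).open_source.mem_nhds (mem_chart_source E x)] with y hy
    exact ((trivializationAt_canonical_basis b ⟨y, Ω y⟩ hy).trans (mul_comm _ _)).symm

end

/-! ### Special unitary holonomy gives a holomorphic volume form -/

section

theorem contMDiffAt_iff_contDiffAt_comp_symm {𝕜 : Type*} [NontriviallyNormedField 𝕜]
    {E : Type*} [NormedAddCommGroup E] [NormedSpace 𝕜 E] {M : Type*} [TopologicalSpace M]
    [ChartedSpace E M] [IsManifold 𝓘(𝕜, E) ∞ M] {F : Type*} [NormedAddCommGroup F] [NormedSpace 𝕜 F]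
    {f : M → F} (x : M) : ContMDiffAt 𝓘(𝕜, E) 𝓘(𝕜, F) ∞ f x
      ↔ ContDiffAt 𝕜 ∞ (f ∘ (chartAt E x).symm) (chartAt E x x) := by
  have hx := mem_chart_source E x
  have h1 : ContMDiffAt 𝓘(𝕜, E) 𝓘(𝕜, E) ∞ (chartAt E x) x :=
    contMDiffAt_of_mem_maximalAtlas (IsManifold.chart_mem_maximalAtlas x) hx
  have h2 : ContMDiffAt 𝓘(𝕜, E) 𝓘(𝕜, E) ∞ (chartAt E x).symm (chartAt E x x) :=
    contMDiffAt_symm_of_mem_maximalAtlas (IsManifold.chart_mem_maximalAtlas x)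
      (mem_chart_target E x)
  refine ⟨fun h ↦ ?_, fun h ↦ ?_⟩
  · refine ContMDiffAt.contDiffAt (ContMDiffAt.comp _ ?_ h2)
    rwa [(chartAt E x).left_inv hx]
  · refine (ContMDiffAt.comp x h.contMDiffAt h1).congr_of_eventuallyEq ?_
    filter_upwards [(chartAt E x).open_source.mem_nhds hx] with y hy
    simp [(chartAt E x).left_inv hy]

/-- The canonical bundle is trivial when the holonomy of the Chern connection is special unitary. -/
theorem isHolomorphicallyTrivial_of_holonomy {E : Type} [NormedAddCommGroup E] [NormedSpace ℂ E]
    [FiniteDimensional ℂ E] {n : ℕ} (b : Module.Basis (Fin n) ℂ E)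
    {M : Type*} [TopologicalSpace M] [ChartedSpace E M] [IsManifold 𝓘(ℂ, E) ∞ M]
    {g : HermitianMetric E M} {D : TangentConnection E M} (hD : IsChernConnection g D)
    (hhol : ∀ x : M, holonomy D x ⊆ specialUnitary g x) :
    IsHolomorphicallyTrivial (E := E) (M := M) (E [⋀^Fin n]→L[ℂ] ℂ) (CanonicalFibre n E M) := by
  obtain ⟨κ, h0, hκ⟩ := exists_density (fun x _ ↦ det_eq_one_of_isTransport (hhol x))
    fun x ↦ .of_smooth (isSmoothTransport_one hD x)
  refine isHolomorphicallyTrivial_of_density b h0 fun x ↦ ?_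
  rw [contMDiffAt_iff_contDiffAt_comp_symm]
  exact (contDiffOn_density b hD hκ (chart_mem_atlas E x)).contDiffAt
    ((chartAt E x).open_target.mem_nhds (mem_chart_target E x))

end

/-! ### Gram determinants of Hermitian forms -/

section

variable {E : Type*} [NormedAddCommGroup E] [NormedSpace ℂ E] {n : ℕ}
  {B : E →L[ℝ] E →L[ℝ] ℝ} (b : Module.Basis (Fin n) ℂ E)

/-- The sesquilinear form, antilinear in the second variable, with real part `B`. -/
def sesquilinear (B : E →L[ℝ] E →L[ℝ] ℝ) (v w : E) : ℂ :=
  (B v w : ℂ) + B v (Complex.I • w) * Complex.I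

theorem IsHermitianForm.conj_sesquilinear (hB : IsHermitianForm B) (v w : E) :
    starRingEnd ℂ (sesquilinear B v w) = sesquilinear B w v := by
  have h1 : B v (Complex.I • w) = -B w (Complex.I • v) := by rw [← hB.I_smul_left, hB.symm]
  simp only [sesquilinear, map_add, map_mul, Complex.conj_ofReal, Complex.conj_I, hB.symm w v, h1]
  push_cast
  ring

/-- The sesquilinear form as a linear form in the first variable. -/
def IsHermitianForm.toLinear (hB : IsHermitianForm B) (w : E) : E →ₗ[ℂ] ℂ where
  toFun v := sesquilinear B v w
  map_add' v v' := by simp [sesquilinear]; ring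
  map_smul' := map_smul_of_map_I_smul
    ({ toFun := fun v ↦ sesquilinear B v w
       map_add' := fun v v' ↦ by simp [sesquilinear]; ring
       map_smul' := fun a v ↦ by simp [sesquilinear]; ring } : E →ₗ[ℝ] ℂ) fun v ↦ by
    change sesquilinear B (Complex.I • v) w = Complex.I * sesquilinear B v w
    simp only [sesquilinear, hB.I_smul_left, I_smul_I_smul_eq_neg, map_neg, neg_neg]
    push_cast
    linear_combination (-(B v (Complex.I • w) : ℂ)) * Complex.I_sq

theorem IsHermitianForm.sesquilinear_sum (hB : IsHermitianForm B) {ι : Type*} (s : Finset ι)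
    (a a' : ι → ℂ) (v v' : ι → E) :
    sesquilinear B (∑ i ∈ s, a i • v i) (∑ j ∈ s, a' j • v' j)
      = ∑ i ∈ s, ∑ j ∈ s, a i * (starRingEnd ℂ (a' j) * sesquilinear B (v i) (v' j)) := by
  have h1 (w : E) : sesquilinear B (∑ i ∈ s, a i • v i) w
      = ∑ i ∈ s, a i * sesquilinear B (v i) w := by
    have := map_sum (hB.toLinear w) (fun i ↦ a i • v i) s
    refine this.trans (Finset.sum_congr rfl fun i _ ↦ (hB.toLinear w).map_smul _ _)
  have h2 (u : E) : sesquilinear B u (∑ j ∈ s, a' j • v' j)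
      = ∑ j ∈ s, starRingEnd ℂ (a' j) * sesquilinear B u (v' j) := by
    have := map_sum (hB.toLinear u) (fun i ↦ a' i • v' i) s
    have h3 : sesquilinear B (∑ j ∈ s, a' j • v' j) u
        = ∑ j ∈ s, a' j * sesquilinear B (v' j) u :=
      this.trans (Finset.sum_congr rfl fun i _ ↦ (hB.toLinear u).map_smul _ _)
    rw [← hB.conj_sesquilinear, h3, map_sum]
    exact Finset.sum_congr rfl fun i _ ↦ by rw [map_mul, hB.conj_sesquilinear]
  rw [h1]
  exact Finset.sum_congr rfl fun i _ ↦ by rw [h2, Finset.mul_sum]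

/-- The Gram matrix of a Hermitian form in a basis. -/
def gramMatrix (B : E →L[ℝ] E →L[ℝ] ℝ) : Matrix (Fin n) (Fin n) ℂ :=
  Matrix.of fun i j ↦ sesquilinear B (b i) (b j)

/-- The Gram determinant of a Hermitian form in a basis. -/
def gramDet (B : E →L[ℝ] E →L[ℝ] ℝ) : ℂ := (gramMatrix b B).det

variable {b} in
open ComplexOrder in
theorem gramDet_pos (hB : IsHermitianForm B) (hpos : ∀ v, v ≠ 0 → 0 < B v v) :
    0 < (gramDet b B).re ∧ gramDet b B = ((gramDet b B).re : ℂ) := by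
  have h1 : (gramMatrix b B).PosDef := by
    refine Matrix.PosDef.of_dotProduct_mulVec_pos ?_ fun x hx ↦ ?_
    · ext i j
      exact hB.conj_sesquilinear _ _
    · set v : E := ∑ i, star (x i) • b i
      have hv : v ≠ 0 := fun hv ↦ hx (funext fun i ↦ by
        have := Fintype.linearIndependent_iff.1 b.linearIndependent _ hv i
        simpa using this)
      have h2 : star x ⬝ᵥ (gramMatrix b B).mulVec x = sesquilinear B v v := by
        rw [hB.sesquilinear_sum]
        simp only [dotProduct, Matrix.mulVec, Finset.mul_sum, gramMatrix, Matrix.of_apply]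
        refine Finset.sum_congr rfl fun i _ ↦ Finset.sum_congr rfl fun j _ ↦ ?_
        simp only [Pi.star_apply, RCLike.star_def, Complex.conj_conj]
        ring
      have h3 : B v (Complex.I • v) = 0 := by
        have h4 := hB.I_smul_left v v
        rw [hB.symm] at h4
        linarith
      rw [h2, sesquilinear, h3]
      simpa using hpos v hv
  have h2 := Complex.lt_def.1 h1.det_pos
  exact ⟨h2.1, Complex.ext rfl h2.2.symm⟩

theorem gramDet_smul (a : ℝ) (B : E →L[ℝ] E →L[ℝ] ℝ) :
    gramDet b (a • B) = (a : ℂ) ^ n * gramDet b B := by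
  have h : gramMatrix b (a • B) = (a : ℂ) • gramMatrix b B := by
    ext i j
    simp [gramMatrix, sesquilinear]
    ring
  rw [gramDet, h, Matrix.det_smul, Fintype.card_fin, gramDet]

theorem gramDet_bilinearComp (hB : IsHermitianForm B) (L : E →L[ℂ] E) :
    gramDet b (B.bilinearComp (L.restrictScalars ℝ) (L.restrictScalars ℝ))
      = (Complex.normSq L.det : ℂ) * gramDet b B := by
  set T := LinearMap.toMatrix b b (L : E →ₗ[ℂ] E) with hT
  have h1 (i : Fin n) : L (b i) = ∑ k, T k i • b k := by
    rw [← b.sum_repr (L (b i))]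
    refine Finset.sum_congr rfl fun k _ ↦ ?_
    rw [hT, LinearMap.toMatrix_apply]
    rfl
  have h2 : gramMatrix b (B.bilinearComp (L.restrictScalars ℝ) (L.restrictScalars ℝ))
      = T.transpose * gramMatrix b B * T.map (starRingEnd ℂ) := by
    ext i j
    have h3 : sesquilinear (B.bilinearComp (L.restrictScalars ℝ) (L.restrictScalars ℝ)) (b i) (b j)
        = sesquilinear B (L (b i)) (L (b j)) := by
      simp [sesquilinear]
    rw [gramMatrix, Matrix.of_apply, h3, h1, h1, hB.sesquilinear_sum, Finset.sum_comm]
    simp only [Matrix.mul_apply, Matrix.transpose_apply, Matrix.map_apply, gramMatrix,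
      Matrix.of_apply, Finset.sum_mul]
    refine Finset.sum_congr rfl fun k _ ↦ Finset.sum_congr rfl fun l _ ↦ ?_
    ring
  have h4 : T.det = L.det := LinearMap.det_toMatrix b (L : E →ₗ[ℂ] E)
  have h5 : (T.map (starRingEnd ℂ)).det = starRingEnd ℂ T.det := (RingHom.map_det _ _).symm
  rw [gramDet, h2, Matrix.det_mul, Matrix.det_mul, Matrix.det_transpose, h5, h4,
    ← Complex.mul_conj, gramDet]
  ring

theorem contDiff_gramDet : ContDiff ℝ ∞ (gramDet b) := by
  have h1 : gramDet b = fun B ↦ ∑ p : Equiv.Perm (Fin n),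
      (Equiv.Perm.sign p : ℂ) * ∏ i, sesquilinear B (b (p i)) (b i) := by
    funext B
    rw [gramDet, Matrix.det_apply']
    rfl
  have h2 (v w : E) : ContDiff ℝ ∞ (fun B : E →L[ℝ] E →L[ℝ] ℝ ↦ B v w) :=
    (ContinuousLinearMap.apply ℝ ℝ w).contDiff.comp
      (ContinuousLinearMap.apply ℝ (E →L[ℝ] ℝ) v).contDiff
  rw [h1]
  refine ContDiff.sum fun p _ ↦ contDiff_const.mul (contDiff_prod fun i _ ↦ ?_)
  exact (Complex.ofRealCLM.contDiff.comp (h2 _ _)).add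
    ((Complex.ofRealCLM.contDiff.comp (h2 _ _)).mul contDiff_const)

/-- The trace of an endomorphism, defined as the derivative of the determinant at the identity, the
only property of the trace that is needed. -/
def traceForm (E : Type*) [NormedAddCommGroup E] [NormedSpace ℂ E] : (E →L[ℂ] E) →L[ℂ] ℂ :=
  fderiv ℂ (fun L : E →L[ℂ] E ↦ L.det) 1

include b in
theorem hasDerivAt_det_one_add [FiniteDimensional ℂ E] (T : E →L[ℂ] E) :
    HasDerivAt (fun t : ℝ ↦ (1 + t • T).det) (traceForm E T) 0 := by
  have h1 : HasFDerivAt (fun L : E →L[ℂ] E ↦ L.det) ((traceForm E).restrictScalars ℝ)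
      (1 + (0 : ℝ) • T) := by
    rw [zero_smul, add_zero]
    exact (((contDiff_det b).differentiable (by simp)) 1).hasFDerivAt.restrictScalars ℝ
  have h2 : HasDerivAt (fun t : ℝ ↦ 1 + t • T) T 0 := by
    simpa using ((hasDerivAt_id (0 : ℝ)).smul_const T).const_add 1
  exact h1.comp_hasDerivAt (0 : ℝ) h2

/-- Variation of the Gram determinant in the direction of an endomorphism `T`: the second order
deformation `B + t B' + t² B(T ·, T ·)` is the pullback of `B` by `1 + t T`, whose Gram determinant
is `|det (1 + t T)|²` times that of `B`. -/
theorem fderiv_gramDet [FiniteDimensional ℂ E] (hB : IsHermitianForm B) {B' : E →L[ℝ] E →L[ℝ] ℝ}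
    {T : E →L[ℂ] E} (hB' : ∀ v w, B' v w = B (T v) w + B v (T w)) :
    fderiv ℝ (gramDet b) B B' = (2 * (traceForm E T).re : ℝ) * gramDet b B := by
  set T' := T.restrictScalars ℝ
  have h1 (t : ℝ) : B + t • B' + t ^ 2 • B.bilinearComp T' T'
      = B.bilinearComp ((1 + t • T).restrictScalars ℝ) ((1 + t • T).restrictScalars ℝ) := by
    ext v w
    have e (v : E) : (1 + t • T) v = v + t • T v := rfl
    simp only [add_apply, smul_apply, ContinuousLinearMap.bilinearComp_apply, hB', e,
      ContinuousLinearMap.coe_restrictScalars', map_add, map_smul, T', smul_eq_mul]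
    ring
  have h2 : HasDerivAt (fun t : ℝ ↦ B + t • B' + t ^ 2 • B.bilinearComp T' T') B' 0 := by
    have := (((hasDerivAt_id (0 : ℝ)).smul_const B').const_add B).add
      (((hasDerivAt_id (0 : ℝ)).pow 2).smul_const (B.bilinearComp T' T'))
    exact this.congr_deriv (by simp)
  have h3 : HasFDerivAt (gramDet b) (fderiv ℝ (gramDet b) B)
      (B + (0 : ℝ) • B' + (0 : ℝ) ^ 2 • B.bilinearComp T' T') := by
    have : B + (0 : ℝ) • B' + (0 : ℝ) ^ 2 • B.bilinearComp T' T' = B := by simp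
    rw [this]
    exact ((contDiff_gramDet b).differentiable (by simp) B).hasFDerivAt
  have h4 := h3.comp_hasDerivAt (0 : ℝ) h2
  have h5 : (gramDet b ∘ fun t : ℝ ↦ B + t • B' + t ^ 2 • B.bilinearComp T' T')
      = fun t : ℝ ↦ ((1 + t • T).det * starRingEnd ℂ (1 + t • T).det) * gramDet b B := by
    funext t
    rw [Function.comp_apply, h1, gramDet_bilinearComp b hB, Complex.mul_conj]
  have h6 := hasDerivAt_det_one_add b T
  have h7 : HasDerivAt (fun t : ℝ ↦ starRingEnd ℂ (1 + t • T).det)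
      (starRingEnd ℂ (traceForm E T)) 0 :=
    Complex.conjCLE.toContinuousLinearMap.hasFDerivAt.comp_hasDerivAt (0 : ℝ) h6
  have h8 := (h6.mul h7).mul_const (gramDet b B)
  rw [h5] at h4
  rw [h4.unique h8]
  have h9 : (1 + (0 : ℝ) • T).det = 1 := by
    rw [zero_smul, add_zero]; exact LinearMap.det_id
  rw [h9, map_one, mul_one, one_mul, Complex.add_conj]

end

/-! ### Existence of Hermitian metrics -/

section

variable {E : Type*} [NormedAddCommGroup E] [NormedSpace ℂ E]
  {M : Type*} [TopologicalSpace M] [ChartedSpace E M] [IsManifold 𝓘(ℂ, E) ∞ M]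

/-- The fibres of the bundle of real bilinear forms on the tangent spaces. -/
abbrev FormFibre (E : Type*) [NormedAddCommGroup E] [NormedSpace ℂ E]
    (M : Type*) [TopologicalSpace M] [ChartedSpace E M] (x : M) : Type _ :=
  TangentSpace 𝓘(ℝ, E) x →L[ℝ] TangentSpace 𝓘(ℝ, E) x →L[ℝ] Bundle.Trivial M ℝ x

theorem trivializationAt_form_apply {x : M}
    (p : Bundle.TotalSpace (E →L[ℝ] E →L[ℝ] ℝ) (FormFibre E M))
    (hp : p.proj ∈ (chartAt E x).source) (v w : E) :
    (trivializationAt (E →L[ℝ] E →L[ℝ] ℝ) (FormFibre E M) x p).2 v w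
      = (show E →L[ℝ] E →L[ℝ] ℝ from p.2) (frame (chartAt E x) p.proj v)
        (frame (chartAt E x) p.proj w) := by
  rw [hom_trivializationAt_apply]
  have h := inCoordinates_apply_eq₂ (𝕜 := ℝ) (F₁ := E) (F₂ := E) (F₃ := ℝ)
    (E₁ := fun x : M ↦ TangentSpace 𝓘(ℝ, E) x) (E₂ := fun x : M ↦ TangentSpace 𝓘(ℝ, E) x)
    (E₃ := Bundle.Trivial M ℝ) (x₀ := x) (x := p.proj) (ϕ := p.2) (v := v) (w := w) hp hp
    (Set.mem_univ _)
  refine h.trans ?_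
  have h1 := trivializationAt_real_symm hp v
  have h2 := trivializationAt_real_symm hp w
  simp only [Bundle.Trivial.fiberBundle_trivializationAt',
    Bundle.Trivial.linearMapAt_trivialization, LinearMap.id_coe, id_eq]
  exact congrArg₂ (fun v w : E ↦ (show E →L[ℝ] E →L[ℝ] ℝ from p.2) v w) h1 h2

/-- A bilinear form on the model space, seen on the tangent space at `x`. -/
def asForm (x : M) (B : E →L[ℝ] E →L[ℝ] ℝ) : FormFibre E M x := B

/-- The constant form `B` in the preferred chart at `x`. -/
def localForm (B : E →L[ℝ] E →L[ℝ] ℝ) (x y : M) : E →L[ℝ] E →L[ℝ] ℝ :=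
  B.bilinearComp ((coframe (chartAt E x) y).restrictScalars ℝ)
    ((coframe (chartAt E x) y).restrictScalars ℝ)

theorem contMDiffOn_localForm (B : E →L[ℝ] E →L[ℝ] ℝ) (x : M) :
    ContMDiffOn 𝓘(ℝ, E) (𝓘(ℝ, E).prod 𝓘(ℝ, E →L[ℝ] E →L[ℝ] ℝ)) ∞
      (fun y ↦ (⟨y, asForm y (localForm B x y)⟩ :
        Bundle.TotalSpace (E →L[ℝ] E →L[ℝ] ℝ) (FormFibre E M)))
      (chartAt E x).source := by
  have h := ((trivializationAt (E →L[ℝ] E →L[ℝ] ℝ) (FormFibre E M) x).contMDiffOn_section_iff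
    (IB := 𝓘(ℝ, E)) (n := ∞) (s := fun y ↦ asForm y (localForm B x y)) (chartAt E x).open_source
    (fun y hy ↦ ⟨hy, hy, Set.mem_univ _⟩)).2
  refine h ((contMDiffOn_const (c := B)).congr fun y hy ↦ ?_)
  ext v w
  refine (trivializationAt_form_apply ⟨y, asForm y (localForm B x y)⟩ hy v w).trans ?_
  change B (coframe (chartAt E x) y (frame (chartAt E x) y v))
    (coframe (chartAt E x) y (frame (chartAt E x) y w)) = B v w
  rw [coframe_frame (chart_mem_atlas E x) hy, coframe_frame (chart_mem_atlas E x) hy]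

variable [FiniteDimensional ℂ E]

theorem isVonNBounded_of_pos {B : E →L[ℝ] E →L[ℝ] ℝ} (hpos : ∀ v, v ≠ 0 → 0 < B v v) :
    Bornology.IsVonNBounded ℝ {v : E | B v v < 1} := by
  have : FiniteDimensional ℝ E := FiniteDimensional.complexToReal E
  have : ProperSpace E := FiniteDimensional.proper ℝ E
  obtain ⟨c, hc, hle⟩ := (isCompact_sphere (0 : E) 1).exists_forall_le' (a := 0)
    (f := fun v ↦ B v v) (by fun_prop)
    fun v hv ↦ hpos v (by rintro rfl; simp at hv)
  rw [NormedSpace.isVonNBounded_iff, isBounded_iff_forall_norm_le]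
  refine ⟨c⁻¹ + 1, fun v hv ↦ ?_⟩
  have h1 : c * ‖v‖ ^ 2 < 1 := by
    refine lt_of_le_of_lt ?_ hv
    rcases eq_or_ne v 0 with rfl | hv0
    · simp
    · have h2 := hle (‖v‖⁻¹ • v) (by simp [norm_smul, hv0])
      have h3 : B (‖v‖⁻¹ • v) (‖v‖⁻¹ • v) = ‖v‖⁻¹ ^ 2 * B v v := by
        simp only [map_smul, smul_apply, smul_eq_mul]; ring
      rw [h3, inv_pow, ← div_eq_inv_mul, le_div_iff₀ (by positivity)] at h2
      exact h2
  have h2 : ‖v‖ ^ 2 < c⁻¹ := by rwa [← one_div, lt_div_iff₀ hc, mul_comm]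
  nlinarith [norm_nonneg v, sq_nonneg (‖v‖ - 1)]

/-- A smooth field of positive Hermitian forms is a Hermitian metric. -/
def HermitianMetric.ofForm (B : M → E →L[ℝ] E →L[ℝ] ℝ) (hB : ∀ x, IsHermitianForm (B x))
    (hpos : ∀ x v, v ≠ 0 → 0 < B x v v)
    (hsmooth : ContMDiff 𝓘(ℝ, E) (𝓘(ℝ, E).prod 𝓘(ℝ, E →L[ℝ] E →L[ℝ] ℝ)) ∞
      (fun y ↦ (⟨y, asForm y (B y)⟩ : Bundle.TotalSpace (E →L[ℝ] E →L[ℝ] ℝ) (FormFibre E M)))) :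
    HermitianMetric E M where
  inner := B
  symm x := (hB x).symm
  pos := hpos
  isVonNBounded x := isVonNBounded_of_pos (E := E) (hpos x)
  contMDiff := hsmooth
  inner_J x := (hB x).I_smul_I_smul

/-- Hermitian metrics exist, by a partition of unity. -/
theorem nonempty_hermitianMetric [T2Space M] [SigmaCompactSpace M] {B : E →L[ℝ] E →L[ℝ] ℝ}
    (hB : IsHermitianForm B) (hpos : ∀ v, v ≠ 0 → 0 < B v v) : Nonempty (HermitianMetric E M) := by
  have : FiniteDimensional ℝ E := FiniteDimensional.complexToReal E
  let t (x : M) : Set (FormFibre E M x) :=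
    {B | IsHermitianForm (show E →L[ℝ] E →L[ℝ] ℝ from B) ∧
      ∀ v : E, v ≠ 0 → 0 < (show E →L[ℝ] E →L[ℝ] ℝ from B) v v}
  have ht (x : M) : Convex ℝ (t x) := by
    have key : Convex ℝ {B : E →L[ℝ] E →L[ℝ] ℝ | IsHermitianForm B ∧
        ∀ v : E, v ≠ 0 → 0 < B v v} := by
      intro B hB B' hB' a a' ha ha' haa'
      refine ⟨⟨fun v w ↦ ?_, fun v w ↦ ?_⟩, fun v hv ↦ ?_⟩
      · simp [hB.1.symm v w, hB'.1.symm v w]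
      · simp [hB.1.I_smul_I_smul v w, hB'.1.I_smul_I_smul v w]
      · have h1 := hB.2 v hv
        have h2 := hB'.2 v hv
        simp only [add_apply, smul_apply, smul_eq_mul]
        rcases ha.eq_or_lt with rfl | ha
        · rw [zero_add] at haa'
          simpa [haa'] using h2
        · exact add_pos_of_pos_of_nonneg (mul_pos ha h1) (mul_nonneg ha' h2.le)
    exact key
  obtain ⟨s, hs⟩ := exists_contMDiffSection_forall_mem_convex_of_local (I := 𝓘(ℝ, E)) (n := ⊤)
    (F_fiber := E →L[ℝ] E →L[ℝ] ℝ) (FormFibre E M) t ht fun x ↦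
    ⟨(chartAt E x).source, (chartAt E x).open_source.mem_nhds (mem_chart_source E x),
      fun y ↦ asForm y (localForm B x y), contMDiffOn_localForm B x, fun y hy ↦ by
      have hinj (v : E) (hv : v ≠ 0) : coframe (chartAt E x) y v ≠ 0 := fun h ↦ hv <| by
        rw [← frame_coframe (chart_mem_atlas E x) hy v, h, map_zero]
      refine ⟨⟨fun v w ↦ hB.symm _ _, fun v w ↦ ?_⟩, fun v hv ↦ hpos _ (hinj v hv)⟩
      change B (coframe _ y _) (coframe _ y _) = B (coframe _ y _) (coframe _ y _)
      rw [(coframe _ y).map_smul, (coframe _ y).map_smul, hB.I_smul_I_smul]⟩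
  exact ⟨HermitianMetric.ofForm (fun x ↦ s x) (fun x ↦ (hs x).1) (fun x ↦ (hs x).2)
    s.contMDiff_toFun⟩

/-- The real part of the inner product of a complex inner product space. -/
def realInnerForm (V : Type*) [NormedAddCommGroup V] [InnerProductSpace ℂ V] :
    V →L[ℝ] V →L[ℝ] ℝ :=
  (ContinuousLinearMap.compL ℝ V ℂ ℝ Complex.reCLM).comp
    (isBoundedBilinearMap_inner (𝕜 := ℂ) (E := V)).toContinuousLinearMap

theorem isHermitianForm_realInnerForm (V : Type*) [NormedAddCommGroup V] [InnerProductSpace ℂ V] :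
    IsHermitianForm (realInnerForm V) where
  symm v w := inner_re_symm (𝕜 := ℂ) v w
  I_smul_I_smul v w := by
    change (inner ℂ (Complex.I • v) (Complex.I • w)).re = (inner ℂ v w).re
    rw [inner_smul_left, inner_smul_right, ← mul_assoc, Complex.conj_I, neg_mul, Complex.I_mul_I,
      neg_neg, one_mul]

theorem realInnerForm_self_pos {V : Type*} [NormedAddCommGroup V] [InnerProductSpace ℂ V]
    {v : V} (hv : v ≠ 0) : 0 < realInnerForm V v v :=
  (re_inner_self_pos (𝕜 := ℂ)).2 hv

end

/-! ### Metrics for which a holomorphic volume form has constant length -/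

section

variable {E : Type*} [NormedAddCommGroup E] [NormedSpace ℂ E] {n : ℕ}
  {M : Type*} [TopologicalSpace M] [ChartedSpace E M] [IsManifold 𝓘(ℂ, E) ∞ M]
  {c : OpenPartialHomeomorph M E} {g : HermitianMetric E M} (b : Module.Basis (Fin n) ℂ E)

theorem gramDet_metricInChart (g : HermitianMetric E M) (c : OpenPartialHomeomorph M E) (z : E) :
    gramDet b (metricInChart g c z)
      = (Complex.normSq (frame c (c.symm z)).det : ℂ) * gramDet b (g.form (c.symm z)) :=
  gramDet_bilinearComp b (g.isHermitianForm_form _) _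

variable [FiniteDimensional ℂ E]

include b in
/-- A conformal change of a Hermitian metric by the factor `u ^ (1 / n)`, where `u` is the quotient
of `|κ|²` by the Gram determinant, makes the length of a given density constant. -/
theorem exists_metric_gramDet_eq (hn : n ≠ 0) (g : HermitianMetric E M) {κ : M → ℂ}
    (h0 : ∀ x, κ x ≠ 0)
    (hκ : ∀ x, ContMDiffAt 𝓘(ℂ, E) 𝓘(ℂ, ℂ) ∞ (densityInChart κ (chartAt E x)) x) :
    ∃ g' : HermitianMetric E M, ∀ x, gramDet b (g'.form x) = (Complex.normSq (κ x) : ℂ) := by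
  have hG (x : M) := gramDet_pos (b := b) (g.isHermitianForm_form x) (g.form_pos x)
  set u : M → ℝ := fun x ↦ Complex.normSq (κ x) / (gramDet b (g.form x)).re with hu
  have hu0 (x : M) : 0 < u x := div_pos (Complex.normSq_pos.2 (h0 x)) (hG x).1
  have hsmooth (x : M) : ContMDiffAt 𝓘(ℝ, E) 𝓘(ℝ, ℝ) ∞ (fun y ↦ u y ^ (1 / n : ℝ)) x := by
    rw [contMDiffAt_iff_contDiffAt_comp_symm]
    have hx := mem_chart_target E x
    have h1 : ContDiffAt ℝ ∞ (densityInChart κ (chartAt E x) ∘ (chartAt E x).symm)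
        (chartAt E x x) := ((contMDiffAt_iff_contDiffAt_comp_symm x).1 (hκ x)).restrict_scalars ℝ
    have h2 : ContDiffAt ℝ ∞ (fun z ↦ (gramDet b (metricInChart g (chartAt E x) z)).re)
        (chartAt E x x) := Complex.reCLM.contDiff.contDiffAt.comp _
      ((contDiff_gramDet b).contDiffAt.comp _
        (contDiffAt_metricInChart g (chart_mem_atlas E x) hx))
    have h3 : ContDiffAt ℝ ∞ (fun z ↦ Complex.normSq
        (densityInChart κ (chartAt E x) ((chartAt E x).symm z))) (chartAt E x x) := by
      have e1 := Complex.reCLM.contDiff.contDiffAt.comp (chartAt E x x) h1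
      have e2 := Complex.imCLM.contDiff.contDiffAt.comp (chartAt E x x) h1
      exact (e1.mul e1).add (e2.mul e2)
    have h4 := gramDet_pos (b := b) (isHermitianForm_metricInChart g (chartAt E x) _)
      (metricInChart_pos g (chart_mem_atlas E x) hx)
    have h5 : u ∘ (chartAt E x).symm =ᶠ[𝓝 (chartAt E x x)] fun z ↦ Complex.normSq
        (densityInChart κ (chartAt E x) ((chartAt E x).symm z))
        / (gramDet b (metricInChart g (chartAt E x) z)).re := by
      filter_upwards [(chartAt E x).open_target.mem_nhds hx] with z hz
      have e1 : (frame (chartAt E x) ((chartAt E x).symm z)).det ≠ 0 :=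
        right_ne_zero_of_mul_eq_one
          (det_frame_mul_det_coframe (chart_mem_atlas E x) ((chartAt E x).map_target hz))
      rw [gramDet_metricInChart, Complex.re_ofReal_mul, densityInChart, Complex.normSq_mul,
        mul_comm, mul_div_mul_left _ _ (Complex.normSq_pos.2 e1).ne']
      rfl
    have h6 : ContDiffAt ℝ ∞ (u ∘ (chartAt E x).symm) (chartAt E x x) :=
      (h3.div h2 h4.1.ne').congr_of_eventuallyEq h5
    exact h6.rpow_const_of_ne (hu0 _).ne'
  have hpos (x : M) : 0 < u x ^ (1 / n : ℝ) := Real.rpow_pos_of_pos (hu0 x) _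
  refine ⟨HermitianMetric.ofForm (fun x ↦ u x ^ (1 / n : ℝ) • g.form x) (fun x ↦ ?_)
    (fun x v hv ↦ mul_pos (hpos x) (g.form_pos x v hv)) ?_, fun x ↦ ?_⟩
  · have h := g.isHermitianForm_form x
    exact ⟨fun v w ↦ congrArg (_ * ·) (h.symm v w),
      fun v w ↦ congrArg (_ * ·) (h.I_smul_I_smul v w)⟩
  · intro x
    exact (hsmooth x).smul_section (g.contMDiff x)
  · change gramDet b (u x ^ (1 / n : ℝ) • g.form x) = _
    rw [gramDet_smul, (hG x).2, ← Complex.ofReal_pow,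
      ← Real.rpow_natCast, ← Real.rpow_mul (hu0 x).le, one_div,
      inv_mul_cancel₀ (Nat.cast_ne_zero.2 hn), Real.rpow_one, ← Complex.ofReal_mul,
      div_mul_cancel₀ _ (hG x).1.ne']

end

/-! ### Holomorphic volume forms of constant length are parallel -/

section

variable {E : Type*} [NormedAddCommGroup E] [NormedSpace ℂ E] [FiniteDimensional ℂ E] {n : ℕ}
  {M : Type*} [TopologicalSpace M] [ChartedSpace E M] [IsManifold 𝓘(ℂ, E) ∞ M]
  {c : OpenPartialHomeomorph M E} {g : HermitianMetric E M} {D : TangentConnection E M}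
  (b : Module.Basis (Fin n) ℂ E)

include b in
/-- If the Gram determinant of the metric is `|f|²` with `f` holomorphic, the logarithmic derivative
of `f` is the trace of the connection form: both are complex linear in `v`, and their real parts
agree. -/
theorem fderiv_eq_mul_traceForm (hc : c ∈ atlas E M) {z : E} (hz : z ∈ c.target) {f : E → ℂ}
    (hf : DifferentiableAt ℂ f z) (hfz : f z ≠ 0)
    (hfg : ∀ y ∈ c.target, gramDet b (metricInChart g c y) = (Complex.normSq (f y) : ℂ)) (v : E) :
    fderiv ℂ f z v = f z * traceForm E (complexForm (chartForm g c) z v) := by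
  have hI := chartForm_I_smul_left g hc hz
  have hI' := chartForm_I_smul_right g hc hz
  set θ : E → ℂ := fun v ↦ fderiv ℂ f z v - f z * traceForm E (complexForm (chartForm g c) z v)
    with hθ
  have hθI (v : E) : θ (Complex.I • v) = Complex.I * θ v := by
    simp only [hθ, complexForm_I_smul hI hI', map_smul, smul_eq_mul]
    ring
  have hre (v : E) : (starRingEnd ℂ (f z) * θ v).re = 0 := by
    have h1 : HasFDerivAt (fun y ↦ gramDet b (metricInChart g c y))
        ((fderiv ℝ (gramDet b) (metricInChart g c z)).comp (fderiv ℝ (metricInChart g c) z)) z :=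
      ((contDiff_gramDet b).differentiable (by simp) _).hasFDerivAt.comp z
        (hasFDerivAt_metricInChart g hc hz)
    have h2 := fderiv_gramDet b (isHermitianForm_metricInChart g c z)
      (B' := fderiv ℝ (metricInChart g c) z v) (T := complexForm (chartForm g c) z v) fun w u ↦ by
        rw [complexForm_apply hI', complexForm_apply hI', metric_chartForm g hc hz]
    have h3 := hf.hasFDerivAt.restrictScalars ℝ
    have h4 : HasFDerivAt (fun y ↦ starRingEnd ℂ (f y)) (Complex.conjCLE.toContinuousLinearMap.comp
        ((fderiv ℂ f z).restrictScalars ℝ)) z :=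
      Complex.conjCLE.toContinuousLinearMap.hasFDerivAt.comp z h3
    have h5 := h3.mul h4
    have h6 : (fun y ↦ gramDet b (metricInChart g c y)) =ᶠ[𝓝 z]
        fun y ↦ f y * starRingEnd ℂ (f y) := by
      filter_upwards [c.open_target.mem_nhds hz] with y hy
      rw [hfg y hy, Complex.mul_conj]
    have h7 := congrArg (fun L : E →L[ℝ] ℂ ↦ L v) (h1.unique (h5.congr_of_eventuallyEq h6))
    simp only [ContinuousLinearMap.comp_apply, h2, hfg z hz] at h7
    have h8 : ((2 * (traceForm E (complexForm (chartForm g c) z v)).re : ℝ) : ℂ)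
        * (Complex.normSq (f z) : ℂ)
        = f z * starRingEnd ℂ (fderiv ℂ f z v) + starRingEnd ℂ (f z) * fderiv ℂ f z v := h7
    have h9 := congrArg Complex.re h8
    simp only [hθ, Complex.normSq_apply] at h9 ⊢
    simp only [Complex.ofReal_re, Complex.ofReal_im, mul_zero,
      sub_zero, Complex.add_re, Complex.mul_re,
      Complex.conj_re, Complex.conj_im, Complex.sub_re, Complex.sub_im, Complex.mul_im] at h9 ⊢
    linear_combination (-1 / 2) * h9
  have h1 : starRingEnd ℂ (f z) * θ v = 0 := by
    refine Complex.ext (hre v) ?_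
    have h2 := hre (Complex.I • v)
    rw [hθI, mul_left_comm, Complex.I_mul_re, neg_eq_zero] at h2
    exact h2
  have h2 : θ v = 0 := (mul_eq_zero.1 h1).resolve_left ((map_ne_zero _).2 hfz)
  exact sub_eq_zero.1 h2

include b in
/-- Liouville's formula: the derivative of the determinant along a solution of a linear differential
equation. -/
theorem hasDerivWithinAt_det {Ξ : ℝ → E →L[ℂ] E} {T : E →L[ℂ] E} {S : Set ℝ} {s : ℝ}
    (h : HasDerivWithinAt Ξ (T * Ξ s) S s) :
    HasDerivWithinAt (fun τ ↦ (Ξ τ).det) (traceForm E T * (Ξ s).det) S s := by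
  have hd (L : E →L[ℂ] E) := ((contDiff_det b).differentiable (by simp) L).hasFDerivAt
  have h1 : fderiv ℂ (fun L : E →L[ℂ] E ↦ L.det) (Ξ s) (T * Ξ s)
      = traceForm E T * (Ξ s).det := by
    have e1 : HasFDerivAt (fun L : E →L[ℂ] E ↦ L * Ξ s)
        ((ContinuousLinearMap.mul ℂ (E →L[ℂ] E)).flip (Ξ s)) 1 :=
      ((ContinuousLinearMap.mul ℂ (E →L[ℂ] E)).flip (Ξ s)).hasFDerivAt
    have e2 : HasFDerivAt (fun L : E →L[ℂ] E ↦ L.det)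
      (fderiv ℂ (fun L : E →L[ℂ] E ↦ L.det) (Ξ s)) (1 * Ξ s) := by
      rw [one_mul]; exact hd _
    have e3 := e2.comp (1 : E →L[ℂ] E) e1
    have e4 := (hd 1).mul_const (Ξ s).det
    have e5 : ((fun L : E →L[ℂ] E ↦ L.det) ∘ fun L ↦ L * Ξ s)
        = fun L : E →L[ℂ] E ↦ L.det * (Ξ s).det := funext fun L ↦ LinearMap.det_comp _ _
    rw [e5] at e3
    have e6 := congrArg (fun φ : (E →L[ℂ] E) →L[ℂ] ℂ ↦ φ T) (e3.unique e4)
    refine Eq.trans e6 ?_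
    change (Ξ s).det * traceForm E T = _
    rw [mul_comm]
  have h2 := ((hd (Ξ s)).restrictScalars ℝ).comp_hasDerivWithinAt s h
  exact h2.congr_deriv h1

/-- The endomorphism with prescribed values on a basis. -/
def ofBasisValues (w : Fin n → E) : E →L[ℂ] E :=
  ∑ i, (LinearMap.toContinuousLinearMap (b.coord i)).smulRight (w i)

theorem ofBasisValues_apply (w : Fin n → E) (j : Fin n) : ofBasisValues b w (b j) = w j := by
  simp [ofBasisValues, Finsupp.single_apply]

/-- The value of the volume form with density `κ` on parallel fields is constant: by Liouville's
formula, the variation of the determinant of the coordinates cancels that of the coefficient. -/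
theorem hasDerivWithinAt_density_mul_det {κ : M → ℂ} (h0 : ∀ x, κ x ≠ 0)
    (hκ : ∀ x, ContMDiffAt 𝓘(ℂ, E) 𝓘(ℂ, ℂ) ∞ (densityInChart κ (chartAt E x)) x)
    (hg : ∀ x, gramDet b (g.form x) = (Complex.normSq (κ x) : ℂ)) {γ : ℝ → M} {S : Set ℝ} {s : ℝ}
    (hγ : MDifferentiableWithinAt 𝓘(ℝ, ℝ) 𝓘(ℝ, E) γ S s) (hs : s ∈ S)
    {X : Fin n → ℝ → TangentBundle 𝓘(ℝ, E) M} (hX : ∀ i, ∀ τ ∈ S, (X i τ).proj = γ τ)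
    (hpar : ∀ i, IsParallelInChartAt g (chartAt E (γ s)) (X i) S s) :
    HasDerivWithinAt (fun τ ↦ κ (γ τ) * (ofBasisValues b fun i ↦ ((X i τ).2 : E)).det) 0 S s := by
  set c := chartAt E (γ s) with hcdef
  have hc : c ∈ atlas E M := chart_mem_atlas E (γ s)
  have hsc : γ s ∈ c.source := mem_chart_source E (γ s)
  have hz := c.map_source hsc
  set f : E → ℂ := densityInChart κ c ∘ c.symm with hf
  set Ξ : ℝ → E →L[ℂ] E := fun τ ↦ ofBasisValues b fun i ↦ coord c (X i) τ with hΞ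
  set u : E := coframe c (γ s) (velocityWithin γ S s) with hu
  set T : E →L[ℂ] E := complexForm (chartForm g c) (c (γ s)) u with hT
  -- In the chart, the value is `f` times the determinant of the coordinates.
  have key (τ : ℝ) (hτ : τ ∈ S) (hτc : γ τ ∈ c.source) :
      κ (γ τ) * (ofBasisValues b fun i ↦ ((X i τ).2 : E)).det = f (c (γ τ)) * (Ξ τ).det := by
    have h1 : (ofBasisValues b fun i ↦ ((X i τ).2 : E)) = frame c (γ τ) * Ξ τ := by
      refine ContinuousLinearMap.coe_injective (b.ext fun i ↦ ?_)
      have h2 : frame c (γ τ) (coord c (X i) τ) = ((X i τ).2 : E) := by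
        unfold coord
        rw [hX i τ hτ]
        exact frame_coframe hc hτc _
      refine (ofBasisValues_apply b _ i).trans (h2.symm.trans ?_)
      exact congrArg (fun v : E ↦ frame c (γ τ) v)
        (ofBasisValues_apply b (fun i ↦ coord c (X i) τ) i).symm
    have h3 : (frame c (γ τ) * Ξ τ).det = (frame c (γ τ)).det * (Ξ τ).det :=
      LinearMap.det_comp _ _
    rw [h1, h3, hf, Function.comp_apply, c.left_inv hτc, densityInChart, mul_assoc]
  have hΞ' : HasDerivWithinAt Ξ (-T * Ξ s) S s := by
    have h1 (i : Fin n) : HasDerivWithinAt (coord c (X i)) (-T (coord c (X i) s)) S s := by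
      refine (hpar i).congr_deriv ?_
      rw [velocityCoord_eq (hX i) hs, hX i s hs, hT,
        complexForm_apply (chartForm_I_smul_right g hc hz)]
    have h2 : HasDerivWithinAt Ξ (ofBasisValues b fun i ↦ -T (coord c (X i) s)) S s := by
      refine HasDerivWithinAt.fun_sum fun i _ ↦ ?_
      exact ((ContinuousLinearMap.smulRightL ℂ E E (LinearMap.toContinuousLinearMap
        (b.coord i))).restrictScalars ℝ).hasFDerivAt.comp_hasDerivWithinAt s (h1 i)
    refine h2.congr_deriv (ContinuousLinearMap.coe_injective (b.ext fun i ↦ ?_))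
    refine (ofBasisValues_apply b _ i).trans ?_
    change _ = -T (Ξ s (b i))
    rw [hΞ, ofBasisValues_apply]
  have hfd : DifferentiableAt ℂ f (c (γ s)) :=
    ((contMDiffAt_iff_contDiffAt_comp_symm (γ s)).1 (hκ (γ s))).differentiableAt (by simp)
  have hf0 : f (c (γ s)) ≠ 0 := by
    rw [hf, Function.comp_apply, c.left_inv hsc]
    exact mul_ne_zero (h0 _) (right_ne_zero_of_mul_eq_one (det_frame_mul_det_coframe hc hsc))
  have hfg (y : E) (_ : y ∈ c.target) :
      gramDet b (metricInChart g c y) = (Complex.normSq (f y) : ℂ) := by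
    rw [gramDet_metricInChart, hg, hf, Function.comp_apply, densityInChart, Complex.normSq_mul]
    push_cast
    ring
  have h1 : HasDerivWithinAt (fun τ ↦ f (c (γ τ))) (fderiv ℂ f (c (γ s)) u) S s :=
    (hfd.hasFDerivAt.restrictScalars ℝ).comp_hasDerivWithinAt s
      (hasDerivWithinAt_chart_comp hc hsc hγ)
  have h2 := h1.mul (hasDerivWithinAt_det b hΞ')
  have h3 : (fun τ ↦ κ (γ τ) * (ofBasisValues b fun i ↦ ((X i τ).2 : E)).det) =ᶠ[𝓝[S] s]
      fun τ ↦ f (c (γ τ)) * (Ξ τ).det := by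
    filter_upwards [hγ.continuousWithinAt.eventually (c.open_source.mem_nhds hsc),
      self_mem_nhdsWithin] with τ hτ hτS
    exact key τ hτS hτ
  refine (h2.congr_of_eventuallyEq h3 (key s hs hsc)).congr_deriv ?_
  rw [fderiv_eq_mul_traceForm b hc hz hfd hf0 hfg, map_neg]
  ring

/-- The holonomy preserves a holomorphic volume form of constant length, so that it has determinant
one. -/
theorem det_holonomy_eq_one (hD : IsChernConnection g D) {κ : M → ℂ} (h0 : ∀ x, κ x ≠ 0)
    (hκ : ∀ x, ContMDiffAt 𝓘(ℂ, E) 𝓘(ℂ, ℂ) ∞ (densityInChart κ (chartAt E x)) x)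
    (hg : ∀ x, gramDet b (g.form x) = (Complex.normSq (κ x) : ℂ)) {x : M}
    {P : TangentSpace 𝓘(ℝ, E) x →ₗ[ℝ] TangentSpace 𝓘(ℝ, E) x} (hP : P ∈ holonomy D x)
    {Q : E →ₗ[ℂ] E} (hQ : ∀ v : E, Q v = P v) : LinearMap.det Q = 1 := by
  obtain ⟨γ, h⟩ := hP
  choose X hX hX0 hX1 using fun i ↦ h (b i : E)
  have hconst := γ.eq_of_hasDerivWithinAt_zero
    (q := fun τ ↦ κ (γ.toFun τ) * (ofBasisValues b fun i ↦ ((X i τ).2 : E)).det)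
    fun i hi s hs ↦ hasDerivWithinAt_density_mul_det b h0 hκ hg
      ((γ.smooth i hi).mdifferentiableOn (by simp) s hs) hs
      (fun j τ hτ ↦ (hX j).1 τ (γ.Icc_subset hi hτ)) fun j ↦
        (hX j).isParallelInChartAt hD hi hs (chart_mem_atlas E _) (by
          rw [(hX j).1 s (γ.Icc_subset hi hs)]; exact mem_chart_source E _)
  have e0 : (ofBasisValues b fun i ↦ ((X i 0).2 : E)).det = 1 := by
    have : (ofBasisValues b fun i ↦ ((X i 0).2 : E)) = .id ℂ E := by
      refine ContinuousLinearMap.coe_injective (b.ext fun i ↦ ?_)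
      refine (ofBasisValues_apply b _ i).trans ?_
      rw [hX0 i]
      rfl
    rw [this]
    exact LinearMap.det_id
  have e1 : (ofBasisValues b fun i ↦ ((X i 1).2 : E)).det = LinearMap.det Q := by
    refine congrArg LinearMap.det (b.ext fun i ↦ ?_)
    refine (ofBasisValues_apply b _ i).trans ?_
    rw [hX1 i]
    exact (hQ (b i)).symm
  simp only [e0, e1, γ.source, γ.target, mul_one] at hconst
  exact (mul_eq_left₀ (h0 x)).1 hconst

include b in
/-- A nowhere vanishing holomorphic density yields a Hermitian metric whose Chern connection has
special unitary holonomy. -/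
theorem exists_holonomy_subset_specialUnitary [T2Space M] [SigmaCompactSpace M]
    {B : E →L[ℝ] E →L[ℝ] ℝ} (hB : IsHermitianForm B) (hpos : ∀ v, v ≠ 0 → 0 < B v v)
    {κ : M → ℂ} (h0 : ∀ x, κ x ≠ 0)
    (hκ : ∀ x, ContMDiffAt 𝓘(ℂ, E) 𝓘(ℂ, ℂ) ∞ (densityInChart κ (chartAt E x)) x) :
    ∃ g : HermitianMetric E M, ∃ D : TangentConnection E M, IsChernConnection g D ∧
      ∀ x : M, holonomy D x ⊆ specialUnitary g x := by
  obtain ⟨g₀⟩ := nonempty_hermitianMetric (M := M) hB hpos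
  -- In dimension zero, every determinant is one and no change of the metric is needed.
  obtain ⟨g, hg⟩ : ∃ g : HermitianMetric E M,
      n = 0 ∨ ∀ x, gramDet b (g.form x) = (Complex.normSq (κ x) : ℂ) := by
    rcases eq_or_ne n 0 with hn | hn
    · exact ⟨g₀, .inl hn⟩
    · obtain ⟨g, hg⟩ := exists_metric_gramDet_eq b hn g₀ h0 hκ
      exact ⟨g, .inr hg⟩
  have hD := isChernConnection_chernConnection g
  refine ⟨g, chernConnection g, hD, fun x P hP ↦ ⟨holonomy_isometry hD hP, ?_⟩⟩
  let Q : E →ₗ[ℂ] E :=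
    { toFun := fun v ↦ P v
      map_add' := fun v w ↦ P.map_add v w
      map_smul' := map_smul_of_map_I_smul
        ({ toFun := fun v ↦ P v
           map_add' := fun v w ↦ P.map_add v w
           map_smul' := fun a v ↦ P.map_smul a v } : E →ₗ[ℝ] E) (holonomy_map_I_smul hD hP) }
  refine ⟨Q, fun v ↦ rfl, ?_⟩
  rcases hg with rfl | hg
  · have h1 : (Q : E →ₗ[ℂ] E) = LinearMap.id := b.ext fun i ↦ i.elim0
    exact (congrArg LinearMap.det h1).trans LinearMap.det_id
  · exact det_holonomy_eq_one b hD h0 hκ hg hP (Q := Q) fun v ↦ rfl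

end

end ChernHolonomy

end

theorem proposition1p3 (n : ℕ) (M : Type*) [TopologicalSpace M] [T2Space M] [CompactSpace M]
    [ChartedSpace (EuclideanSpace ℂ (Fin n)) M]
    [IsManifold 𝓘(ℂ, EuclideanSpace ℂ (Fin n)) ∞ M] :
    (∃ g : ChernHolonomy.HermitianMetric (EuclideanSpace ℂ (Fin n)) M,
      ∃ D : ChernHolonomy.TangentConnection (EuclideanSpace ℂ (Fin n)) M,
        ChernHolonomy.IsChernConnection g D ∧
          ∀ x : M, ChernHolonomy.holonomy D x ⊆ ChernHolonomy.specialUnitary g x) ↔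
      ChernHolonomy.IsHolomorphicallyTrivial (E := EuclideanSpace ℂ (Fin n)) (M := M)
        (EuclideanSpace ℂ (Fin n) [⋀^Fin n]→L[ℂ] ℂ)
        (ChernHolonomy.CanonicalFibre n (EuclideanSpace ℂ (Fin n)) M) := by
  have b := (EuclideanSpace.basisFun (Fin n) ℂ).toBasis
  refine ⟨fun ⟨g, D, hD, hhol⟩ ↦ ChernHolonomy.isHolomorphicallyTrivial_of_holonomy b hD hhol,
    fun h ↦ ?_⟩
  obtain ⟨κ, h0, hκ⟩ := ChernHolonomy.exists_density_of_isHolomorphicallyTrivial b h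
  exact ChernHolonomy.exists_holonomy_subset_specialUnitary b
    (ChernHolonomy.isHermitianForm_realInnerForm _)
    (fun _ hv ↦ ChernHolonomy.realInnerForm_self_pos hv) h0 hκ
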